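/- **Setting.** Let $\mathfrak g$ be a finite-dimensional complex Lie algebra, $T\ge 1$, $\omega$ a primitive $T$-th root of unity, $\sigma$ a linear automorphism of $\mathfrak g$ with $\sigma^T=\mathrm{id}$ and $\tau$ an anti-linear involutive automorphism of $\mathfrak g$ with $(\sigma\tau)^2=\mathrm{id}$. Let $\langle\cdot,\cdot\rangle$ be a non-degenerate invariant symmetric $\mathbb C$-bilinear form on $\mathfrak g$ with $\langle\sigma\mathsf x,\sigma\mathsf y\rangle=\langle\mathsf x,\mathsf y\rangle$ and $\langle\tau\mathsf x,\tau\mathsf y\rangle=\overline{\langle\mathsf x,\mathsf y\rangle}$. Let $\widetilde{\mathfrak g}=\mathfrak g\otimes\mathbb C[t,t^{-1}]\oplus\mathbb C\mathsf K\oplus\mathbb C\mathsf D$ be the untwisted affine Kac–Moody algebra, write $\mathsf x_n=\mathsf x\otimes t^n$, and let $(\mathsf x_m+\alpha\mathsf K+a\mathsf D\,|\,\mathsf y_n+\beta\mathsf K+b\mathsf D)=\langle\mathsf x,\mathsf y\rangle\delta_{m+n,0}+\alpha b+\beta a$. Extend $\sigma$ linearly by $\sigma\mathsf x_n=(\sigma\mathsf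 x)_n$, $\sigma\mathsf K=\mathsf K$, $\sigma\mathsf D=\mathsf D$, and $\tau$ anti-linearly by $\tau\mathsf x_n=(\tau\mathsf x)_{-n}$, $\tau\mathsf K=-\mathsf K$, $\tau\mathsf D=-\mathsf D$. Put $\mathsf F_n\widetilde{\mathfrak g}=\mathfrak g\otimes t^n\mathbb C[t]$ and $\overline{\mathsf F}_n\widetilde{\mathfrak g}=\mathfrak g\otimes t^{-n}\mathbb C[t^{-1}]$ for $n\ge 0$. Let $\{I^{\tilde a}\}$ be the basis of $\widetilde{\mathfrak g}$ consisting of the $b_n$ ($b$ in a basis of $\mathfrak g$, $n\in\mathbb Z$), $\mathsf K$ and $\mathsf D$, and $\{I_{\tilde a}\}$ its dual basis with respect to $(\cdot|\cdot)$; repeated indices are summed over. The dihedral group $\Pi=\langle\mathsf s,\mathsf t\mid\mathsf s^T=\mathsf t^2=(\mathsf s\mathsf t)^2=1\rangle$ acts on $\widetilde{\mathfrak g}$ by $\mathsf s\mapsto\sigma$, $\mathsf t\mapsto\tau$ and on $\mathbb P^1$ by $\mathsf s:z\mapsto\omega z$, $\mathsf t:z\mapsto\bar z$. Let $\boldsymbol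 z\subset\mathbb P^1$ be a finite set which contains $\infty$ and whose points have pairwise disjoint $\Pi$-orbits, with multiplicities $n_x\in\mathbb Z_{\ge1}$ for $x\in\boldsymbol z$; if $0\notin\boldsymbol z$ put $n_0=0$. Let $\boldsymbol z_{\rm c}$ be the set of points of $\boldsymbol z$ with trivial stabiliser $\Pi_x$, let $\boldsymbol{\mathcal Z}'=(\boldsymbol z\setminus\{0,\infty\})\cup\overline{\boldsymbol z_{\rm c}}$, and put $n_{\bar x}=n_x$ for $x\in\boldsymbol z_{\rm c}$. **Observables.** For $x\in\boldsymbol z$ finite let $\mathcal T_x=\widetilde{\mathfrak g}\otimes\mathbb C[\varepsilon_x]/(\varepsilon_x^{n_x})$, and let $\mathcal T_\infty=\widetilde{\mathfrak g}\otimes\varepsilon_\infty\mathbb C[\varepsilon_\infty]/(\varepsilon_\infty^{n_\infty})$. Let $\mathsf s$ act on $\mathcal T_x$ by $\mathsf X\otimes\varepsilon_x^p\mapsto\omega^{-p}\sigma\mathsf X\otimes\varepsilon_x^p$ for $x$ finite and by $\mathsf X\otimes\varepsilon_\infty^p\mapsto\omega^{p}\sigma\mathsf X\otimes\varepsilon_\infty^p$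 for $x=\infty$, and $\mathsf t$ by $\mathsf X\otimes\varepsilon_x^p\mapsto\tau\mathsf X\otimes\varepsilon_x^p$. Let $\widetilde{\mathfrak g}^{\mathcal D}=\bigoplus_{x\in\boldsymbol z}(\mathcal T_x)^{\Pi_x}$, a real vector space, $\widetilde{\mathfrak g}^{\mathcal D}_{\mathbb C}=\widetilde{\mathfrak g}^{\mathcal D}\otimes_{\mathbb R}\mathbb C$, and $c$ the complex conjugation on the second factor. For $\mathsf X\in\widetilde{\mathfrak g}$ define $\mathsf X^{(x)}_{p}\in\widetilde{\mathfrak g}^{\mathcal D}_{\mathbb C}$ as follows. * If $x\in\boldsymbol z_{\rm c}$: $\mathsf X^{(x)}_p=\tfrac12\big((\mathsf X\otimes\varepsilon_x^p)\otimes1-(i\mathsf X\otimes\varepsilon_x^p)\otimes i\big)$, and $\mathsf X^{(\bar x)}_p=c(\mathsf X^{(x)}_p)$. * If $x\in\boldsymbol z\setminus\{0,\infty\}$ and $\Pi_x=\langle\mathsf s^k\mathsf t\rangle$: $\mathsf X^{(x)}_p=(\pi\mathsf X\otimes\varepsilon_x^p)\otimes1-(\pi(i\mathsf X)\otimes\varepsilon_x^p)\otimes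 i$ with $\pi\mathsf X=\tfrac12(\mathsf X+\omega^{-kp}\sigma^k\tau\mathsf X)$. * If $x\in\{0,\infty\}\cap\boldsymbol z$: the same formula with $\pi\mathsf X=\tfrac12(\mathsf X'+\tau\mathsf X')$, where $\mathsf X'$ is the projection of $\mathsf X$ onto the eigenspace of $\sigma$ of eigenvalue $\omega^{p}$ (if $x=0$), resp. $\omega^{-p}$ (if $x=\infty$). Here $0\le p<n_x$ for $x$ finite and $1\le p<n_\infty$ for $x=\infty$. Let $\mathsf F_n\widetilde{\mathfrak g}^{\mathcal D}_{\mathbb C}$ be the span of the $\mathsf X^{(x)}_p$ with $x\in\boldsymbol z$, $\mathsf X\in\mathsf F_n\widetilde{\mathfrak g}$ and of the $\mathsf X^{(\bar x)}_p$ with $x\in\boldsymbol z_{\rm c}$, $\mathsf X\in\overline{\mathsf F}_n\widetilde{\mathfrak g}$. Let $S$ be the symmetric algebra of $\widetilde{\mathfrak g}^{\mathcal D}_{\mathbb C}$, $\hat S$ its completion with respect to the ideals $(\mathsf F_n\widetilde{\mathfrak g}^{\mathcal D}_{\mathbb C})S\cap c(\mathsf F_n\widetilde{\mathfrak g}^{\mathcal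 D}_{\mathbb C})S$, and $\mathfrak F$ the completion of $\widetilde{\mathfrak g}\otimes\widetilde{\mathfrak g}^{\mathcal D}_{\mathbb C}$ with respect to the subspaces $\mathsf F_n\widetilde{\mathfrak g}\otimes c(\mathsf F_n\widetilde{\mathfrak g}^{\mathcal D}_{\mathbb C})+\overline{\mathsf F}_n\widetilde{\mathfrak g}\otimes\mathsf F_n\widetilde{\mathfrak g}^{\mathcal D}_{\mathbb C}$. The bilinear map $(\mathsf X\otimes a,\mathsf Y\otimes b)\mapsto(\mathsf X|\mathsf Y)\,ab$ is continuous and so extends to a bilinear map $(\cdot|\cdot):\mathfrak F\times\mathfrak F\to\hat S$; likewise $\sigma\otimes\mathrm{id}$ extends to $\sigma:\mathfrak F\to\mathfrak F$. **Lax matrix.** The formal fields are the elements of $\mathfrak F$ $$\mathcal A^x_p=I_{\tilde a}\otimes (I^{\tilde a})^{(x)}_p\quad(x\in\boldsymbol z),\qquad \mathcal A^{\bar x}_p=\tau I_{\tilde a}\otimes (I^{\tilde a})^{(\bar x)}_p\quad(x\in\boldsymbol z_{\rm c}),$$ and $\mathcal A^x_p=0$ if $p\ge n_x$ (in particular $\mathcal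 A^0_p=0$ for all $p$ if $0\notin\boldsymbol z$). Let $R$ be the algebra of rational functions on $\mathbb P^1$ whose poles lie in $\Pi\boldsymbol z$. The formal Lax matrix $\mathcal L\in\mathfrak F\otimes R$ is $$\mathcal L(z)=\frac1T\sum_{k=0}^{T-1}\sum_{x\in\boldsymbol{\mathcal Z}'}\sum_{p\ge0}\frac{\omega^{-k}\sigma^k\mathcal A^x_p}{(\omega^{-k}z-x)^{p+1}}+\sum_{p\ge0}\mathcal A^0_pz^{-p-1}-\sum_{q\ge0}\mathcal A^\infty_{q+1}z^q .$$ Extend $(\cdot|\cdot)$ to $\mathfrak F\otimes R$ with values in $\hat S\otimes R$ by $(\mathcal X\otimes f\,|\,\mathcal Y\otimes g)=(\mathcal X|\mathcal Y)\otimes fg$. **Proposition.** In $\hat S\otimes R$, $$\tfrac12\big(\mathcal L(z)\big|\mathcal L(z)\big)=\frac1{T^2}\sum_{k=0}^{T-1}\sum_{x\in\boldsymbol{\mathcal Z}'}\sum_{p=0}^{2n_x-1}\frac{\omega^{k(p-1)}\mathcal H^x_p}{(z-\omega^kx)^{p+1}}+\sum_{\substack{0\le p\le 2n_0-1\\ p\equiv1\bmod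 T}}\mathcal H^0_p\,z^{-p-1}+\sum_{\substack{0\le q\le2n_\infty-4\\ q+2\equiv0\bmod T}}\mathcal H^\infty_q\,z^q,$$ where the formal quadratic Gaudin Hamiltonians are $$\mathcal H^x_p=\sum_{\substack{0\le\ell\le T-1,\ y\in\boldsymbol{\mathcal Z}'\cup\{0\}\\(\ell,y)\ne(0,x)}}\ \sum_{q,s\ge0}\binom{q+s}{s}(-1)^s\frac{\omega^{\ell q}\big(\mathcal A^x_{p+s}\big|\sigma^\ell\mathcal A^y_q\big)}{(x-\omega^\ell y)^{q+s+1}}-T\sum_{q,s\ge0}\binom qs x^{q-s}\big(\mathcal A^x_{p+s}\big|\mathcal A^\infty_{q+1}\big)+\frac12\sum_{q=0}^{p-1}\big(\mathcal A^x_q\big|\mathcal A^x_{p-q-1}\big),$$ $$\mathcal H^0_p=\sum_{x\in\boldsymbol{\mathcal Z}'}\sum_{q,s\ge0}(-1)^{q+1}\binom{q+s}{s}\frac{\big(\mathcal A^0_{p+s}\big|\mathcal A^x_q\big)}{x^{q+s+1}}-\sum_{q\ge0}\big(\mathcal A^0_{p+q}\big|\mathcal A^\infty_{q+1}\big)+\frac12\sum_{q=0}^{p-1}\big(\mathcal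 A^0_{p-q-1}\big|\mathcal A^0_q\big),$$ $$\mathcal H^\infty_q=-\sum_{x\in\boldsymbol{\mathcal Z}'}\sum_{p,s\ge0}\binom sp x^{s-p}\big(\mathcal A^x_p\big|\mathcal A^\infty_{q+s+2}\big)-\sum_{p\ge0}\big(\mathcal A^0_p\big|\mathcal A^\infty_{q+p+2}\big)+\frac12\sum_{p=0}^q\big(\mathcal A^\infty_{p+1}\big|\mathcal A^\infty_{q-p+1}\big).$$ -/

import Mathlib

open scoped TensorProduct

/-! ### Descending filtrations, completions, extension of maps by continuity -/

/-- A descending `ℕ`-filtration of a complex vector space by linear subspaces. -/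
structure DescFil (M : Type*) [AddCommGroup M] [Module ℂ M] where
  F : ℕ → Submodule ℂ M
  anti : ∀ n m, n ≤ m → F m ≤ F n

namespace DescFil

variable {M N P : Type*} [AddCommGroup M] [Module ℂ M] [AddCommGroup N] [Module ℂ N]
  [AddCommGroup P] [Module ℂ P]

/-- The completion `lim M / F n`: the compatible sequences in the product of the `M / F n`. -/
def completion (A : DescFil M) : Submodule ℂ (∀ n, M ⧸ A.F n) where
  carrier := {v | ∀ n m (h : n ≤ m), Submodule.factor (A.anti n m h) (v m) = v n}
  add_mem' := fun {a b} ha hb n m h => by simp [ha n m h, hb n m h]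
  zero_mem' := fun n m h => by simp
  smul_mem' := fun c a ha n m h => by simp [ha n m h]

/-- The element of the completion given by a sequence with `a m - a n ∈ F n` for `n ≤ m`. -/
def ofSeq (A : DescFil M) (a : ℕ → M) (h : ∀ n m, n ≤ m → a m - a n ∈ A.F n) :
    A.completion :=
  ⟨fun n => (A.F n).mkQ (a n), fun n m hnm => by
    rw [Submodule.factor_mk]
    exact (Submodule.Quotient.eq _).2 (h n m hnm)⟩

/-- A linear map which preserves the filtrations, extended to the completions. -/
def mapCompl (A : DescFil M) (B : DescFil N) (f : M →ₗ[ℂ] N)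
    (hf : ∀ n x, x ∈ A.F n → f x ∈ B.F n) : A.completion →ₗ[ℂ] B.completion where
  toFun v := ⟨fun n => (A.F n).mapQ (B.F n) f (hf n) (v.1 n), fun n m h => by
    have hv := v.2 n m h
    obtain ⟨a, ha⟩ := Submodule.mkQ_surjective _ (v.1 m)
    rw [← ha, Submodule.factor_mk] at hv
    change Submodule.factor _ ((A.F m).mapQ (B.F m) f (hf m) (v.1 m)) =
      (A.F n).mapQ (B.F n) f (hf n) (v.1 n)
    rw [← ha, ← hv]
    rfl⟩
  map_add' u v := by ext n; simp
  map_smul' c v := by ext n; simp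

theorem sub_mem_of_rep (A : DescFil M) (u : A.completion) (m m' : ℕ) (x x' : M) (h : m ≤ m')
    (hx : (A.F m).mkQ x = u.1 m) (hx' : (A.F m').mkQ x' = u.1 m') : x' - x ∈ A.F m := by
  have := u.2 m m' h
  rw [← hx', ← hx, Submodule.factor_mk] at this
  exact (Submodule.Quotient.eq _).1 this

/-- Continuity of a bilinear map, with respect to the topologies in which the `F n` form a basis
of neighbourhoods of `0`. -/
def BilinCont (A : DescFil M) (B : DescFil N) (C : DescFil P) (f : M →ₗ[ℂ] N →ₗ[ℂ] P) : Prop :=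
  (∀ n, ∃ m, ∀ x ∈ A.F m, ∀ y ∈ B.F m, f x y ∈ C.F n) ∧
  (∀ n x, ∃ m, ∀ y ∈ B.F m, f x y ∈ C.F n) ∧
  (∀ n y, ∃ m, ∀ x ∈ A.F m, f x y ∈ C.F n)

/-- For `u`, `v` in the completions, the class of `f x y` modulo `C.F n` does not depend on the
representatives `x` of `u m` and `y` of `v m`, nor on `m`, if `m` is large. -/
theorem exists_stable (A : DescFil M) (B : DescFil N) (C : DescFil P)
    {f : M →ₗ[ℂ] N →ₗ[ℂ] P} (hf : BilinCont A B C f) (u : A.completion) (v : B.completion)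
    (n : ℕ) : ∃ w : P ⧸ C.F n, ∃ m₀, ∀ m ≥ m₀, ∀ x y, (A.F m).mkQ x = u.1 m →
      (B.F m).mkQ y = v.1 m → (C.F n).mkQ (f x y) = w := by
  obtain ⟨m₁, h₁⟩ := hf.1 n
  obtain ⟨x₀, hx₀⟩ := Submodule.mkQ_surjective _ (u.1 m₁)
  obtain ⟨y₀, hy₀⟩ := Submodule.mkQ_surjective _ (v.1 m₁)
  obtain ⟨m₂, h₂⟩ := hf.2.1 n x₀
  obtain ⟨m₃, h₃⟩ := hf.2.2 n y₀
  set m₀ := m₁ + m₂ + m₃ with hm₀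
  obtain ⟨X, hX⟩ := Submodule.mkQ_surjective _ (u.1 m₀)
  obtain ⟨Y, hY⟩ := Submodule.mkQ_surjective _ (v.1 m₀)
  refine ⟨(C.F n).mkQ (f X Y), m₀, fun m hm x y hx hy => ?_⟩
  refine (Submodule.Quotient.eq _).2 ?_
  have dx := sub_mem_of_rep A u m₀ m X x hm hX hx
  have dy := sub_mem_of_rep B v m₀ m Y y hm hY hy
  have ex := sub_mem_of_rep A u m₁ m₀ x₀ X (by omega) hx₀ hX
  have ey := sub_mem_of_rep B v m₁ m y₀ y (by omega) hy₀ hy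
  have e : f x y - f X Y = f (x - X) y₀ + f (x - X) (y - y₀) + (f x₀ (y - Y) +
      f (X - x₀) (y - Y)) := by
    simp only [map_sub, LinearMap.sub_apply]; abel
  rw [e]
  refine add_mem (add_mem (h₃ _ (A.anti _ _ (by omega) dx)) (h₁ _ (A.anti _ _ (by omega) dx) _ ey))
    (add_mem (h₂ _ (B.anti _ _ (by omega) dy)) (h₁ _ ex _ (B.anti _ _ (by omega) dy)))

/-- The extension by continuity of a continuous bilinear map to the completions. Its component
of index `n` at `(u, v)` is the class modulo `C.F n` of `f x y` where `x` and `y` represent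
`u m` and `v m` for any large `m`. -/
noncomputable def extend₂ (A : DescFil M) (B : DescFil N) (C : DescFil P)
    (f : M →ₗ[ℂ] N →ₗ[ℂ] P) (hf : BilinCont A B C f) :
    A.completion →ₗ[ℂ] B.completion →ₗ[ℂ] C.completion :=
  have uniq : ∀ (u : A.completion) (v : B.completion) (n : ℕ) (w : P ⧸ C.F n),
      (∃ m₀, ∀ m ≥ m₀, ∃ x y, (A.F m).mkQ x = u.1 m ∧ (B.F m).mkQ y = v.1 m ∧
        (C.F n).mkQ (f x y) = w) →
      (exists_stable A B C hf u v n).choose = w := by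
    rintro u v n w ⟨m₁, h₁⟩
    obtain ⟨m₀, h₀⟩ := (exists_stable A B C hf u v n).choose_spec
    obtain ⟨x, y, hx, hy, hw⟩ := h₁ (m₀ + m₁) (by omega)
    rw [← hw, h₀ (m₀ + m₁) (by omega) x y hx hy]
  have rep : ∀ (u : A.completion) (v : B.completion) (n : ℕ), ∃ m₀, ∀ m ≥ m₀, ∀ x y,
      (A.F m).mkQ x = u.1 m → (B.F m).mkQ y = v.1 m →
      (C.F n).mkQ (f x y) = (exists_stable A B C hf u v n).choose :=
    fun u v n => (exists_stable A B C hf u v n).choose_spec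
  LinearMap.mk₂ ℂ
    (fun u v => ⟨fun n => (exists_stable A B C hf u v n).choose, fun n m h => by
      obtain ⟨m₀, h₀⟩ := rep u v m
      refine (uniq u v n _ ⟨m₀, fun k hk => ?_⟩).symm
      obtain ⟨x, hx⟩ := Submodule.mkQ_surjective _ (u.1 k)
      obtain ⟨y, hy⟩ := Submodule.mkQ_surjective _ (v.1 k)
      refine ⟨x, y, hx, hy, ?_⟩
      have e := congrArg (Submodule.factor (C.anti n m h)) (h₀ k hk x y hx hy)
      rw [Submodule.factor_mk] at e
      exact e⟩)
    (fun u u' v => by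
      ext n
      obtain ⟨m₀, h₀⟩ := rep u v n
      obtain ⟨m₁, h₁⟩ := rep u' v n
      refine uniq _ _ _ _ ⟨m₀ + m₁, fun k hk => ?_⟩
      obtain ⟨x, hx⟩ := Submodule.mkQ_surjective _ (u.1 k)
      obtain ⟨x', hx'⟩ := Submodule.mkQ_surjective _ (u'.1 k)
      obtain ⟨y, hy⟩ := Submodule.mkQ_surjective _ (v.1 k)
      refine ⟨x + x', y, ?_, hy, ?_⟩
      · rw [map_add, hx, hx']; rfl
      · rw [map_add, LinearMap.add_apply, map_add, h₀ k (by omega) x y hx hy,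
          h₁ k (by omega) x' y hx' hy]; rfl)
    (fun c u v => by
      ext n
      obtain ⟨m₀, h₀⟩ := rep u v n
      refine uniq _ _ _ _ ⟨m₀, fun k hk => ?_⟩
      obtain ⟨x, hx⟩ := Submodule.mkQ_surjective _ (u.1 k)
      obtain ⟨y, hy⟩ := Submodule.mkQ_surjective _ (v.1 k)
      refine ⟨c • x, y, ?_, hy, ?_⟩
      · rw [map_smul, hx]; rfl
      · rw [map_smul, LinearMap.smul_apply, map_smul, h₀ k (by omega) x y hx hy]; rfl)
    (fun u v v' => by
      ext n
      obtain ⟨m₀, h₀⟩ := rep u v n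
      obtain ⟨m₁, h₁⟩ := rep u v' n
      refine uniq _ _ _ _ ⟨m₀ + m₁, fun k hk => ?_⟩
      obtain ⟨x, hx⟩ := Submodule.mkQ_surjective _ (u.1 k)
      obtain ⟨y, hy⟩ := Submodule.mkQ_surjective _ (v.1 k)
      obtain ⟨y', hy'⟩ := Submodule.mkQ_surjective _ (v'.1 k)
      refine ⟨x, y + y', hx, ?_, ?_⟩
      · rw [map_add, hy, hy']; rfl
      · rw [map_add, map_add, h₀ k (by omega) x y hx hy, h₁ k (by omega) x y' hx hy']; rfl)
    (fun c u v => by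
      ext n
      obtain ⟨m₀, h₀⟩ := rep u v n
      refine uniq _ _ _ _ ⟨m₀, fun k hk => ?_⟩
      obtain ⟨x, hx⟩ := Submodule.mkQ_surjective _ (u.1 k)
      obtain ⟨y, hy⟩ := Submodule.mkQ_surjective _ (v.1 k)
      refine ⟨x, c • y, hx, ?_, ?_⟩
      · rw [map_smul, hy]; rfl
      · rw [map_smul, map_smul, h₀ k (by omega) x y hx hy]; rfl)

end DescFil

/-! ### The affine Kac–Moody algebra -/

/-- The underlying vector space `𝔤 ⊗ ℂ[t, t⁻¹] ⊕ ℂ K ⊕ ℂ D` of the untwisted affine Kac–Moody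
algebra of `𝔤`. An element of the loop algebra is the finitely supported family of its
coefficients: `Finsupp.single n x` is `x ⊗ tⁿ`. -/
def Aff (𝔤 : Type*) [AddCommGroup 𝔤] [Module ℂ 𝔤] : Type _ := (ℤ →₀ 𝔤) × ℂ × ℂ

namespace Aff

variable {𝔤 : Type*} [AddCommGroup 𝔤] [Module ℂ 𝔤]

noncomputable instance : AddCommGroup (Aff 𝔤) := inferInstanceAs (AddCommGroup ((ℤ →₀ 𝔤) × ℂ × ℂ))

noncomputable instance : Module ℂ (Aff 𝔤) := inferInstanceAs (Module ℂ ((ℤ →₀ 𝔤) × ℂ × ℂ))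

/-- The loop part of an element. -/
noncomputable def loop : Aff 𝔤 →ₗ[ℂ] (ℤ →₀ 𝔤) := LinearMap.fst ℂ (ℤ →₀ 𝔤) (ℂ × ℂ)

/-- The coefficient of `K`. -/
noncomputable def coeffK : Aff 𝔤 →ₗ[ℂ] ℂ :=
  LinearMap.fst ℂ ℂ ℂ ∘ₗ LinearMap.snd ℂ (ℤ →₀ 𝔤) (ℂ × ℂ)

/-- The coefficient of `D`. -/
noncomputable def coeffD : Aff 𝔤 →ₗ[ℂ] ℂ :=
  LinearMap.snd ℂ ℂ ℂ ∘ₗ LinearMap.snd ℂ (ℤ →₀ 𝔤) (ℂ × ℂ)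

/-- `x ⊗ tⁿ`. -/
noncomputable def mono (n : ℤ) (x : 𝔤) : Aff 𝔤 := (Finsupp.single n x, 0, 0)

noncomputable def K : Aff 𝔤 := (0, 1, 0)

noncomputable def D : Aff 𝔤 := (0, 0, 1)

theorem ext' {X Y : Aff 𝔤} (h : ∀ n, loop X n = loop Y n) (hK : coeffK X = coeffK Y)
    (hD : coeffD X = coeffD Y) : X = Y :=
  Prod.ext (Finsupp.ext h) (Prod.ext hK hD)

/-- The bilinear form `(x_m + αK + aD | y_n + βK + bD) = δ_{m+n,0} ⟨x, y⟩ + α b + β a`. -/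
noncomputable def form (κ : LinearMap.BilinForm ℂ 𝔤) : LinearMap.BilinForm ℂ (Aff 𝔤) :=
  (Finsupp.lsum ℂ (fun n : ℤ => κ.compl₂ (Finsupp.lapply (-n)))).compl₁₂ loop loop
    + (LinearMap.mul ℂ ℂ).compl₁₂ coeffK coeffD + (LinearMap.mul ℂ ℂ).compl₁₂ coeffD coeffK

/-- `F_n = 𝔤 ⊗ tⁿ ℂ[t]`. -/
def fil (n : ℕ) : Submodule ℂ (Aff 𝔤) where
  carrier := {X | (∀ j : ℤ, j < n → loop X j = 0) ∧ coeffK X = 0 ∧ coeffD X = 0}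
  add_mem' := fun {a b} ha hb =>
    ⟨fun j hj => by simp [ha.1 j hj, hb.1 j hj], by simp [ha.2.1, hb.2.1], by simp [ha.2.2, hb.2.2]⟩
  zero_mem' := by simp
  smul_mem' := fun c a ha =>
    ⟨fun j hj => by simp [ha.1 j hj], by simp [ha.2.1], by simp [ha.2.2]⟩

/-- `F̄_n = 𝔤 ⊗ t⁻ⁿ ℂ[t⁻¹]`. -/
def filBar (n : ℕ) : Submodule ℂ (Aff 𝔤) where
  carrier := {X | (∀ j : ℤ, -(n : ℤ) < j → loop X j = 0) ∧ coeffK X = 0 ∧ coeffD X = 0}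
  add_mem' := fun {a b} ha hb =>
    ⟨fun j hj => by simp [ha.1 j hj, hb.1 j hj], by simp [ha.2.1, hb.2.1], by simp [ha.2.2, hb.2.2]⟩
  zero_mem' := by simp
  smul_mem' := fun c a ha =>
    ⟨fun j hj => by simp [ha.1 j hj], by simp [ha.2.1], by simp [ha.2.2]⟩

theorem fil_anti (n m : ℕ) (h : n ≤ m) : (fil m : Submodule ℂ (Aff 𝔤)) ≤ fil n :=
  fun _ hX => ⟨fun j hj => hX.1 j (by omega), hX.2⟩

theorem filBar_anti (n m : ℕ) (h : n ≤ m) : (filBar m : Submodule ℂ (Aff 𝔤)) ≤ filBar n :=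
  fun _ hX => ⟨fun j hj => hX.1 j (by omega), hX.2⟩

theorem loop_mono (n j : ℤ) (x : 𝔤) : loop (mono n x) j = Finsupp.single n x j := rfl

theorem mono_mem_fil {n : ℕ} {j : ℤ} (h : (n : ℤ) ≤ j) (x : 𝔤) : mono j x ∈ fil n :=
  ⟨fun i hi => by rw [loop_mono, Finsupp.single_eq_of_ne (by omega)], rfl, rfl⟩

theorem mono_mem_filBar {n : ℕ} {j : ℤ} (h : j ≤ -(n : ℤ)) (x : 𝔤) : mono j x ∈ filBar n :=
  ⟨fun i hi => by rw [loop_mono, Finsupp.single_eq_of_ne (by omega)], rfl, rfl⟩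

theorem form_apply (κ : LinearMap.BilinForm ℂ 𝔤) (X Y : Aff 𝔤) :
    form κ X Y = ((loop X).sum fun n x => κ x (loop Y (-n))) + coeffK X * coeffD Y
      + coeffD X * coeffK Y := by
  simp [form, Finsupp.sum]

end Aff

/-! ### The data -/

/-- The data of a dihedral affine Gaudin model: a complex Lie algebra `𝔤` with an invariant form
and an action of the dihedral group of order `2 T` generated by a linear automorphism `σ` and an
anti-linear automorphism `τ`, and a divisor with support `z ∪ {∞}`. -/
structure GaudinData (𝔤 : Type*) [LieRing 𝔤] [LieAlgebra ℂ 𝔤] where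
  T : ℕ
  T_pos : 1 ≤ T
  ω : ℂ
  ω_prim : IsPrimitiveRoot ω T
  σ : 𝔤 →ₗ⁅ℂ⁆ 𝔤
  σ_pow : ∀ x, (⇑σ)^[T] x = x
  τ : 𝔤 →ₛₗ[starRingEnd ℂ] 𝔤
  τ_lie : ∀ x y, τ ⁅x, y⁆ = ⁅τ x, τ y⁆
  τ_τ : ∀ x, τ (τ x) = x
  σ_τ : ∀ x, σ (τ (σ (τ x))) = x
  /-- the complexification of the form on the real form of fixed points of `τ` -/
  κ : LinearMap.BilinForm ℂ 𝔤
  κ_symm : κ.IsSymm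
  κ_nondeg : κ.Nondegenerate
  κ_inv : ∀ x y w, κ ⁅x, y⁆ w = κ x ⁅y, w⁆
  κ_σ : ∀ x y, κ (σ x) (σ y) = κ x y
  κ_τ : ∀ x y, κ (τ x) (τ y) = starRingEnd ℂ (κ x y)
  /-- the multiplicities at the finite points -/
  n : ℂ → ℕ
  /-- the finite points of the support of the divisor -/
  z : Finset ℂ
  mem_z : ∀ x, x ∈ z ↔ n x ≠ 0
  /-- distinct points have disjoint orbits -/
  disj : ∀ x ∈ z, ∀ y ∈ z, ∀ k : ℕ,
    (ω ^ k * x = y ∨ ω ^ k * (starRingEnd ℂ x) = y) → x = y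
  /-- the multiplicity at infinity -/
  nInf : ℕ
  nInf_pos : 1 ≤ nInf

namespace GaudinData

variable {𝔤 : Type*} [LieRing 𝔤] [LieAlgebra ℂ 𝔤] (G : GaudinData 𝔤)

/-- `σ` on the affine algebra: `x_n ↦ (σ x)_n`, `K ↦ K`, `D ↦ D`. -/
noncomputable def sig : Module.End ℂ (Aff 𝔤) :=
  LinearMap.prodMap (Finsupp.mapRange.linearMap (G.σ : 𝔤 →ₗ[ℂ] 𝔤)) LinearMap.id

/-- `τ` on the affine algebra: `x_n ↦ (τ x)_{-n}`, `K ↦ -K`, `D ↦ -D`, extended anti-linearly. -/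
noncomputable def tau : Aff 𝔤 →ₛₗ[starRingEnd ℂ] Aff 𝔤 where
  toFun X := (Finsupp.equivMapDomain (Equiv.neg ℤ) (Finsupp.mapRange G.τ (map_zero _) X.1),
    -starRingEnd ℂ X.2.1, -starRingEnd ℂ X.2.2)
  map_add' X Y := by
    refine Aff.ext' (fun n => ?_) ?_ ?_
    · change G.τ ((X.1 + Y.1) _) = G.τ (X.1 _) + G.τ (Y.1 _)
      rw [Finsupp.add_apply, map_add]
    · change -starRingEnd ℂ (X.2.1 + Y.2.1) = -starRingEnd ℂ X.2.1 + -starRingEnd ℂ Y.2.1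
      rw [map_add]; ring
    · change -starRingEnd ℂ (X.2.2 + Y.2.2) = -starRingEnd ℂ X.2.2 + -starRingEnd ℂ Y.2.2
      rw [map_add]; ring
  map_smul' c X := by
    refine Aff.ext' (fun n => ?_) ?_ ?_
    · change G.τ ((c • X.1) _) = starRingEnd ℂ c • G.τ (X.1 _)
      rw [Finsupp.smul_apply, map_smulₛₗ]
    · change -starRingEnd ℂ (c * X.2.1) = starRingEnd ℂ c * -starRingEnd ℂ X.2.1
      rw [map_mul]; ring
    · change -starRingEnd ℂ (c * X.2.2) = starRingEnd ℂ c * -starRingEnd ℂ X.2.2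
      rw [map_mul]; ring

theorem loop_sig (X : Aff 𝔤) (n : ℤ) : Aff.loop (G.sig X) n = G.σ (Aff.loop X n) := rfl

theorem loop_tau (X : Aff 𝔤) (n : ℤ) : Aff.loop (G.tau X) n = G.τ (Aff.loop X (-n)) := rfl

theorem loop_sig_pow (X : Aff 𝔤) (n : ℤ) (k : ℕ) :
    Aff.loop ((G.sig ^ k) X) n = (⇑G.σ)^[k] (Aff.loop X n) := by
  induction k with
  | zero => rfl
  | succ k ih =>
    rw [pow_succ', Module.End.mul_apply, loop_sig, ih, Function.iterate_succ_apply']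

theorem coeff_sig_pow (X : Aff 𝔤) (k : ℕ) :
    Aff.coeffK ((G.sig ^ k) X) = Aff.coeffK X ∧ Aff.coeffD ((G.sig ^ k) X) = Aff.coeffD X := by
  induction k with
  | zero => exact ⟨rfl, rfl⟩
  | succ k ih => rw [pow_succ', Module.End.mul_apply]; exact ih

theorem sig_pow_T : G.sig ^ G.T = 1 := by
  refine LinearMap.ext fun X => Aff.ext' (fun n => ?_) (G.coeff_sig_pow X _).1
    (G.coeff_sig_pow X _).2
  rw [loop_sig_pow, G.σ_pow]; rfl

theorem tau_tau (X : Aff 𝔤) : G.tau (G.tau X) = X := by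
  refine Aff.ext' (fun n => ?_) ?_ ?_
  · rw [loop_tau, loop_tau, G.τ_τ, neg_neg]
  · change -starRingEnd ℂ (-starRingEnd ℂ X.2.1) = X.2.1
    simp
  · change -starRingEnd ℂ (-starRingEnd ℂ X.2.2) = X.2.2
    simp

theorem sig_tau_sig (X : Aff 𝔤) : G.sig (G.tau (G.sig X)) = G.tau X := by
  refine Aff.ext' (fun n => ?_) rfl rfl
  rw [loop_sig, loop_tau, loop_sig, loop_tau]
  conv_lhs => rw [← G.τ_τ (Aff.loop X (-n))]
  exact G.σ_τ _

theorem sig_mem_fil {n : ℕ} {X : Aff 𝔤} (h : X ∈ Aff.fil n) : G.sig X ∈ Aff.fil n :=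
  ⟨fun j hj => by rw [loop_sig, h.1 j hj, map_zero], h.2.1, h.2.2⟩

theorem sig_mem_filBar {n : ℕ} {X : Aff 𝔤} (h : X ∈ Aff.filBar n) : G.sig X ∈ Aff.filBar n :=
  ⟨fun j hj => by rw [loop_sig, h.1 j hj, map_zero], h.2.1, h.2.2⟩

theorem coeff_tau (X : Aff 𝔤) : Aff.coeffK (G.tau X) = -starRingEnd ℂ (Aff.coeffK X) ∧
    Aff.coeffD (G.tau X) = -starRingEnd ℂ (Aff.coeffD X) := ⟨rfl, rfl⟩

theorem tau_mem_fil {n : ℕ} {X : Aff 𝔤} (h : X ∈ Aff.filBar n) : G.tau X ∈ Aff.fil n :=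
  ⟨fun j hj => by rw [loop_tau, h.1 _ (by omega), map_zero],
    by rw [(G.coeff_tau X).1, h.2.1]; simp, by rw [(G.coeff_tau X).2, h.2.2]; simp⟩

theorem tau_mem_filBar {n : ℕ} {X : Aff 𝔤} (h : X ∈ Aff.fil n) : G.tau X ∈ Aff.filBar n :=
  ⟨fun j hj => by rw [loop_tau, h.1 _ (by omega), map_zero],
    by rw [(G.coeff_tau X).1, h.2.1]; simp, by rw [(G.coeff_tau X).2, h.2.2]; simp⟩

/-! ### The real Takiff algebra and its complexification -/

/-- The exponents `p` such that `ε_x ^ p` occurs at the point `x` of the Riemann sphere. -/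
def IsExp (x : OnePoint ℂ) (p : ℕ) : Prop :=
  x.elim (1 ≤ p ∧ p < G.nInf) (fun a => p < G.n a)

/-- `ε_x ↦ twist x • ε_x` is the action of the rotation `s`. -/
noncomputable def twist (x : OnePoint ℂ) : ℂ := x.elim G.ω (fun _ => G.ω⁻¹)

/-- The rotation `s` of order `T` acting on the coefficient of `ε_x ^ p`:
`s (X ⊗ ε_x ^ p) = hatS x p X ⊗ ε_x ^ p`. The reflection `t` acts on it by `tau`. -/
noncomputable def hatS (x : OnePoint ℂ) (p : ℕ) : Module.End ℂ (Aff 𝔤) := G.twist x ^ p • G.sig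

/-- `s ^ k` on the Riemann sphere. -/
noncomputable def rot (k : ℕ) : OnePoint ℂ → OnePoint ℂ := OnePoint.map fun a => G.ω ^ k * a

/-- `s ^ k t` on the Riemann sphere. -/
noncomputable def refl (k : ℕ) : OnePoint ℂ → OnePoint ℂ :=
  OnePoint.map fun a => G.ω ^ k * starRingEnd ℂ a

/-- The `X` for which `X ⊗ ε_x ^ p` lies in the Takiff algebra at `x` and is invariant under the
stabiliser of `x` in the dihedral group. -/
noncomputable def slot (x : OnePoint ℂ) (p : ℕ) : Submodule ℝ (Aff 𝔤) where
  carrier := {X | (¬ G.IsExp x p → X = 0) ∧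
    (∀ k, G.rot k x = x → (G.hatS x p ^ k) X = X) ∧
    (∀ k, G.refl k x = x → (G.hatS x p ^ k) (G.tau X) = X)}
  add_mem' := fun {X Y} hX hY => ⟨fun h => by rw [hX.1 h, hY.1 h, add_zero],
    fun k h => by rw [map_add, hX.2.1 k h, hY.2.1 k h],
    fun k h => by rw [map_add, map_add, hX.2.2 k h, hY.2.2 k h]⟩
  zero_mem' := ⟨fun _ => rfl, fun k _ => map_zero _, fun k _ => by rw [map_zero, map_zero]⟩
  smul_mem' := fun c X hX => ⟨fun h => by rw [hX.1 h, smul_zero],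
    fun k h => by rw [← Complex.coe_smul, map_smul, hX.2.1 k h],
    fun k h => by rw [← Complex.coe_smul, map_smulₛₗ, Complex.conj_ofReal, map_smul, hX.2.2 k h]⟩

/-- The direct sum over the points `x` of the divisor of the real Takiff algebras: an element is
a family `Y` standing for `∑ x, ∑ p, Y x p ⊗ ε_x ^ p`, with `ε_x ^ p` truncated at the
multiplicity of `x` (and without constant term at infinity), whose component at each `x` is
invariant under the stabiliser of `x`. -/
noncomputable def Tak : Submodule ℝ (OnePoint ℂ → ℕ → Aff 𝔤) where
  carrier := {Y | ∀ x p, Y x p ∈ G.slot x p}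
  add_mem' := fun hX hY x p => add_mem (hX x p) (hY x p)
  zero_mem' := fun _ _ => zero_mem _
  smul_mem' := fun c _ hX x p => (G.slot x p).smul_mem c (hX x p)

/-- The complexification of `Tak`. -/
abbrev TakC : Type _ := ℂ ⊗[ℝ] G.Tak

/-- Complex conjugation on the complexification. -/
noncomputable def conj : G.TakC →ₛₗ[starRingEnd ℂ] G.TakC where
  toFun := TensorProduct.map Complex.conjAe.toLinearMap (LinearMap.id : G.Tak →ₗ[ℝ] G.Tak)
  map_add' := map_add _
  map_smul' c w := by
    induction w using TensorProduct.induction_on with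
    | zero => simp
    | tmul u v => simp [TensorProduct.smul_tmul']
    | add a b ha hb => rw [smul_add, map_add, map_add, ha, hb, smul_add]

open Classical in
/-- `X ⊗ ε_x ^ p` as an element of `Tak`. -/
noncomputable def inSlot (x : OnePoint ℂ) (p : ℕ) (X : G.slot x p) : G.Tak :=
  ⟨Pi.single x (Pi.single p X.1), fun y q => by
    by_cases hy : y = x
    · subst hy
      by_cases hq : q = p
      · subst hq
        rw [Pi.single_eq_same, Pi.single_eq_same]
        exact X.2
      · rw [Pi.single_eq_same, Pi.single_eq_of_ne hq]
        exact zero_mem _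
    · rw [Pi.single_eq_of_ne hy]
      exact zero_mem _⟩

theorem ω_norm : ‖G.ω‖ = 1 := G.ω_prim.norm'_eq_one (by have := G.T_pos; omega)

theorem twist_pow_T (x : OnePoint ℂ) : G.twist x ^ G.T = 1 := by
  induction x with
  | infty => exact G.ω_prim.pow_eq_one
  | coe a => change G.ω⁻¹ ^ G.T = 1; rw [inv_pow, G.ω_prim.pow_eq_one, inv_one]

theorem twist_conj (x : OnePoint ℂ) : starRingEnd ℂ (G.twist x) * G.twist x = 1 := by
  rw [mul_comm, Complex.mul_conj, Complex.normSq_eq_norm_sq]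
  induction x with
  | infty => change ((‖G.ω‖ ^ 2 : ℝ) : ℂ) = 1; rw [G.ω_norm]; simp
  | coe a => change ((‖G.ω⁻¹‖ ^ 2 : ℝ) : ℂ) = 1; rw [norm_inv, G.ω_norm]; simp

theorem hatS_pow_T (x : OnePoint ℂ) (p : ℕ) : G.hatS x p ^ G.T = 1 := by
  rw [hatS, smul_pow, G.sig_pow_T, ← pow_mul, mul_comm p, pow_mul, G.twist_pow_T, one_pow,
    one_smul]

theorem hatS_pow_mod (x : OnePoint ℂ) (p k : ℕ) : G.hatS x p ^ k = G.hatS x p ^ (k % G.T) :=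
  pow_eq_pow_mod k (G.hatS_pow_T x p)

theorem hatS_tau_hatS (x : OnePoint ℂ) (p : ℕ) (X : Aff 𝔤) :
    G.hatS x p (G.tau (G.hatS x p X)) = G.tau X := by
  rw [hatS, LinearMap.smul_apply, LinearMap.smul_apply, map_smulₛₗ, map_smul, smul_smul,
    G.sig_tau_sig, map_pow, ← mul_pow, mul_comm, G.twist_conj, one_pow, one_smul]

theorem hatS_pow_tau (x : OnePoint ℂ) (p k : ℕ) (X : Aff 𝔤) :
    (G.hatS x p ^ k) (G.tau ((G.hatS x p ^ k) X)) = G.tau X := by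
  induction k generalizing X with
  | zero => rfl
  | succ k ih =>
    rw [pow_succ, Module.End.mul_apply, Module.End.mul_apply]
    have h : G.hatS x p (G.tau ((G.hatS x p ^ k) (G.hatS x p X))) =
        G.tau ((G.hatS x p ^ k) X) := by
      rw [← Module.End.mul_apply, ← pow_succ, pow_succ', Module.End.mul_apply, G.hatS_tau_hatS]
    rw [h, ih]

/-- The projection onto the invariants of the rotations, for a point fixed by all of them. -/
noncomputable def rotAv (x : OnePoint ℂ) (p : ℕ) : Module.End ℂ (Aff 𝔤) :=
  (1 / (G.T : ℂ)) • ∑ k ∈ Finset.range G.T, G.hatS x p ^ k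

theorem hatS_rotAv (x : OnePoint ℂ) (p : ℕ) : G.hatS x p * G.rotAv x p = G.rotAv x p := by
  rw [rotAv, mul_smul_comm, Finset.mul_sum]
  congr 1
  have h := Finset.sum_range_succ (fun k => G.hatS x p ^ k) G.T
  rw [Finset.sum_range_succ', G.hatS_pow_T, pow_zero] at h
  rw [← add_right_cancel h]
  exact Finset.sum_congr rfl fun k _ => (pow_succ' _ _).symm

theorem hatS_pow_rotAv (x : OnePoint ℂ) (p k : ℕ) (X : Aff 𝔤) :
    (G.hatS x p ^ k) (G.rotAv x p X) = G.rotAv x p X := by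
  induction k with
  | zero => rfl
  | succ k ih =>
    rw [pow_succ', Module.End.mul_apply, ih, ← Module.End.mul_apply, G.hatS_rotAv]

theorem tau_rotAv (x : OnePoint ℂ) (p : ℕ) (X : Aff 𝔤) :
    G.tau (G.rotAv x p X) = G.rotAv x p (G.tau X) := by
  have h1 : ∀ k ∈ Finset.range G.T, G.tau ((G.hatS x p ^ k) X) =
      (G.hatS x p ^ (G.T - 1 - k)) (G.hatS x p (G.tau X)) := by
    intro k hk
    have hk' := Finset.mem_range.1 hk
    rw [← G.hatS_pow_tau x p k X, ← Module.End.mul_apply, ← Module.End.mul_apply, mul_assoc,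
      ← pow_succ', ← pow_add, show G.T - 1 - k + (k + 1) = G.T by omega, G.hatS_pow_T]
    rfl
  have h2 : ∀ Y, G.rotAv x p Y = (1 / (G.T : ℂ)) • ∑ k ∈ Finset.range G.T, (G.hatS x p ^ k) Y :=
    fun Y => by rw [rotAv, LinearMap.smul_apply, LinearMap.sum_apply]
  have h3 : G.rotAv x p (G.hatS x p (G.tau X)) = G.rotAv x p (G.tau X) := by
    conv_rhs => rw [← G.hatS_rotAv]
    rw [Module.End.mul_apply, h2, h2, map_smul, map_sum]
    congr 1
    refine Finset.sum_congr rfl fun k _ => ?_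
    rw [← Module.End.mul_apply, ← Module.End.mul_apply, ← pow_succ, ← pow_succ']
  rw [h2 X, LinearMap.map_smulₛₗ G.tau, map_sum, Finset.sum_congr rfl h1,
    Finset.sum_range_reflect (fun k => (G.hatS x p ^ k) (G.hatS x p (G.tau X))) G.T, ← h3, h2]
  congr 1
  simp

open Classical in
/-- The projection of `X` onto `slot x p`, that is, of `X ⊗ ε_x ^ p` onto the invariants of the
stabiliser of `x`: for `x = 0` and `x = ∞`, the real part with respect to `τ` of the projection
onto the invariants of the rotations; for the other points of a reflection axis, the real part
with respect to that reflection; for all other points, `X` itself. -/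
noncomputable def proj (x : OnePoint ℂ) (p : ℕ) (X : Aff 𝔤) : Aff 𝔤 :=
  if G.IsExp x p then
    if x = OnePoint.infty ∨ x = ((0 : ℂ) : OnePoint ℂ) then
      (1 / 2 : ℂ) • (G.rotAv x p X + G.tau (G.rotAv x p X))
    else if h : ∃ k, G.refl k x = x then
      (1 / 2 : ℂ) • (X + (G.hatS x p ^ h.choose) (G.tau X))
    else X
  else 0

theorem refl_fixed {x : OnePoint ℂ} (hx : x = OnePoint.infty ∨ x = ((0 : ℂ) : OnePoint ℂ))
    (k : ℕ) : G.refl k x = x := by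
  rcases hx with rfl | rfl
  · rfl
  · simp [refl]

theorem half_conj : starRingEnd ℂ (1 / 2 : ℂ) = 1 / 2 := by
  rw [map_div₀, map_one, map_ofNat]

theorem ω_pow_mod {k l : ℕ} (h : G.ω ^ k = G.ω ^ l) : k % G.T = l % G.T := by
  refine G.ω_prim.pow_inj (Nat.mod_lt _ G.T_pos) (Nat.mod_lt _ G.T_pos) ?_
  rw [← pow_eq_pow_mod k G.ω_prim.pow_eq_one, ← pow_eq_pow_mod l G.ω_prim.pow_eq_one, h]

theorem rot_eq {x : OnePoint ℂ} (hx : ¬ (x = OnePoint.infty ∨ x = ((0 : ℂ) : OnePoint ℂ)))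
    {k : ℕ} (h : G.rot k x = x) (p : ℕ) : G.hatS x p ^ k = 1 := by
  push Not at hx
  induction x with
  | infty => exact absurd rfl hx.1
  | coe a =>
    have ha : a ≠ 0 := fun h => hx.2 (by rw [h])
    rw [rot, OnePoint.map_some, OnePoint.coe_eq_coe] at h
    have h1 : G.ω ^ k = G.ω ^ 0 := by
      rw [pow_zero]; exact mul_right_cancel₀ ha (by rw [h, one_mul])
    rw [G.hatS_pow_mod, G.ω_pow_mod h1, ← G.hatS_pow_mod, pow_zero]

theorem refl_eq {x : OnePoint ℂ} (hx : ¬ (x = OnePoint.infty ∨ x = ((0 : ℂ) : OnePoint ℂ)))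
    {k l : ℕ} (h : G.refl k x = x) (h' : G.refl l x = x) (p : ℕ) :
    G.hatS x p ^ k = G.hatS x p ^ l := by
  push Not at hx
  induction x with
  | infty => exact absurd rfl hx.1
  | coe a =>
    have ha : a ≠ 0 := fun h => hx.2 (by rw [h])
    rw [refl, OnePoint.map_some, OnePoint.coe_eq_coe] at h h'
    have ha' : starRingEnd ℂ a ≠ 0 := by simpa using ha
    rw [G.hatS_pow_mod, G.ω_pow_mod (mul_right_cancel₀ ha' (h.trans h'.symm)), ← G.hatS_pow_mod]

theorem proj_mem (x : OnePoint ℂ) (p : ℕ) (X : Aff 𝔤) : G.proj x p X ∈ G.slot x p := by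
  unfold proj
  split_ifs with h1 h2 h3
  · have key : ∀ k, (G.hatS x p ^ k) ((1 / 2 : ℂ) • (G.rotAv x p X + G.tau (G.rotAv x p X))) =
        (1 / 2 : ℂ) • (G.rotAv x p X + G.tau (G.rotAv x p X)) := fun k => by
      rw [map_smul, map_add, G.tau_rotAv, G.hatS_pow_rotAv, G.hatS_pow_rotAv]
    refine ⟨fun h => absurd h1 h, fun k _ => key k, fun k _ => ?_⟩
    rw [map_smulₛₗ, half_conj, map_add, G.tau_tau, add_comm (G.tau _), key]
  · refine ⟨fun h => absurd h1 h, fun k hk => ?_, fun k hk => ?_⟩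
    · rw [G.rot_eq h2 hk]; rfl
    · rw [G.refl_eq h2 hk h3.choose_spec, map_smulₛₗ, half_conj, map_add, map_smul, map_add]
      have := G.hatS_pow_tau x p h3.choose (G.tau X)
      rw [G.tau_tau] at this
      rw [this, add_comm]
  · refine ⟨fun h => absurd h1 h, fun k hk => ?_, fun k hk => absurd ⟨k, hk⟩ h3⟩
    rw [G.rot_eq h2 hk]; rfl
  · exact zero_mem _

theorem proj_refl (x : OnePoint ℂ) (p : ℕ) (h : ∃ k, G.refl k x = x) :
    ∃ k, ∀ X, G.proj x p ((G.hatS x p ^ k) (G.tau X)) = G.proj x p X := by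
  by_cases h2 : x = OnePoint.infty ∨ x = ((0 : ℂ) : OnePoint ℂ)
  · refine ⟨0, fun X => ?_⟩
    unfold proj
    rw [pow_zero, Module.End.one_apply, if_pos h2, if_pos h2, G.tau_rotAv, G.tau_rotAv, G.tau_tau,
      add_comm]
  · refine ⟨h.choose, fun X => ?_⟩
    have := G.hatS_pow_tau x p h.choose (G.tau X)
    rw [G.tau_tau] at this
    unfold proj
    rw [if_neg h2, if_neg h2, dif_pos h, dif_pos h, this, add_comm]

theorem proj_neg (x : OnePoint ℂ) (p : ℕ) (X : Aff 𝔤) : G.proj x p (-X) = -G.proj x p X := by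
  unfold proj
  split_ifs
  · rw [map_neg, map_neg, ← smul_neg, neg_add]
  · rw [map_neg, map_neg, ← smul_neg, neg_add]
  · rfl
  · rw [neg_zero]

/-- `proj x p X ⊗ ε_x ^ p` as an element of `Tak`. -/
noncomputable def tak (x : OnePoint ℂ) (p : ℕ) (X : Aff 𝔤) : G.Tak :=
  G.inSlot x p ⟨G.proj x p X, G.proj_mem x p X⟩

open Classical in
/-- The element `X^{(x)}_p` of the complexified Takiff algebra. With `π = proj x p`, it is
`(π X ⊗ ε_x ^ p) ⊗ 1 - (π (i X) ⊗ ε_x ^ p) ⊗ i` if `x` is fixed by a reflection (note that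
`π (i X) = i π⁻ X` where `π⁻` projects onto the anti-invariants), and half of this otherwise.
It is zero unless `x` is in the support of the divisor and `p` is an exponent at `x`. At the
points `0` and `∞`, `X` is first projected onto the invariants of the rotations. -/
noncomputable def emb (x : OnePoint ℂ) (p : ℕ) (X : Aff 𝔤) : G.TakC :=
  (if ∃ k, G.refl k x = x then (1 : ℂ) else 1 / 2) •
    ((1 : ℂ) ⊗ₜ[ℝ] G.tak x p X - Complex.I ⊗ₜ[ℝ] G.tak x p (Complex.I • X))

theorem conj_tmul (u : ℂ) (Y : G.Tak) : G.conj (u ⊗ₜ[ℝ] Y) = starRingEnd ℂ u ⊗ₜ[ℝ] Y := rfl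

theorem conj_conj (w : G.TakC) : G.conj (G.conj w) = w := by
  induction w using TensorProduct.induction_on with
  | zero => simp
  | tmul u v => rw [conj_tmul, conj_tmul, Complex.conj_conj]
  | add a b ha hb => rw [map_add, map_add, ha, hb]

open Classical in
theorem tak_neg (x : OnePoint ℂ) (p : ℕ) (X : Aff 𝔤) : G.tak x p (-X) = -G.tak x p X := by
  refine Subtype.ext ?_
  change (Pi.single x (Pi.single p (G.proj x p (-X)) : ℕ → Aff 𝔤) : OnePoint ℂ → ℕ → Aff 𝔤) =
    -(Pi.single x (Pi.single p (G.proj x p X) : ℕ → Aff 𝔤) : OnePoint ℂ → ℕ → Aff 𝔤)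
  rw [G.proj_neg, Pi.single_neg, Pi.single_neg]

theorem emb_refl (x : OnePoint ℂ) (p : ℕ) (h : ∃ k, G.refl k x = x) :
    ∃ k, ∀ X, G.emb x p X = G.conj (G.emb x p ((G.hatS x p ^ k) (G.tau X))) := by
  obtain ⟨k, hk⟩ := G.proj_refl x p h
  have hk' : ∀ X, G.tak x p ((G.hatS x p ^ k) (G.tau X)) = G.tak x p X := fun X => by
    simp only [tak, hk]
  refine ⟨k, fun X => ?_⟩
  have h2 : G.tak x p (Complex.I • (G.hatS x p ^ k) (G.tau X)) = -G.tak x p (Complex.I • X) := by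
    rw [← hk' (Complex.I • X), ← tak_neg, map_smulₛₗ, map_smul, Complex.conj_I, neg_smul, neg_neg]
  rw [emb, emb, if_pos h, one_smul, one_smul, hk', h2, map_sub, conj_tmul, conj_tmul,
    Complex.conj_I, map_one, TensorProduct.neg_tmul, TensorProduct.tmul_neg, neg_neg]

/-! ### Filtrations, formal fields, formal observables -/

/-- The filtration of the complexified Takiff algebra: `F_n` is spanned by the `X^{(x)}_p` with
`X ∈ F_n` and, for points `x` with trivial stabiliser, by the conjugates of the `X^{(x)}_p` with
`X ∈ F̄_n`. -/
noncomputable def filTak : DescFil G.TakC where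
  F n := Submodule.span ℂ
    ({w | ∃ x p, ∃ X ∈ Aff.fil n, w = G.emb x p X} ∪
      {w | ∃ x p, (¬ ∃ k, G.refl k x = x) ∧ ∃ X ∈ Aff.filBar n, w = G.conj (G.emb x p X)})
  anti n m h := Submodule.span_mono (Set.union_subset_union
    (fun _ ⟨x, p, X, hX, e⟩ => ⟨x, p, X, Aff.fil_anti n m h hX, e⟩)
    (fun _ ⟨x, p, hx, X, hX, e⟩ => ⟨x, p, hx, X, Aff.filBar_anti n m h hX, e⟩))

/-- The conjugate `c (F_n)` of the filtration of the complexified Takiff algebra. -/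
noncomputable def filTakBar (n : ℕ) : Submodule ℂ G.TakC := (G.filTak.F n).map G.conj

theorem filTakBar_anti (n m : ℕ) (h : n ≤ m) : G.filTakBar m ≤ G.filTakBar n :=
  Submodule.map_mono (G.filTak.anti n m h)

/-- The filtration `F_n ⊗ c (F_n) + F̄_n ⊗ F_n` of the tensor product of the affine algebra and the
complexified Takiff algebra. -/
noncomputable def filField : DescFil (Aff 𝔤 ⊗[ℂ] G.TakC) where
  F n := Submodule.map₂ (TensorProduct.mk ℂ (Aff 𝔤) G.TakC) (Aff.fil n) (G.filTakBar n) ⊔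
    Submodule.map₂ (TensorProduct.mk ℂ (Aff 𝔤) G.TakC) (Aff.filBar n) (G.filTak.F n)
  anti n m h := sup_le_sup
    (Submodule.map₂_le_map₂ (Aff.fil_anti n m h) (G.filTakBar_anti n m h))
    (Submodule.map₂_le_map₂ (Aff.filBar_anti n m h) (G.filTak.anti n m h))

/-- The space of formal fields: the completion of the tensor product of the affine algebra
(auxiliary space) and the complexified Takiff algebra (operator space). -/
abbrev Fields : Type _ := G.filField.completion

/-- The symmetric algebra of the complexified Takiff algebra. -/
abbrev Sym : Type _ := SymmetricAlgebra ℂ G.TakC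

/-- The filtration of the symmetric algebra by the ideals `F_n S ∩ c (F_n) S`. -/
noncomputable def filSym : DescFil G.Sym where
  F n := (Ideal.span (SymmetricAlgebra.ι ℂ G.TakC '' G.filTak.F n) ⊓
    Ideal.span (SymmetricAlgebra.ι ℂ G.TakC '' G.filTakBar n)).restrictScalars ℂ
  anti n m h := inf_le_inf (Ideal.span_mono (Set.image_mono (G.filTak.anti n m h)))
    (Ideal.span_mono (Set.image_mono (G.filTakBar_anti n m h)))

/-- The complexified algebra of formal observables: the completion of the symmetric algebra. -/
abbrev Obs : Type _ := G.filSym.completion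

/-- The bilinear map `(X ⊗ a, Y ⊗ b) ↦ (X | Y) a b`. -/
noncomputable def pairPre :
    Aff 𝔤 ⊗[ℂ] G.TakC →ₗ[ℂ] Aff 𝔤 ⊗[ℂ] G.TakC →ₗ[ℂ] G.Sym :=
  (TensorProduct.map₂ (Aff.form G.κ) ((LinearMap.mul ℂ G.Sym).compl₁₂
    (SymmetricAlgebra.ι ℂ G.TakC) (SymmetricAlgebra.ι ℂ G.TakC))).compr₂
      (TensorProduct.lid ℂ G.Sym).toLinearMap

theorem pairPre_tmul (X Y : Aff 𝔤) (a b : G.TakC) :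
    G.pairPre (X ⊗ₜ a) (Y ⊗ₜ b) = Aff.form G.κ X Y •
      (SymmetricAlgebra.ι ℂ G.TakC a * SymmetricAlgebra.ι ℂ G.TakC b) := by
  simp [pairPre]

theorem form_symm (X Y : Aff 𝔤) : Aff.form G.κ X Y = Aff.form G.κ Y X := by
  classical
  have h : ∀ X Y : Aff 𝔤, ((Aff.loop X).sum fun n x => G.κ x (Aff.loop Y (-n))) =
      ∑ n ∈ (Aff.loop X).support ∪ (Aff.loop Y).support.image (fun n => -n),
        G.κ (Aff.loop X n) (Aff.loop Y (-n)) := fun X Y =>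
    Finsupp.sum_of_support_subset _ Finset.subset_union_left _ (by simp)
  rw [Aff.form_apply, Aff.form_apply, h, h]
  have e : ∑ n ∈ (Aff.loop X).support ∪ (Aff.loop Y).support.image (fun n => -n),
        G.κ (Aff.loop X n) (Aff.loop Y (-n)) =
      ∑ n ∈ (Aff.loop Y).support ∪ (Aff.loop X).support.image (fun n => -n),
        G.κ (Aff.loop Y n) (Aff.loop X (-n)) := by
    refine Finset.sum_bij' (fun n _ => -n) (fun n _ => -n) ?_ ?_ (by simp) (by simp) ?_
    · intro n hn
      simp only [Finset.mem_union, Finset.mem_image] at hn ⊢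
      rcases hn with hn | ⟨m, hm, rfl⟩
      · exact Or.inr ⟨n, hn, rfl⟩
      · exact Or.inl (by simpa using hm)
    · intro n hn
      simp only [Finset.mem_union, Finset.mem_image] at hn ⊢
      rcases hn with hn | ⟨m, hm, rfl⟩
      · exact Or.inr ⟨n, hn, rfl⟩
      · exact Or.inl (by simpa using hm)
    · intro n _
      rw [neg_neg]
      exact G.κ_symm.eq _ _
  rw [e]
  ring

theorem form_eq_zero {X Y : Aff 𝔤} (h : ∀ n, Aff.loop X n = 0 ∨ Aff.loop Y (-n) = 0)
    (hK : Aff.coeffK X = 0) (hD : Aff.coeffD X = 0) : Aff.form G.κ X Y = 0 := by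
  rw [Aff.form_apply, hK, hD, zero_mul, zero_mul, add_zero, add_zero]
  refine Finset.sum_eq_zero fun n _ => ?_
  rcases h n with h | h <;> simp [h]

theorem pairPre_symm (u v : Aff 𝔤 ⊗[ℂ] G.TakC) : G.pairPre u v = G.pairPre v u := by
  have h : G.pairPre = G.pairPre.flip := by
    refine TensorProduct.ext' fun X a => ?_
    refine TensorProduct.ext' fun Y b => ?_
    rw [LinearMap.flip_apply, G.pairPre_tmul, G.pairPre_tmul, G.form_symm, mul_comm]
  conv_lhs => rw [h]
  rfl

theorem mul_mem_filSym {n : ℕ} {a b : G.TakC} (ha : a ∈ G.filTakBar n) (hb : b ∈ G.filTak.F n) :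
    SymmetricAlgebra.ι ℂ G.TakC a * SymmetricAlgebra.ι ℂ G.TakC b ∈ G.filSym.F n :=
  ⟨Ideal.mul_mem_left _ _ (Ideal.subset_span ⟨b, hb, rfl⟩),
    Ideal.mul_mem_right _ _ (Ideal.subset_span ⟨a, ha, rfl⟩)⟩

/-- To check that a bilinear map sends `F_n` into a subspace, it is enough to do it on the
generators. -/
theorem filField_le {n : ℕ} {S : Submodule ℂ (Aff 𝔤 ⊗[ℂ] G.TakC)}
    (h1 : ∀ X ∈ Aff.fil n, ∀ a ∈ G.filTakBar n, X ⊗ₜ a ∈ S)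
    (h2 : ∀ X ∈ Aff.filBar n, ∀ a ∈ G.filTak.F n, X ⊗ₜ a ∈ S) : G.filField.F n ≤ S :=
  sup_le (Submodule.map₂_le.2 h1) (Submodule.map₂_le.2 h2)

theorem pairPre_fil (n : ℕ) (hn : 1 ≤ n) (x y : Aff 𝔤 ⊗[ℂ] G.TakC) (hx : x ∈ G.filField.F n)
    (hy : y ∈ G.filField.F n) : G.pairPre x y ∈ G.filSym.F n := by
  revert x
  refine G.filField_le (S := (G.filSym.F n).comap (G.pairPre.flip y)) ?_ ?_
  · intro X hX a ha
    revert y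
    refine G.filField_le (S := (G.filSym.F n).comap (G.pairPre (X ⊗ₜ a))) ?_ ?_
    · intro Y hY b hb
      rw [Submodule.mem_comap, pairPre_tmul, G.form_eq_zero _ hX.2.1 hX.2.2, zero_smul]
      · exact zero_mem _
      · intro j
        by_cases hj : j < n
        · exact Or.inl (hX.1 j hj)
        · exact Or.inr (hY.1 _ (by omega))
    · intro Y hY b hb
      rw [Submodule.mem_comap, pairPre_tmul]
      exact Submodule.smul_mem _ _ (G.mul_mem_filSym ha hb)
  · intro X hX a ha
    revert y
    refine G.filField_le (S := (G.filSym.F n).comap (G.pairPre (X ⊗ₜ a))) ?_ ?_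
    · intro Y hY b hb
      rw [Submodule.mem_comap, pairPre_tmul, mul_comm]
      exact Submodule.smul_mem _ _ (G.mul_mem_filSym hb ha)
    · intro Y hY b hb
      rw [Submodule.mem_comap, pairPre_tmul, G.form_eq_zero _ hX.2.1 hX.2.2, zero_smul]
      · exact zero_mem _
      · intro j
        by_cases hj : -(n : ℤ) < j
        · exact Or.inl (hX.1 j hj)
        · exact Or.inr (hY.1 _ (by omega))

theorem exists_form_zero (Y : Aff 𝔤) : ∃ m, ∀ X, X ∈ Aff.fil m ∨ X ∈ Aff.filBar m →
    Aff.form G.κ X Y = 0 := by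
  refine ⟨(Aff.loop Y).support.sup Int.natAbs + 1, fun X hX => ?_⟩
  have hY : ∀ j : ℤ, (Aff.loop Y).support.sup Int.natAbs < j.natAbs → Aff.loop Y j = 0 := by
    intro j hj
    by_contra h
    have := Finset.le_sup (f := Int.natAbs) (Finsupp.mem_support_iff.2 h)
    omega
  rcases hX with hX | hX
  · refine G.form_eq_zero (fun j => ?_) hX.2.1 hX.2.2
    by_cases hj : j < ((Aff.loop Y).support.sup Int.natAbs + 1 : ℕ)
    · exact Or.inl (hX.1 j hj)
    · exact Or.inr (hY _ (by omega))
  · refine G.form_eq_zero (fun j => ?_) hX.2.1 hX.2.2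
    by_cases hj : -(((Aff.loop Y).support.sup Int.natAbs + 1 : ℕ) : ℤ) < j
    · exact Or.inl (hX.1 j hj)
    · exact Or.inr (hY _ (by omega))

theorem pairPre_eventually (y : Aff 𝔤 ⊗[ℂ] G.TakC) :
    ∃ m, ∀ x ∈ G.filField.F m, G.pairPre x y = 0 := by
  induction y using TensorProduct.induction_on with
  | zero => exact ⟨0, fun x _ => map_zero _⟩
  | tmul Y b =>
    obtain ⟨m, hm⟩ := G.exists_form_zero Y
    refine ⟨m, fun x hx => ?_⟩
    have : G.filField.F m ≤ LinearMap.ker (G.pairPre.flip (Y ⊗ₜ b)) := by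
      refine G.filField_le (fun X hX a _ => ?_) (fun X hX a _ => ?_)
      · rw [LinearMap.mem_ker, LinearMap.flip_apply, pairPre_tmul, hm X (Or.inl hX), zero_smul]
      · rw [LinearMap.mem_ker, LinearMap.flip_apply, pairPre_tmul, hm X (Or.inr hX), zero_smul]
    exact this hx
  | add a b ha hb =>
    obtain ⟨m, hm⟩ := ha
    obtain ⟨m', hm'⟩ := hb
    refine ⟨m + m', fun x hx => ?_⟩
    rw [map_add, hm x (G.filField.anti _ _ (by omega) hx),
      hm' x (G.filField.anti _ _ (by omega) hx), add_zero]

theorem pairPre_cont : DescFil.BilinCont G.filField G.filField G.filSym G.pairPre := by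
  refine ⟨fun n => ⟨n + 1, fun x hx y hy => ?_⟩, fun n x => ?_, fun n y => ?_⟩
  · exact G.filSym.anti n (n + 1) (by omega) (G.pairPre_fil (n + 1) (by omega) x y hx hy)
  · obtain ⟨m, hm⟩ := G.pairPre_eventually x
    exact ⟨m, fun y hy => by rw [G.pairPre_symm, hm y hy]; exact zero_mem _⟩
  · obtain ⟨m, hm⟩ := G.pairPre_eventually y
    exact ⟨m, fun x hx => by rw [hm x hx]; exact zero_mem _⟩

/-- The bilinear map `(· | ·)` from formal fields to the completed symmetric algebra: the extension
by continuity of `pairPre`. -/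
noncomputable def pair : G.Fields →ₗ[ℂ] G.Fields →ₗ[ℂ] G.Obs :=
  DescFil.extend₂ G.filField G.filField G.filSym G.pairPre G.pairPre_cont

/-- `σ` on formal fields: the extension by continuity of `σ ⊗ id`. -/
noncomputable def sigF : Module.End ℂ G.Fields :=
  DescFil.mapCompl G.filField G.filField (TensorProduct.map G.sig LinearMap.id) (fun n _ hx =>
    G.filField_le (S := (G.filField.F n).comap (TensorProduct.map G.sig LinearMap.id))
      (fun _ hX _ ha => Submodule.mem_sup_left
        (Submodule.apply_mem_map₂ _ (G.sig_mem_fil hX) ha))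
      (fun _ hX _ ha => Submodule.mem_sup_right
        (Submodule.apply_mem_map₂ _ (G.sig_mem_filBar hX) ha)) hx)

/-- The point `x` of the Riemann sphere is fixed by no reflection. As `0` and `∞`, the fixed points of
the rotations, are fixed by reflections, this means that its stabiliser is trivial. -/
def Free (x : OnePoint ℂ) : Prop := ¬ ∃ k, G.refl k x = x

open Classical in
/-- The points of the divisor with trivial stabiliser. -/
noncomputable def zc : Finset ℂ := G.z.filter fun x => G.Free x

section Canonical

variable {ι : Type*} [Fintype ι] [DecidableEq ι] (b : Module.Basis ι ℂ 𝔤)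

/-- The formal field `∑ u(I_ã) ⊗ v(I^ã)`, the sum being over the basis `I^ã` of the affine algebra
which consists of the `b a ⊗ tⁿ`, `K` and `D`, and over its dual basis `I_ã`, which consists of
the `b' a ⊗ t⁻ⁿ`, `D` and `K` for `b'` dual to `b`. It is the limit of the partial sums over
`-k < n < k`, together with the two terms in `K` and `D`. -/
noncomputable def canon (u : Aff 𝔤 → Aff 𝔤) (v : Aff 𝔤 → G.TakC)
    (h : ∀ (k : ℕ) (n : ℤ) (x y : 𝔤), k ≤ n.natAbs →
      u (Aff.mono (-n) y) ⊗ₜ[ℂ] v (Aff.mono n x) ∈ G.filField.F k) : G.Fields :=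
  G.filField.ofSeq (fun k => u Aff.D ⊗ₜ[ℂ] v Aff.K + u Aff.K ⊗ₜ[ℂ] v Aff.D +
    ∑ n ∈ Finset.Ioo (-(k : ℤ)) k, ∑ a,
      u (Aff.mono (-n) (G.κ.dualBasis G.κ_nondeg b a)) ⊗ₜ[ℂ] v (Aff.mono n (b a)))
    (fun k l hkl => by
      rw [add_sub_add_left_eq_sub, ← Finset.sum_sdiff_eq_sub
        (Finset.Ioo_subset_Ioo (by omega) (by omega))]
      refine sum_mem fun n hn => sum_mem fun a _ => h k n _ _ ?_
      simp only [Finset.mem_sdiff, Finset.mem_Ioo] at hn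
      omega)

theorem hatS_pow_mem_fil (x : OnePoint ℂ) (p k : ℕ) {n : ℕ} {X : Aff 𝔤} (h : X ∈ Aff.fil n) :
    (G.hatS x p ^ k) X ∈ Aff.fil n := by
  induction k with
  | zero => exact h
  | succ k ih =>
    rw [pow_succ', Module.End.mul_apply]
    exact Submodule.smul_mem _ _ (G.sig_mem_fil ih)

theorem emb_mem (x : OnePoint ℂ) (p n : ℕ) {X : Aff 𝔤} (h : X ∈ Aff.fil n) :
    G.emb x p X ∈ G.filTak.F n :=
  Submodule.subset_span (Or.inl ⟨x, p, X, h, rfl⟩)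

theorem emb_mem_bar (x : OnePoint ℂ) (p n : ℕ) {X : Aff 𝔤} (h : X ∈ Aff.filBar n) :
    G.emb x p X ∈ G.filTakBar n := by
  by_cases hx : ∃ k, G.refl k x = x
  · obtain ⟨k, hk⟩ := G.emb_refl x p hx
    exact ⟨_, G.emb_mem x p n (G.hatS_pow_mem_fil x p k (G.tau_mem_fil h)), (hk X).symm⟩
  · exact ⟨G.conj (G.emb x p X), Submodule.subset_span (Or.inr ⟨x, p, hx, X, h, rfl⟩),
      G.conj_conj _⟩

/-- `∑ I_ã ⊗ (I^ã)^{(x)}_p`. -/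
noncomputable def field (x : OnePoint ℂ) (p : ℕ) : G.Fields :=
  G.canon b id (G.emb x p) (fun k n y w h => by
    rcases le_total 0 n with hn | hn
    · exact Submodule.mem_sup_right (Submodule.apply_mem_map₂ _
        (Aff.mono_mem_filBar (by omega) w) (G.emb_mem x p k (Aff.mono_mem_fil (by omega) y)))
    · exact Submodule.mem_sup_left (Submodule.apply_mem_map₂ _
        (Aff.mono_mem_fil (by omega) w) (G.emb_mem_bar x p k (Aff.mono_mem_filBar (by omega) y))))

/-- `∑ τ(I_ã) ⊗ (I^ã)^{(x̄)}_p`, for a point `x` with trivial stabiliser, where `X^{(x̄)}_p` is the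
complex conjugate of `X^{(x)}_p`. -/
noncomputable def fieldBar (x : OnePoint ℂ) (p : ℕ) (hx : G.Free x) : G.Fields :=
  G.canon b G.tau (fun X => G.conj (G.emb x p X)) (fun k n y w h => by
    rcases le_total 0 n with hn | hn
    · exact Submodule.mem_sup_left (Submodule.apply_mem_map₂ _
        (G.tau_mem_fil (Aff.mono_mem_filBar (by omega) w))
        ⟨_, G.emb_mem x p k (Aff.mono_mem_fil (by omega) y), rfl⟩)
    · exact Submodule.mem_sup_right (Submodule.apply_mem_map₂ _
        (G.tau_mem_filBar (Aff.mono_mem_fil (by omega) w))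
        (Submodule.subset_span (Or.inr ⟨x, p, hx, _, Aff.mono_mem_filBar (by omega) y, rfl⟩))))

open Classical in
/-- The formal field `𝒜^x_p` at a finite point `x`. If `x̄` is a point of the divisor with trivial
stabiliser it is `∑ τ(I_ã) ⊗ (I^ã)^{(x)}_p`, with `(I^ã)^{(x)}_p` the conjugate of
`(I^ã)^{(x̄)}_p`; at the points `x` of the divisor it is `∑ I_ã ⊗ (I^ã)^{(x)}_p`; otherwise, and
also when `p` is at least the multiplicity, it vanishes. -/
noncomputable def A (x : ℂ) (p : ℕ) : G.Fields :=
  if h : starRingEnd ℂ x ∈ G.zc then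
    G.fieldBar b (starRingEnd ℂ x : ℂ) p (Finset.mem_filter.1 h).2
  else G.field b (x : OnePoint ℂ) p

/-- The formal field `𝒜^∞_p`; it vanishes unless `1 ≤ p < nInf`. -/
noncomputable def AInf (p : ℕ) : G.Fields := G.field b OnePoint.infty p

end Canonical

/-! ### Rational functions, Lax matrix, Hamiltonians -/

open Classical in
/-- The set `𝒵'`: the finite non-zero points of the divisor and the complex conjugates of those
with trivial stabiliser. -/
noncomputable def Zp : Finset ℂ := G.z.erase 0 ∪ G.zc.image (starRingEnd ℂ)

open Classical in
/-- The multiplicity of a point of `𝒵'`: the one of its complex conjugate if the latter is a point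
of the divisor with trivial stabiliser, and its own otherwise. -/
noncomputable def mult (x : ℂ) : ℕ :=
  if starRingEnd ℂ x ∈ G.zc then G.n (starRingEnd ℂ x) else G.n x

/-- The finite points of the orbit under the dihedral group of the support of the divisor. -/
def orbit : Set ℂ :=
  {c | ∃ x ∈ G.z, ∃ k : ℕ, c = G.ω ^ k * x ∨ c = G.ω ^ k * starRingEnd ℂ x}

/-- The algebra of rational functions whose poles, on the Riemann sphere, lie in the orbit of the
support of the divisor. (The point at infinity is in the support.) -/
noncomputable def R : Subalgebra ℂ (RatFunc ℂ) where
  carrier := {f | ∀ c, f.denom.IsRoot c → c ∈ G.orbit}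
  mul_mem' {f g} hf hg c hc := by
    have := Polynomial.IsRoot.dvd hc (RatFunc.denom_mul_dvd f g)
    rw [Polynomial.root_mul] at this
    exact this.elim (hf c) (hg c)
  add_mem' {f g} hf hg c hc := by
    have := Polynomial.IsRoot.dvd hc (RatFunc.denom_add_dvd f g)
    rw [Polynomial.root_mul] at this
    exact this.elim (hf c) (hg c)
  algebraMap_mem' r c hc := by
    rw [RatFunc.algebraMap_eq_C, RatFunc.denom_C] at hc
    exact absurd hc (by simp)

/-- The rational function `1 / (a z - b) ^ m`. -/
noncomputable def frac (a b : ℂ) (m : ℕ) (h : ∀ c, a * c = b → c ∈ G.orbit) : G.R :=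
  ⟨algebraMap (Polynomial ℂ) (RatFunc ℂ) 1 / algebraMap (Polynomial ℂ) (RatFunc ℂ)
    ((Polynomial.C a * Polynomial.X - Polynomial.C b) ^ m), fun c hc => by
    have := Polynomial.IsRoot.dvd hc (RatFunc.denom_div_dvd _ _)
    rw [Polynomial.IsRoot.def, Polynomial.eval_pow] at this
    have h' := eq_zero_of_pow_eq_zero this
    simp only [Polynomial.eval_sub, Polynomial.eval_mul, Polynomial.eval_C,
      Polynomial.eval_X] at h'
    exact h c (sub_eq_zero.1 h')⟩

/-- The rational function `z ^ q`. -/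
noncomputable def zpow (q : ℕ) : G.R :=
  ⟨RatFunc.X ^ q, fun c hc => by
    rw [← RatFunc.algebraMap_X, ← map_pow, RatFunc.denom_algebraMap] at hc
    exact absurd hc (by simp)⟩

open Classical in
theorem orbit_Zp {x : ℂ} (hx : x ∈ G.Zp) (k : ℕ) : G.ω ^ k * x ∈ G.orbit := by
  rw [Zp, Finset.mem_union] at hx
  rcases hx with hx | hx
  · exact ⟨x, Finset.mem_of_mem_erase hx, k, Or.inl rfl⟩
  · obtain ⟨y, hy, rfl⟩ := Finset.mem_image.1 hx
    rw [zc] at hy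
    exact ⟨y, (Finset.mem_filter.1 hy).1, k, Or.inr rfl⟩

/-- `1 / (ω ^ (-k) z - x) ^ m` for `x` in `𝒵'`. -/
noncomputable def fracRot (k : ℕ) (x : G.Zp) (m : ℕ) : G.R :=
  G.frac (G.ω ^ k)⁻¹ x m (fun c hc => by
    have h := G.orbit_Zp x.2 k
    rwa [← hc, mul_inv_cancel_left₀
      (pow_ne_zero _ (G.ω_prim.ne_zero (by have := G.T_pos; omega)))] at h)

/-- `1 / (z - ω ^ k x) ^ m` for `x` in `𝒵'`. -/
noncomputable def fracPt (k : ℕ) (x : G.Zp) (m : ℕ) : G.R :=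
  G.frac 1 (G.ω ^ k * x) m (fun c hc => by
    rw [one_mul] at hc
    rw [hc]
    exact G.orbit_Zp x.2 k)

/-- `1 / z ^ m`, if `0` is in the support of the divisor. -/
noncomputable def fracZero (m : ℕ) (h : 0 < G.n 0) : G.R :=
  G.frac 1 0 m (fun c hc => ⟨0, (G.mem_z 0).2 h.ne', 0, Or.inl (by
    rw [one_mul] at hc
    rw [hc, mul_zero])⟩)

/-- The extension of `(· | ·)` which sends `(𝒳 ⊗ f, 𝒴 ⊗ g)` to `(𝒳 | 𝒴) ⊗ f g`. -/
noncomputable def pairR : G.Fields ⊗[ℂ] G.R →ₗ[ℂ] G.Fields ⊗[ℂ] G.R →ₗ[ℂ] G.Obs ⊗[ℂ] G.R :=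
  TensorProduct.map₂ G.pair (LinearMap.mul ℂ G.R)

section Hamiltonians

variable {ι : Type*} [Fintype ι] [DecidableEq ι] (b : Module.Basis ι ℂ 𝔤)

/-- The formal Lax matrix. -/
noncomputable def lax : G.Fields ⊗[ℂ] G.R :=
  (1 / (G.T : ℂ)) • ∑ k ∈ Finset.range G.T, ∑ x : G.Zp, ∑ p ∈ Finset.range (G.mult x),
      ((G.ω ^ k)⁻¹ • (G.sigF ^ k) (G.A b x p)) ⊗ₜ[ℂ] G.fracRot k x (p + 1)
    + ∑ p : Fin (G.n 0), G.A b 0 p ⊗ₜ[ℂ] G.fracZero (p + 1) (by have := p.2; omega)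
    - ∑ q ∈ Finset.range (G.nInf - 1), G.AInf b (q + 1) ⊗ₜ[ℂ] G.zpow q

open Classical in
/-- The formal quadratic Gaudin Hamiltonian `ℋ^x_p` for `x` in `𝒵'`. -/
noncomputable def hamPt (x : ℂ) (p : ℕ) : G.Obs :=
  (∑ l ∈ Finset.range G.T, ∑ y ∈ insert 0 G.Zp, if (l, y) = (0, x) then 0 else
      ∑ q ∈ Finset.range (G.mult y), ∑ s ∈ Finset.range (G.mult x),
        (((q + s).choose s : ℂ) * (-1) ^ s * G.ω ^ (l * q) / (x - G.ω ^ l * y) ^ (q + s + 1)) •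
          G.pair (G.A b x (p + s)) ((G.sigF ^ l) (G.A b y q)))
    - (G.T : ℂ) • ∑ q ∈ Finset.range (G.nInf - 1), ∑ s ∈ Finset.range (G.mult x),
        ((q.choose s : ℂ) * x ^ (q - s)) • G.pair (G.A b x (p + s)) (G.AInf b (q + 1))
    + (1 / 2 : ℂ) • ∑ q ∈ Finset.range p, G.pair (G.A b x q) (G.A b x (p - q - 1))

/-- The formal quadratic Gaudin Hamiltonian `ℋ^0_p`. -/
noncomputable def hamZero (p : ℕ) : G.Obs :=
  (∑ x ∈ G.Zp, ∑ q ∈ Finset.range (G.mult x), ∑ s ∈ Finset.range (G.n 0),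
      ((-1) ^ (q + 1) * ((q + s).choose s : ℂ) / x ^ (q + s + 1)) •
        G.pair (G.A b 0 (p + s)) (G.A b x q))
    - ∑ q ∈ Finset.range (G.nInf - 1), G.pair (G.A b 0 (p + q)) (G.AInf b (q + 1))
    + (1 / 2 : ℂ) • ∑ q ∈ Finset.range p, G.pair (G.A b 0 (p - q - 1)) (G.A b 0 q)

/-- The formal quadratic Gaudin Hamiltonian `ℋ^∞_q`. -/
noncomputable def hamInf (q : ℕ) : G.Obs :=
  -(∑ x ∈ G.Zp, ∑ p ∈ Finset.range (G.mult x), ∑ s ∈ Finset.range (G.nInf - 1),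
      ((s.choose p : ℂ) * x ^ (s - p)) • G.pair (G.A b x p) (G.AInf b (q + s + 2)))
    - ∑ p ∈ Finset.range (G.n 0), G.pair (G.A b 0 p) (G.AInf b (q + p + 2))
    + (1 / 2 : ℂ) • ∑ p ∈ Finset.range (q + 1), G.pair (G.AInf b (p + 1)) (G.AInf b (q - p + 1))

end Hamiltonians

end GaudinData

/-! ### Partial fractions -/

/-! The Lax matrix is a finite sum of polar parts at distinct points, minus a polynomial, so half
its square is computed by partial fractions. A product of polar terms at `a ≠ b` splits into a polar
part at `a` and one at `b` (`pow_mul_pow_polar`). A polar term times a monomial splits into a polar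
part at the same point and a polynomial (`pow_mul_pow_regular`). The square of one polar part is
polar at that point, and the square of the polynomial is a polynomial. Since the pairing is
symmetric, every cross contribution occurs twice and absorbs the factor `1/2`, while the squares
keep it. This is `half_pairExt_self`, valid for any symmetric bilinear map.

The rest is equivariance. The poles are `0` and the points `ω ^ k * x`, and the polar part at `ω ^ k
* x` is `1/T` times the rotated polar part at `x`. The pairing is invariant under `σ`, and the
fields `𝒜^0_p` and `𝒜^∞_p` are eigenvectors of `σ` with eigenvalues `ω^{-p}` and `ω^p`. Hence every
contribution is homogeneous under the rotation by `ω ^ k`: of weight `ω^{k(p-1)}` for a pole of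
order `p + 1`, and of weight `ω^{-k(q+2)}` for `z ^ q`. So the coefficients at `ω ^ k * x` are those
at `x` times this weight (`polarCoeff_some`). At the fixed points `0` and `∞` the sum over `k` is a
projector, which leaves only `p ≡ 1`, respectively `q + 2 ≡ 0`, modulo `T` (`polarCoeff_none`,
`regularCoeff_poles`).

Three facts about the model feed this computation. The completed pairing is symmetric and
`σ`-invariant, which is checked on representatives (`pair_symm`, `pair_sigF`). The fields at `0` and
`∞` are eigenvectors because the canonical element is invariant under `σ ⊗ σ` (`sigF_field`). The
poles are distinct because the orbits are disjoint (`eq_of_ω_pow_mul_eq`). -/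

section PartialFractions

variable {R : Type*} [CommRing R] [Algebra ℂ R]

/-- The part at `u` of the partial fraction expansion of `u ^ m * v ^ n`, when
`u * v = δ • (u - v)`. -/
noncomputable def partFrac (δ : ℂ) (u : R) (m n : ℕ) : R :=
  ∑ s ∈ Finset.range m, ((n.multichoose s : ℂ) * (-1) ^ s * δ ^ (n + s)) • u ^ (m - s)

/-- This is the recursion satisfied by `u ^ m * v ^ n` when `u * v = δ • (u - v)`. Coefficientwise
it is Pascal's rule for `Nat.multichoose`, a form of the binomials that also covers the exponent `n
= 0`. -/
theorem partFrac_succ_succ (δ : ℂ) (u : R) (m n : ℕ) :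
    partFrac δ u (m + 1) (n + 1) = δ • (partFrac δ u (m + 1) n - partFrac δ u m (n + 1)) := by
  unfold partFrac
  rw [Finset.sum_range_succ', Finset.sum_range_succ' _ m, add_sub_right_comm,
    ← Finset.sum_sub_distrib, smul_add, Finset.smul_sum]
  congr 1
  · refine Finset.sum_congr rfl fun s _ => ?_
    rw [Nat.add_sub_add_right, ← sub_smul, smul_smul, Nat.multichoose_succ_succ]
    congr 1
    push_cast
    ring
  · rw [smul_smul]
    congr 1
    simp
    ring

theorem partFrac_zero_right (δ : ℂ) (u : R) (m : ℕ) : partFrac δ u (m + 1) 0 = u ^ (m + 1) := by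
  rw [partFrac, Finset.sum_range_succ']
  simp

theorem partFrac_zero_left (δ : ℂ) (u : R) (n : ℕ) : partFrac δ u 0 n = 0 := rfl

/-- Double induction: each use of `u * v = δ • (u - v)` lowers one of the two exponents by one. The
case `m = n = 0` is excluded because the product is then `1` while both polar parts are empty. -/
theorem pow_mul_pow_eq_partFrac {δ : ℂ} {u v : R} (h : u * v = δ • (u - v)) (m n : ℕ)
    (hmn : 0 < m + n) : u ^ m * v ^ n = partFrac δ u m n + partFrac (-δ) v n m := by
  induction m generalizing n with
  | zero =>
    obtain ⟨n, rfl⟩ : ∃ k, n = k + 1 := ⟨n - 1, by omega⟩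
    rw [partFrac_zero_left, partFrac_zero_right, pow_zero, one_mul, zero_add]
  | succ m ihm =>
    induction n with
    | zero => rw [partFrac_zero_left, partFrac_zero_right, pow_zero, mul_one, add_zero]
    | succ n ihn =>
      have e : u ^ (m + 1) * v ^ (n + 1) = δ • (u ^ (m + 1) * v ^ n - u ^ m * v ^ (n + 1)) := by
        calc u ^ (m + 1) * v ^ (n + 1) = u ^ m * v ^ n * (u * v) := by ring
          _ = δ • (u ^ m * v ^ n * (u - v)) := by rw [h, mul_smul_comm]
          _ = _ := by congr 1; ring
      rw [e, ihn (by omega), ihm _ (by omega), partFrac_succ_succ, partFrac_succ_succ]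
      module

theorem mul_eq_inv_smul_sub {Z u v : R} {a b : ℂ} (hu : u * (Z - algebraMap ℂ R a) = 1)
    (hv : v * (Z - algebraMap ℂ R b) = 1) (hab : a ≠ b) : u * v = (a - b)⁻¹ • (u - v) := by
  have e : (a - b) • (u * v) = u - v := by
    rw [Algebra.smul_def, map_sub]
    linear_combination (-v) * hu + u * hv
  rw [← e, smul_smul, inv_mul_cancel₀ (sub_ne_zero.2 hab), one_smul]

/-- Partial fraction expansion of a product of two polar terms at distinct points. -/
theorem pow_mul_pow_polar {Z u v : R} {a b : ℂ} (hu : u * (Z - algebraMap ℂ R a) = 1)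
    (hv : v * (Z - algebraMap ℂ R b) = 1) (hab : a ≠ b) (m n : ℕ) :
    u ^ (m + 1) * v ^ (n + 1) =
      ∑ s ∈ Finset.range (m + 1),
        (((n + s).choose s : ℂ) * (-1) ^ s / (a - b) ^ (n + s + 1)) • u ^ (m - s + 1) +
      ∑ s ∈ Finset.range (n + 1),
        (((m + s).choose s : ℂ) * (-1) ^ s / (b - a) ^ (m + s + 1)) • v ^ (n - s + 1) := by
  rw [pow_mul_pow_eq_partFrac (mul_eq_inv_smul_sub hu hv hab) _ _ (by omega), partFrac, partFrac,
    ← inv_neg, neg_sub]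
  congr 1 <;> refine Finset.sum_congr rfl fun s hs => ?_ <;> have := Finset.mem_range.1 hs
  · rw [Nat.multichoose_eq, show n + 1 + s - 1 = n + s by omega,
      show m + 1 - s = m - s + 1 by omega, inv_pow, div_eq_mul_inv,
      show n + 1 + s = n + s + 1 by omega]
  · rw [Nat.multichoose_eq, show m + 1 + s - 1 = m + s by omega,
      show n + 1 - s = n - s + 1 by omega, inv_pow, div_eq_mul_inv,
      show m + 1 + s = m + s + 1 by omega]

/-- Expansion of the product of a polar term and a monomial. -/
theorem pow_mul_pow_regular {Z u : R} {a : ℂ} (hu : u * (Z - algebraMap ℂ R a) = 1) (m q : ℕ) :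
    u ^ (m + 1) * Z ^ q =
      ∑ s ∈ Finset.range (m + 1), ((q.choose s : ℂ) * a ^ (q - s)) • u ^ (m - s + 1) +
      ∑ s ∈ Finset.range q, ((s.choose m : ℂ) * a ^ (s - m)) • Z ^ (q - 1 - s) := by
  have hZ : u * Z = 1 + a • u := by rw [Algebra.smul_def]; linear_combination hu
  -- The truncated exponents are harmless: whenever a subtraction truncates, the binomial in front
  -- of the power vanishes.
  have pascal : ∀ r s : ℕ, ((r + 1).choose (s + 1) : ℂ) * a ^ (r - s) =
      (r.choose s : ℂ) * a ^ (r - s) + a * ((r.choose (s + 1) : ℂ) * a ^ (r - (s + 1))) := by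
    intro r s
    rw [Nat.choose_succ_succ]
    rcases Nat.lt_or_ge s r with h | h
    · rw [show r - s = r - (s + 1) + 1 by omega]; push_cast; ring
    · rw [Nat.choose_eq_zero_of_lt (show r < s + 1 by omega)]; simp
  induction q generalizing m with
  | zero =>
    rw [Finset.sum_range_succ']
    simp
  | succ q ih =>
    -- The induction on `q` rests on `z / (z - a) = 1 + a / (z - a)`. The polar and polynomial sums
    -- of the statement obey the same recursion, by `polar` and `poly`.
    have e : ∀ m, u ^ (m + 1) * Z ^ (q + 1) = u ^ m * Z ^ q + a • (u ^ (m + 1) * Z ^ q) := by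
      intro m
      calc u ^ (m + 1) * Z ^ (q + 1) = u ^ m * Z ^ q * (u * Z) := by ring
        _ = u ^ m * Z ^ q + a • (u ^ m * Z ^ q * u) := by
          rw [hZ, mul_add, mul_one, mul_smul_comm]
        _ = _ := by congr 2; ring
    have polar : ∀ m, ∑ s ∈ Finset.range (m + 1),
        (((q + 1).choose s : ℂ) * a ^ (q + 1 - s)) • u ^ (m - s + 1) =
        ∑ s ∈ Finset.range m, ((q.choose s : ℂ) * a ^ (q - s)) • u ^ (m - s) +
        a • ∑ s ∈ Finset.range (m + 1), ((q.choose s : ℂ) * a ^ (q - s)) • u ^ (m - s + 1) := by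
      intro m
      rw [Finset.sum_range_succ', Finset.sum_range_succ' _ m, smul_add, ← add_assoc,
        Finset.smul_sum, ← Finset.sum_add_distrib]
      congr 1
      · refine Finset.sum_congr rfl fun s hs => ?_
        have := Finset.mem_range.1 hs
        rw [Nat.add_sub_add_right, pascal, show m - (s + 1) + 1 = m - s by omega]
        module
      · simp only [Nat.choose_zero_right, smul_smul, Nat.sub_zero]
        congr 1
        push_cast
        ring
    have poly : ∀ m, ∑ s ∈ Finset.range (q + 1),
        ((s.choose (m + 1) : ℂ) * a ^ (s - (m + 1))) • Z ^ (q + 1 - 1 - s) =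
        ∑ s ∈ Finset.range q, ((s.choose m : ℂ) * a ^ (s - m)) • Z ^ (q - 1 - s) +
        a • ∑ s ∈ Finset.range q,
          ((s.choose (m + 1) : ℂ) * a ^ (s - (m + 1))) • Z ^ (q - 1 - s) := by
      intro m
      rw [Finset.sum_range_succ', Nat.choose_zero_succ, Nat.cast_zero, zero_mul, zero_smul,
        add_zero, Finset.smul_sum, ← Finset.sum_add_distrib]
      refine Finset.sum_congr rfl fun s _ => ?_
      rw [Nat.add_sub_add_right, pascal, show q + 1 - 1 - (s + 1) = q - 1 - s by omega]
      module
    rw [e, polar, ih]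
    -- For `m = 0` the term `u ^ m * Z ^ q` is the pure monomial `Z ^ q`, which supplies the summand
    -- `s = 0` of the polynomial part. Otherwise the induction hypothesis applies to it.
    cases m with
    | zero =>
      rw [Finset.sum_range_succ' _ q, smul_add, Finset.smul_sum]
      simp only [Finset.range_zero, Finset.sum_empty, pow_zero, one_mul, zero_add,
        Nat.choose_zero_right, Nat.cast_one, Nat.sub_zero, one_smul, add_tsub_cancel_right,
        Finset.smul_sum, smul_smul]
      rw [add_comm (Z ^ q), add_assoc]
      congr 2
      refine Finset.sum_congr rfl fun s _ => ?_
      rw [show q - (s + 1) = q - 1 - s by omega, pow_succ']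
    | succ m =>
      rw [ih, poly]
      have e2 : ∀ s ∈ Finset.range (m + 1), ((q.choose s : ℂ) * a ^ (q - s)) • u ^ (m + 1 - s) =
          ((q.choose s : ℂ) * a ^ (q - s)) • u ^ (m - s + 1) := fun s hs => by
        rw [show m + 1 - s = m - s + 1 by have := Finset.mem_range.1 hs; omega]
      rw [Finset.sum_congr rfl e2, smul_add]
      abel

end PartialFractions

/-! ### Regrouping of finite double sums -/

/-- Both sides run over all pairs `(p, s)` with `G p s ≠ 0`, on the left grouped by `P = p + s`. The
hypothesis places every such pair in both the triangle and the rectangle, so the bounds can be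
chosen freely beyond the support. -/
theorem sum_range_sum_range_sub {M : Type*} [AddCommMonoid M] {G : ℕ → ℕ → M} {A C N : ℕ}
    (h : ∀ p s, G p s = 0 ∨ p < A ∧ s < C ∧ p + s < N) :
    ∑ P ∈ Finset.range N, ∑ s ∈ Finset.range (P + 1), G (P - s) s =
      ∑ p ∈ Finset.range A, ∑ s ∈ Finset.range C, G p s := by
  rw [Finset.sum_sigma', Finset.sum_sigma']
  refine Finset.sum_bij_ne_zero (fun x _ _ => ⟨x.1 - x.2, x.2⟩) ?_ ?_ ?_ (fun _ _ _ => rfl)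
  · intro x _ hx
    have := (h _ _).resolve_left hx
    simp only [Finset.mem_sigma, Finset.mem_range]
    exact ⟨this.1, this.2.1⟩
  · rintro ⟨P, s⟩ hx _ ⟨P', s'⟩ hx' _ e
    simp only [Finset.mem_sigma, Finset.mem_range] at hx hx'
    simp only [Sigma.mk.injEq, heq_eq_eq] at e ⊢
    omega
  · rintro ⟨p, s⟩ _ hx
    have := (h _ _).resolve_left hx
    refine ⟨⟨p + s, s⟩, ?_, ?_, ?_⟩
    · simp only [Finset.mem_sigma, Finset.mem_range] at this ⊢
      omega
    · rwa [Nat.add_sub_cancel]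
    · simp

/-! ### The square of a sum of polar parts and a polynomial -/

section Pairing

variable {R V W : Type*} [CommRing R] [Algebra ℂ R] [AddCommGroup V] [Module ℂ V]
  [AddCommGroup W] [Module ℂ W]

/-- Collects the coefficient of each `e p`. The bounds `A` and `C` may exceed `N` because `w`
vanishes from `N` on; this lets all contributions at a pole be written over the same range `2 * N`,
which the self-pairing needs. -/
theorem sum_tmul_sum_eq {w : ℕ → W} {N : ℕ} (hw : ∀ p, N ≤ p → w p = 0) (k : ℕ → ℂ) (e : ℕ → R)
    {A C : ℕ} (hA : N ≤ A) (hC : N ≤ C) :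
    ∑ P ∈ Finset.range N, w P ⊗ₜ[ℂ] ∑ s ∈ Finset.range (P + 1), k s • e (P - s) =
      ∑ p ∈ Finset.range A, (∑ s ∈ Finset.range C, k s • w (p + s)) ⊗ₜ[ℂ] e p := by
  simp only [TensorProduct.sum_tmul, TensorProduct.tmul_sum]
  rw [← sum_range_sum_range_sub (N := N)]
  · refine Finset.sum_congr rfl fun P _ => Finset.sum_congr rfl fun s hs => ?_
    rw [Nat.sub_add_cancel (by have := Finset.mem_range.1 hs; omega), TensorProduct.tmul_smul,
      TensorProduct.smul_tmul']
  · intro p s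
    by_cases hp : p + s < N
    · exact Or.inr ⟨by omega, by omega, hp⟩
    · rw [hw _ (by omega), smul_zero, TensorProduct.zero_tmul]
      exact Or.inl rfl

/-- The analogue for the polynomial part: multiplying `z ^ q` by a polar term leaves degree at most
`q - 1`, hence the shift by one in `w`. -/
theorem sum_tmul_sum_succ_eq {w : ℕ → W} {Q : ℕ} (hw : ∀ q, Q ≤ q → w q = 0) (k : ℕ → ℂ)
    (e : ℕ → R) :
    ∑ q ∈ Finset.range Q, w q ⊗ₜ[ℂ] ∑ s ∈ Finset.range q, k s • e (q - 1 - s) =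
      ∑ r ∈ Finset.range (2 * Q - 1),
        (∑ s ∈ Finset.range Q, k s • w (r + s + 1)) ⊗ₜ[ℂ] e r := by
  cases Q with
  | zero => rfl
  | succ Q =>
    rw [Finset.sum_range_succ', Finset.range_zero, Finset.sum_empty, TensorProduct.tmul_zero,
      add_zero]
    exact sum_tmul_sum_eq (w := fun q => w (q + 1)) (N := Q) (fun q hq => hw _ (by omega)) k e
      (by omega) (by omega)

theorem sum_sum_tmul_add (B : V →ₗ[ℂ] V →ₗ[ℂ] W) {f : ℕ → V} {N : ℕ}
    (hf : ∀ p, N ≤ p → f p = 0) (e : ℕ → R) :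
    ∑ p ∈ Finset.range N, ∑ q ∈ Finset.range N, B (f p) (f q) ⊗ₜ[ℂ] e (p + q) =
      ∑ r ∈ Finset.range (2 * N - 1),
        (∑ p ∈ Finset.range (r + 1), B (f p) (f (r - p))) ⊗ₜ[ℂ] e r := by
  simp only [TensorProduct.sum_tmul]
  rw [Finset.sum_comm, ← sum_range_sum_range_sub (N := 2 * N - 1)]
  · refine Finset.sum_congr rfl fun P _ => Finset.sum_congr rfl fun s hs => ?_
    rw [Nat.add_sub_cancel' (by have := Finset.mem_range.1 hs; omega)]
  · intro p s
    by_cases hp : N ≤ p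
    · rw [hf p hp, map_zero, TensorProduct.zero_tmul]
      exact Or.inl rfl
    by_cases hs : N ≤ s
    · rw [hf s hs, map_zero, LinearMap.zero_apply, TensorProduct.zero_tmul]
      exact Or.inl rfl
    exact Or.inr (by omega)

/-- The extension of a bilinear map `B` to `R`-valued arguments. -/
noncomputable abbrev pairExt (R : Type*) [CommRing R] [Algebra ℂ R] (B : V →ₗ[ℂ] V →ₗ[ℂ] W) :
    V ⊗[ℂ] R →ₗ[ℂ] V ⊗[ℂ] R →ₗ[ℂ] W ⊗[ℂ] R :=
  TensorProduct.map₂ B (LinearMap.mul ℂ R)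

theorem pairExt_sum_sum (B : V →ₗ[ℂ] V →ₗ[ℂ] W) (f g : ℕ → V) (e e' : ℕ → R) (N M : ℕ) :
    pairExt R B (∑ p ∈ Finset.range N, f p ⊗ₜ e p) (∑ q ∈ Finset.range M, g q ⊗ₜ e' q) =
      ∑ p ∈ Finset.range N, ∑ q ∈ Finset.range M, B (f p) (g q) ⊗ₜ[ℂ] (e p * e' q) := by
  simp only [map_sum, LinearMap.sum_apply]
  rw [Finset.sum_comm]
  rfl

/-- The coefficient of the pole of order `p + 1` at `a` in the pairing of the polar part
`f` at `a` with the polar part `g` at `b`. It vanishes for `a = b`. -/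
noncomputable def crossPolar (B : V →ₗ[ℂ] V →ₗ[ℂ] W) (a b : ℂ) (f g : ℕ → V) (N M p : ℕ) : W :=
  ∑ q ∈ Finset.range M, ∑ s ∈ Finset.range N,
    (((q + s).choose s : ℂ) * (-1) ^ s / (a - b) ^ (q + s + 1)) • B (f (p + s)) (g q)

/-- The coefficient of the pole of order `p + 1` at `a` in the pairing of the polar part `f` at `a`
with the polynomial `d`. -/
noncomputable def mixedPolar (B : V →ₗ[ℂ] V →ₗ[ℂ] W) (a : ℂ) (f d : ℕ → V) (N Q p : ℕ) : W :=
  ∑ q ∈ Finset.range Q, ∑ s ∈ Finset.range N,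
    ((q.choose s : ℂ) * a ^ (q - s)) • B (f (p + s)) (d q)

/-- The coefficient of `z ^ r` in the pairing of the polar part `f` at `a` with the
polynomial `d`. -/
noncomputable def mixedRegular (B : V →ₗ[ℂ] V →ₗ[ℂ] W) (a : ℂ) (f d : ℕ → V) (N Q r : ℕ) : W :=
  ∑ p ∈ Finset.range N, ∑ s ∈ Finset.range Q,
    ((s.choose p : ℂ) * a ^ (s - p)) • B (f p) (d (r + s + 1))

/-- The coefficient of the pole of order `p + 1` in the square of the polar part `f`. -/
def selfPolar (B : V →ₗ[ℂ] V →ₗ[ℂ] W) (f : ℕ → V) (p : ℕ) : W :=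
  ∑ q ∈ Finset.range p, B (f q) (f (p - q - 1))

/-- The coefficient of `z ^ r` in the square of the polynomial `d`. -/
def selfRegular (B : V →ₗ[ℂ] V →ₗ[ℂ] W) (d : ℕ → V) (r : ℕ) : W :=
  ∑ p ∈ Finset.range (r + 1), B (d p) (d (r - p))

/-- The denominators are positive powers of `0`, and division by zero gives `0`. Thanks to this
convention, sums over pairs of poles need not exclude the diagonal. -/
theorem crossPolar_self (B : V →ₗ[ℂ] V →ₗ[ℂ] W) (a : ℂ) (f g : ℕ → V) (N M p : ℕ) :
    crossPolar B a a f g N M p = 0 :=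
  Finset.sum_eq_zero fun q _ => Finset.sum_eq_zero fun s _ => by
    rw [sub_self, zero_pow (by omega), div_zero, zero_smul]

/-- The inverse relations are required only when the polar part is nonempty: if `0` is not in the
divisor, the ring contains no function `1 / z`. Symmetry of `B` puts the part at `b` in the same
form as the part at `a`. -/
theorem pairExt_polar_polar {B : V →ₗ[ℂ] V →ₗ[ℂ] W} (hB : ∀ x y, B x y = B y x) {Z u v : R}
    {a b : ℂ} {f g : ℕ → V} {N M : ℕ} (hu : N ≠ 0 → u * (Z - algebraMap ℂ R a) = 1)
    (hv : M ≠ 0 → v * (Z - algebraMap ℂ R b) = 1) (hf : ∀ p, N ≤ p → f p = 0)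
    (hg : ∀ p, M ≤ p → g p = 0) (hab : a ≠ b) :
    pairExt R B (∑ p ∈ Finset.range N, f p ⊗ₜ (u ^ (p + 1)))
        (∑ p ∈ Finset.range M, g p ⊗ₜ (v ^ (p + 1))) =
      ∑ p ∈ Finset.range (2 * N), crossPolar B a b f g N M p ⊗ₜ[ℂ] (u ^ (p + 1)) +
      ∑ p ∈ Finset.range (2 * M), crossPolar B b a g f M N p ⊗ₜ[ℂ] (v ^ (p + 1)) := by
  rw [pairExt_sum_sum]
  by_cases hN : N = 0
  · subst hN; simp [crossPolar]
  by_cases hM : M = 0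
  · subst hM; simp [crossPolar]
  simp only [pow_mul_pow_polar (hu hN) (hv hM) hab, TensorProduct.tmul_add,
    Finset.sum_add_distrib]
  congr 1
  · rw [Finset.sum_comm]
    simp only [crossPolar, TensorProduct.sum_tmul]
    rw [Finset.sum_comm (s := Finset.range (2 * N))]
    refine Finset.sum_congr rfl fun q _ => ?_
    simp only [← TensorProduct.sum_tmul]
    exact sum_tmul_sum_eq (w := fun p => B (f p) (g q)) (fun p hp => by simp [hf p hp])
      (fun s => ((q + s).choose s : ℂ) * (-1) ^ s / (a - b) ^ (q + s + 1))
      (fun p => u ^ (p + 1)) (by omega) le_rfl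
  · simp only [crossPolar, TensorProduct.sum_tmul]
    rw [Finset.sum_comm (s := Finset.range (2 * M))]
    refine Finset.sum_congr rfl fun q _ => ?_
    simp only [← TensorProduct.sum_tmul, hB (f q)]
    exact sum_tmul_sum_eq (w := fun p => B (g p) (f q)) (fun p hp => by simp [hg p hp])
      (fun s => ((q + s).choose s : ℂ) * (-1) ^ s / (b - a) ^ (q + s + 1))
      (fun p => v ^ (p + 1)) (by omega) le_rfl

theorem pairExt_polar_self (B : V →ₗ[ℂ] V →ₗ[ℂ] W) {u : R} {f : ℕ → V} {N : ℕ}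
    (hf : ∀ p, N ≤ p → f p = 0) :
    pairExt R B (∑ p ∈ Finset.range N, f p ⊗ₜ (u ^ (p + 1)))
        (∑ p ∈ Finset.range N, f p ⊗ₜ (u ^ (p + 1))) =
      ∑ p ∈ Finset.range (2 * N), selfPolar B f p ⊗ₜ[ℂ] (u ^ (p + 1)) := by
  unfold selfPolar
  rw [pairExt_sum_sum]
  cases N with
  | zero => rfl
  | succ N =>
    -- Since `u ^ (p + 1) * u ^ (q + 1)` has pole index `p + q + 1`, the index `0` carries an empty
    -- sum. It is split off and the rest is a Cauchy product shifted by one.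
    rw [show 2 * (N + 1) = 2 * (N + 1) - 1 + 1 by omega,
      Finset.sum_range_succ' _ (2 * (N + 1) - 1),
      Finset.range_zero, Finset.sum_empty, TensorProduct.zero_tmul, add_zero]
    refine Eq.trans ?_ ((sum_sum_tmul_add B hf (fun r => u ^ (r + 2))).trans ?_)
    · refine Finset.sum_congr rfl fun p _ => Finset.sum_congr rfl fun q _ => ?_
      congr 1
      ring
    · refine Finset.sum_congr rfl fun r _ => ?_
      congr 1
      refine Finset.sum_congr rfl fun p _ => ?_
      rw [show r + 1 - p - 1 = r - p by omega]

theorem pairExt_polar_regular (B : V →ₗ[ℂ] V →ₗ[ℂ] W) {Z u : R} {a : ℂ} {f d : ℕ → V} {N Q : ℕ}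
    (hu : N ≠ 0 → u * (Z - algebraMap ℂ R a) = 1) (hf : ∀ p, N ≤ p → f p = 0)
    (hd : ∀ q, Q ≤ q → d q = 0) :
    pairExt R B (∑ p ∈ Finset.range N, f p ⊗ₜ (u ^ (p + 1))) (∑ q ∈ Finset.range Q, d q ⊗ₜ (Z ^ q)) =
      ∑ p ∈ Finset.range (2 * N), mixedPolar B a f d N Q p ⊗ₜ[ℂ] (u ^ (p + 1)) +
      ∑ r ∈ Finset.range (2 * Q - 1), mixedRegular B a f d N Q r ⊗ₜ[ℂ] (Z ^ r) := by
  unfold mixedPolar mixedRegular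
  rw [pairExt_sum_sum]
  by_cases hN : N = 0
  · subst hN; simp
  simp only [pow_mul_pow_regular (hu hN), TensorProduct.tmul_add, Finset.sum_add_distrib]
  congr 1
  · rw [Finset.sum_comm]
    simp only [TensorProduct.sum_tmul]
    rw [Finset.sum_comm (s := Finset.range (2 * N))]
    refine Finset.sum_congr rfl fun q _ => ?_
    simp only [← TensorProduct.sum_tmul]
    exact sum_tmul_sum_eq (w := fun p => B (f p) (d q)) (fun p hp => by simp [hf p hp])
      (fun s => (q.choose s : ℂ) * a ^ (q - s)) (fun p => u ^ (p + 1)) (by omega) le_rfl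
  · simp only [TensorProduct.sum_tmul]
    rw [Finset.sum_comm (s := Finset.range (2 * Q - 1))]
    refine Finset.sum_congr rfl fun p _ => ?_
    simp only [← TensorProduct.sum_tmul]
    exact sum_tmul_sum_succ_eq (w := fun q => B (f p) (d q)) (fun q hq => by simp [hd q hq])
      (fun s => (s.choose p : ℂ) * a ^ (s - p)) (fun r => Z ^ r)

theorem pairExt_regular_self (B : V →ₗ[ℂ] V →ₗ[ℂ] W) {Z : R} {d : ℕ → V} {Q : ℕ}
    (hd : ∀ q, Q ≤ q → d q = 0) :
    pairExt R B (∑ q ∈ Finset.range Q, d q ⊗ₜ (Z ^ q)) (∑ q ∈ Finset.range Q, d q ⊗ₜ (Z ^ q)) =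
      ∑ r ∈ Finset.range (2 * Q - 1), selfRegular B d r ⊗ₜ[ℂ] (Z ^ r) := by
  rw [pairExt_sum_sum]
  simp only [← pow_add]
  exact sum_sum_tmul_add B hd (fun r => Z ^ r)

theorem pairExt_symm {B : V →ₗ[ℂ] V →ₗ[ℂ] W} (hB : ∀ x y, B x y = B y x) (x y : V ⊗[ℂ] R) :
    pairExt R B x y = pairExt R B y x := by
  have h : pairExt R B = (pairExt R B).flip := by
    refine TensorProduct.ext' fun X a => TensorProduct.ext' fun Y b => ?_
    change B X Y ⊗ₜ (a * b) = B Y X ⊗ₜ (b * a)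
    rw [hB, mul_comm]
  conv_lhs => rw [h]
  rfl

variable {J : Type*} [Fintype J]

/-- The coefficient of `1 / (z - c j) ^ (p + 1)` in half the square of
`∑ j, ∑ p, f j p / (z - c j) ^ (p + 1) - ∑ q, d q * z ^ q`. -/
noncomputable def polarCoeff (B : V →ₗ[ℂ] V →ₗ[ℂ] W) (c : J → ℂ) (f : J → ℕ → V) (d : ℕ → V)
    (N : J → ℕ) (Q : ℕ) (j : J) (p : ℕ) : W :=
  ∑ i, crossPolar B (c j) (c i) (f j) (f i) (N j) (N i) p
    - mixedPolar B (c j) (f j) d (N j) Q p + (1 / 2 : ℂ) • selfPolar B (f j) p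

/-- The coefficient of `z ^ r` in half the square of
`∑ j, ∑ p, f j p / (z - c j) ^ (p + 1) - ∑ q, d q * z ^ q`. -/
noncomputable def regularCoeff (B : V →ₗ[ℂ] V →ₗ[ℂ] W) (c : J → ℂ) (f : J → ℕ → V) (d : ℕ → V)
    (N : J → ℕ) (Q r : ℕ) : W :=
  -(∑ j, mixedRegular B (c j) (f j) d (N j) Q r) + (1 / 2 : ℂ) • selfRegular B d r

-- Expand the square of `∑ P j - D`. With `X j i` the part at `c j` of the product of the polar
-- parts `j` and `i`, the sum over ordered pairs produces each `X j i` twice, which cancels the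
-- factor `1/2`; so do the two mixed terms with `D`. The squares of each `P j` and of `D` retain it.
open Classical in
theorem half_pairExt_self {B : V →ₗ[ℂ] V →ₗ[ℂ] W} (hB : ∀ x y, B x y = B y x) {Z : R} {u : J → R}
    {c : J → ℂ} (hc : Function.Injective c) {f : J → ℕ → V} {d : ℕ → V} {N : J → ℕ} {Q : ℕ}
    (hu : ∀ j, N j ≠ 0 → u j * (Z - algebraMap ℂ R (c j)) = 1)
    (hf : ∀ j p, N j ≤ p → f j p = 0) (hd : ∀ q, Q ≤ q → d q = 0) {L : V ⊗[ℂ] R}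
    (hL : L = ∑ j, ∑ p ∈ Finset.range (N j), f j p ⊗ₜ (u j ^ (p + 1)) -
      ∑ q ∈ Finset.range Q, d q ⊗ₜ (Z ^ q)) :
    (1 / 2 : ℂ) • pairExt R B L L =
      ∑ j, ∑ p ∈ Finset.range (2 * N j), polarCoeff B c f d N Q j p ⊗ₜ[ℂ] (u j ^ (p + 1)) +
      ∑ r ∈ Finset.range (2 * Q - 1), regularCoeff B c f d N Q r ⊗ₜ[ℂ] (Z ^ r) := by
  set P : J → V ⊗[ℂ] R := fun j => ∑ p ∈ Finset.range (N j), f j p ⊗ₜ (u j ^ (p + 1)) with hP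
  set D : V ⊗[ℂ] R := ∑ q ∈ Finset.range Q, d q ⊗ₜ (Z ^ q) with hD
  set X : J → J → W ⊗[ℂ] R := fun j i => ∑ p ∈ Finset.range (2 * N j),
    crossPolar B (c j) (c i) (f j) (f i) (N j) (N i) p ⊗ₜ[ℂ] (u j ^ (p + 1)) with hX
  set S : J → W ⊗[ℂ] R := fun j => ∑ p ∈ Finset.range (2 * N j),
    selfPolar B (f j) p ⊗ₜ[ℂ] (u j ^ (p + 1)) with hS
  -- One formula for all pairs: on the diagonal both cross terms vanish by `crossPolar_self`.
  have hPP : ∀ j i, pairExt R B (P j) (P i) = X j i + X i j + if j = i then S j else 0 := by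
    intro j i
    split_ifs with h
    · subst h
      rw [pairExt_polar_self B (hf j)]
      simp [hX, hS, crossPolar_self]
    · rw [pairExt_polar_polar hB (hu j) (hu i) (hf j) (hf i) (hc.ne h), add_zero]
  have expand : ∀ y, pairExt R B (Finset.univ.sum P) y = ∑ j, pairExt R B (P j) y := fun y => by
    rw [map_sum, LinearMap.sum_apply]
  have hLL : pairExt R B L L = ∑ j, ∑ i, pairExt R B (P j) (P i) -
      (2 : ℂ) • ∑ j, pairExt R B (P j) D + pairExt R B D D := by
    rw [hL, (pairExt R B).map_sub, LinearMap.sub_apply, map_sub, map_sub,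
      pairExt_symm hB D, expand, expand, Finset.sum_congr rfl fun j _ => map_sum _ P _, two_smul]
    abel
  have hsum : ∑ j, ∑ i, pairExt R B (P j) (P i) = (2 : ℂ) • (∑ j, ∑ i, X j i) + ∑ j, S j := by
    simp only [hPP, Finset.sum_add_distrib, Finset.sum_ite_eq, Finset.mem_univ, if_true]
    rw [two_smul, Finset.sum_comm (f := fun i j => X j i)]
  rw [hLL, hsum, Finset.sum_congr rfl fun j _ => pairExt_polar_regular B (hu j) (hf j) hd,
    pairExt_regular_self B hd, Finset.sum_add_distrib]
  simp only [polarCoeff, regularCoeff, TensorProduct.add_tmul, TensorProduct.sub_tmul,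
    TensorProduct.neg_tmul, Finset.sum_add_distrib, Finset.sum_sub_distrib,
    Finset.sum_neg_distrib, ← TensorProduct.smul_tmul', ← Finset.smul_sum, hX, hS]
  have e1 : ∑ j, ∑ p ∈ Finset.range (2 * N j),
      (∑ i, crossPolar B (c j) (c i) (f j) (f i) (N j) (N i) p) ⊗ₜ[ℂ] (u j ^ (p + 1)) =
      ∑ j, ∑ i, X j i := by
    refine Finset.sum_congr rfl fun j _ => ?_
    simp only [hX, TensorProduct.sum_tmul]
    exact Finset.sum_comm
  have e2 : ∑ r ∈ Finset.range (2 * Q - 1),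
      (∑ j, mixedRegular B (c j) (f j) d (N j) Q r) ⊗ₜ[ℂ] (Z ^ r) =
      ∑ j, ∑ r ∈ Finset.range (2 * Q - 1), mixedRegular B (c j) (f j) d (N j) Q r ⊗ₜ[ℂ] (Z ^ r) := by
    simp only [TensorProduct.sum_tmul]
    exact Finset.sum_comm
  rw [e1, e2]
  module

end Pairing

/-! ### Extensions by continuity computed on representatives -/

namespace DescFil

variable {M N P : Type*} [AddCommGroup M] [Module ℂ M] [AddCommGroup N] [Module ℂ N]
  [AddCommGroup P] [Module ℂ P]

/-- The characterisation of the extension that all later identities use: each component can be read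
off from any representatives of sufficiently high index. -/
theorem extend₂_spec (A : DescFil M) (B : DescFil N) (C : DescFil P)
    (f : M →ₗ[ℂ] N →ₗ[ℂ] P) (hf : BilinCont A B C f) (u : A.completion) (v : B.completion)
    (n : ℕ) : ∃ m₀, ∀ m ≥ m₀, ∀ x y, (A.F m).mkQ x = u.1 m → (B.F m).mkQ y = v.1 m →
      (C.F n).mkQ (f x y) = (extend₂ A B C f hf u v).1 n :=
  (exists_stable A B C hf u v n).choose_spec

theorem mapCompl_mkQ (A : DescFil M) (B : DescFil N) (f : M →ₗ[ℂ] N)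
    (hf : ∀ n x, x ∈ A.F n → f x ∈ B.F n) (u : A.completion) (n : ℕ) (x : M)
    (hx : (A.F n).mkQ x = u.1 n) : (B.F n).mkQ (f x) = (mapCompl A B f hf u).1 n := by
  change _ = (A.F n).mapQ (B.F n) f (hf n) (u.1 n)
  rw [← hx]
  rfl

/-- Two extensions by continuity agree if they do so on representatives. -/
theorem extend₂_eq_extend₂ {M' N' : Type*} [AddCommGroup M'] [Module ℂ M'] [AddCommGroup N']
    [Module ℂ N'] (A : DescFil M) (B : DescFil N) (A' : DescFil M') (B' : DescFil N')
    (C : DescFil P) {f : M →ₗ[ℂ] N →ₗ[ℂ] P} {f' : M' →ₗ[ℂ] N' →ₗ[ℂ] P}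
    (hf : BilinCont A B C f) (hf' : BilinCont A' B' C f') {u : A.completion} {v : B.completion}
    {u' : A'.completion} {v' : B'.completion}
    (h : ∀ m, ∃ x y x' y', (A.F m).mkQ x = u.1 m ∧ (B.F m).mkQ y = v.1 m ∧
      (A'.F m).mkQ x' = u'.1 m ∧ (B'.F m).mkQ y' = v'.1 m ∧ f x y = f' x' y') :
    extend₂ A B C f hf u v = extend₂ A' B' C f' hf' u' v' := by
  refine Subtype.ext (funext fun n => ?_)
  obtain ⟨m₁, h₁⟩ := extend₂_spec A B C f hf u v n
  obtain ⟨m₂, h₂⟩ := extend₂_spec A' B' C f' hf' u' v' n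
  obtain ⟨x, y, x', y', hx, hy, hx', hy', e⟩ := h (m₁ + m₂)
  rw [← h₁ (m₁ + m₂) (by omega) x y hx hy, ← h₂ (m₁ + m₂) (by omega) x' y' hx' hy', e]

end DescFil

namespace GaudinData

variable {𝔤 : Type*} [LieRing 𝔤] [LieAlgebra ℂ 𝔤] (G : GaudinData 𝔤)

/-! ### The pairing of formal fields -/

theorem pair_symm (u v : G.Fields) : G.pair u v = G.pair v u := by
  refine DescFil.extend₂_eq_extend₂ _ _ _ _ _ _ _ fun m => ?_
  obtain ⟨x, hx⟩ := Submodule.mkQ_surjective _ (u.1 m)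
  obtain ⟨y, hy⟩ := Submodule.mkQ_surjective _ (v.1 m)
  exact ⟨x, y, y, x, hx, hy, hy, hx, G.pairPre_symm x y⟩

theorem form_sig (X Y : Aff 𝔤) : Aff.form G.κ (G.sig X) (G.sig Y) = Aff.form G.κ X Y := by
  have h : Aff.loop (G.sig X) = Finsupp.mapRange G.σ (map_zero _) (Aff.loop X) := rfl
  rw [Aff.form_apply, Aff.form_apply, h, Finsupp.sum_mapRange_index (by simp)]
  simp only [loop_sig, G.κ_σ]
  rfl

theorem pairPre_sig (x y : Aff 𝔤 ⊗[ℂ] G.TakC) :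
    G.pairPre (TensorProduct.map G.sig LinearMap.id x) (TensorProduct.map G.sig LinearMap.id y) =
      G.pairPre x y := by
  induction x using TensorProduct.induction_on with
  | zero => simp
  | add a b ha hb => simp only [map_add, LinearMap.add_apply, ha, hb]
  | tmul X a =>
    induction y using TensorProduct.induction_on with
    | zero => simp
    | add a b ha hb => simp only [map_add, ha, hb]
    | tmul Y b =>
      rw [TensorProduct.map_tmul, TensorProduct.map_tmul, pairPre_tmul, pairPre_tmul, form_sig]
      rfl

theorem mkQ_sigF (u : G.Fields) (n : ℕ) (x : Aff 𝔤 ⊗[ℂ] G.TakC)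
    (hx : (G.filField.F n).mkQ x = u.1 n) :
    (G.filField.F n).mkQ (TensorProduct.map G.sig LinearMap.id x) = (G.sigF u).1 n :=
  DescFil.mapCompl_mkQ G.filField G.filField _ _ u n x hx

/-- At every level, applying `σ ⊗ id` to representatives of `u` and `v` gives representatives of
their images, and on these the invariance reduces to that of the form on the affine algebra. -/
theorem pair_sigF (u v : G.Fields) : G.pair (G.sigF u) (G.sigF v) = G.pair u v := by
  refine DescFil.extend₂_eq_extend₂ _ _ _ _ _ _ _ fun m => ?_
  obtain ⟨x, hx⟩ := Submodule.mkQ_surjective _ (u.1 m)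
  obtain ⟨y, hy⟩ := Submodule.mkQ_surjective _ (v.1 m)
  have h1 := G.mkQ_sigF u m x hx
  have h2 := G.mkQ_sigF v m y hy
  have h3 := G.pairPre_sig x y
  generalize TensorProduct.map G.sig LinearMap.id x = x' at h1 h3
  generalize TensorProduct.map G.sig LinearMap.id y = y' at h2 h3
  exact ⟨x', y', x, y, h1, h2, hx, hy, h3⟩

theorem mkQ_sigF_pow (k : ℕ) (u : G.Fields) (n : ℕ) (x : Aff 𝔤 ⊗[ℂ] G.TakC)
    (hx : (G.filField.F n).mkQ x = u.1 n) :
    (G.filField.F n).mkQ (TensorProduct.map (G.sig ^ k) LinearMap.id x) = ((G.sigF ^ k) u).1 n := by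
  induction k with
  | zero =>
    rw [pow_zero, pow_zero, Module.End.one_eq_id, TensorProduct.map_id]
    exact hx
  | succ k ih =>
    rw [pow_succ', pow_succ', Module.End.mul_apply, ← G.mkQ_sigF _ n _ ih]
    exact congrArg _ (LinearMap.congr_fun
      (TensorProduct.map_comp G.sig LinearMap.id (G.sig ^ k) LinearMap.id) x)

theorem sigF_pow_T : G.sigF ^ G.T = 1 := by
  refine LinearMap.ext fun u => Subtype.ext (funext fun n => ?_)
  obtain ⟨x, hx⟩ := Submodule.mkQ_surjective _ (u.1 n)
  rw [← G.mkQ_sigF_pow _ u n x hx, G.sig_pow_T, Module.End.one_eq_id, TensorProduct.map_id]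
  exact hx

/-! ### Linearity and equivariance of the embeddings -/

theorem proj_add (x : OnePoint ℂ) (p : ℕ) (X Y : Aff 𝔤) :
    G.proj x p (X + Y) = G.proj x p X + G.proj x p Y := by
  unfold proj
  split_ifs
  · simp only [map_add, ← smul_add]
    congr 1
    abel
  · simp only [map_add, ← smul_add]
    congr 1
    abel
  · rfl
  · rw [add_zero]

theorem proj_ofReal_smul (x : OnePoint ℂ) (p : ℕ) (r : ℝ) (X : Aff 𝔤) :
    G.proj x p ((r : ℂ) • X) = (r : ℂ) • G.proj x p X := by
  unfold proj
  split_ifs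
  · rw [map_smul, map_smulₛₗ, Complex.conj_ofReal, ← smul_add, smul_comm]
  · rw [map_smulₛₗ, Complex.conj_ofReal, map_smul, ← smul_add, smul_comm]
  · rfl
  · rw [smul_zero]

theorem tak_eq_of_proj_eq {x : OnePoint ℂ} {p : ℕ} {X Y : Aff 𝔤}
    (h : G.proj x p X = G.proj x p Y) : G.tak x p X = G.tak x p Y := by
  simp only [tak, h]

theorem coe_tak (x : OnePoint ℂ) (p : ℕ) (X : Aff 𝔤) (y : OnePoint ℂ) (q : ℕ) [Decidable (y = x)]
    [Decidable (q = p)] :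
    (G.tak x p X).1 y q = if y = x then if q = p then G.proj x p X else 0 else 0 := by
  classical
  change (Pi.single x (Pi.single p (G.proj x p X) : ℕ → Aff 𝔤) : OnePoint ℂ → ℕ → Aff 𝔤) y q = _
  split_ifs with hy hq
  · subst hy hq; simp
  · subst hy; rw [Pi.single_eq_same, Pi.single_eq_of_ne hq]
  · rw [Pi.single_eq_of_ne hy]; rfl

theorem tak_add (x : OnePoint ℂ) (p : ℕ) (X Y : Aff 𝔤) :
    G.tak x p (X + Y) = G.tak x p X + G.tak x p Y := by
  classical
  refine Subtype.ext (funext fun y => funext fun q => ?_)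
  change _ = (G.tak x p X).1 y q + (G.tak x p Y).1 y q
  rw [coe_tak, coe_tak, coe_tak, proj_add]
  split_ifs <;> simp

theorem tak_ofReal_smul (x : OnePoint ℂ) (p : ℕ) (r : ℝ) (X : Aff 𝔤) :
    G.tak x p ((r : ℂ) • X) = r • G.tak x p X := by
  classical
  refine Subtype.ext (funext fun y => funext fun q => ?_)
  change _ = r • (G.tak x p X).1 y q
  rw [coe_tak, coe_tak, proj_ofReal_smul]
  split_ifs <;> simp

theorem emb_add (x : OnePoint ℂ) (p : ℕ) (X Y : Aff 𝔤) :
    G.emb x p (X + Y) = G.emb x p X + G.emb x p Y := by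
  rw [emb, emb, emb, ← smul_add, smul_add Complex.I, tak_add, tak_add, TensorProduct.tmul_add,
    TensorProduct.tmul_add]
  congr 1
  abel

/-- The projection onto invariants is only real-linear, but `X ↦ 1 ⊗ π X - i ⊗ π (i X)` is
complex-linear: replacing `X` by `i X` gives `1 ⊗ π (i X) + i ⊗ π X`, which is `i` times the
original. -/
theorem emb_smul (x : OnePoint ℂ) (p : ℕ) (c : ℂ) (X : Aff 𝔤) :
    G.emb x p (c • X) = c • G.emb x p X := by
  have h1 : G.tak x p (c • X) = c.re • G.tak x p X + c.im • G.tak x p (Complex.I • X) := by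
    conv_lhs => rw [← Complex.re_add_im c, add_smul, mul_smul]
    rw [tak_add, tak_ofReal_smul, tak_ofReal_smul]
  have h2 : G.tak x p (Complex.I • c • X) =
      c.re • G.tak x p (Complex.I • X) - c.im • G.tak x p X := by
    have : Complex.I • c • X = (c.re : ℂ) • Complex.I • X + ((-c.im : ℝ) : ℂ) • X := by
      conv_lhs => rw [← Complex.re_add_im c]
      rw [smul_smul, smul_smul, ← add_smul]
      congr 1
      push_cast
      linear_combination (c.im : ℂ) * Complex.I_sq
    rw [this, tak_add, tak_ofReal_smul, tak_ofReal_smul, sub_eq_add_neg]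
    congr 1
    exact neg_smul c.im (G.tak x p X)
  have h3 : ∀ (r : ℝ) (w : ℂ) (Y : G.Tak), w ⊗ₜ[ℝ] (r • Y) = (r : ℂ) • (w ⊗ₜ[ℝ] Y) := by
    intro r w Y
    rw [TensorProduct.tmul_smul, TensorProduct.smul_tmul', TensorProduct.smul_tmul',
      Complex.real_smul, smul_eq_mul]
  have h4 : ∀ Y : G.Tak, Complex.I ⊗ₜ[ℝ] Y = Complex.I • ((1 : ℂ) ⊗ₜ[ℝ] Y) := fun Y => by
    rw [TensorProduct.smul_tmul', smul_eq_mul, mul_one]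
  rw [emb, emb, smul_comm c, h1, h2, TensorProduct.tmul_add, TensorProduct.tmul_sub]
  congr 1
  rw [h3, h3, h3, h3, h4, h4]
  conv_rhs => rw [← Complex.re_add_im c]
  have hI := Complex.I_mul_I
  match_scalars
  · ring
  · linear_combination (c.im : ℂ) * hI

theorem emb_eq_zero {x : OnePoint ℂ} {p : ℕ} (h : ¬ G.IsExp x p) (X : Aff 𝔤) :
    G.emb x p X = 0 := by
  have : ∀ X, G.tak x p X = 0 := fun X => by
    classical
    refine Subtype.ext (funext fun y => funext fun q => ?_)
    rw [coe_tak, proj, if_neg h]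
    split_ifs <;> rfl
  rw [emb, this, this, TensorProduct.tmul_zero, TensorProduct.tmul_zero, sub_zero, smul_zero]

theorem rotAv_hatS (x : OnePoint ℂ) (p : ℕ) : G.rotAv x p * G.hatS x p = G.rotAv x p := by
  rw [← G.hatS_rotAv]
  conv_lhs => rw [G.hatS_rotAv]
  rw [rotAv, smul_mul_assoc, mul_smul_comm, Finset.sum_mul, Finset.mul_sum]
  congr 1
  exact Finset.sum_congr rfl fun k _ => (Commute.pow_self _ k).eq

/-- At a point fixed by the rotations, the projection begins with the average over them, which
absorbs `hatS`, that is, `σ` times the twist. Linearity of the embedding takes the twist outside. -/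
theorem emb_sig {x : OnePoint ℂ} (hx : x = OnePoint.infty ∨ x = ((0 : ℂ) : OnePoint ℂ)) (p : ℕ)
    (X : Aff 𝔤) : G.twist x ^ p • G.emb x p (G.sig X) = G.emb x p X := by
  have h : ∀ X, G.proj x p (G.hatS x p X) = G.proj x p X := fun X => by
    unfold proj
    rw [if_pos hx, if_pos hx, ← Module.End.mul_apply, rotAv_hatS]
  have h2 : Complex.I • G.hatS x p X = G.hatS x p (Complex.I • X) := (map_smul _ _ _).symm
  rw [← emb_smul, ← LinearMap.smul_apply]
  change G.emb x p (G.hatS x p X) = _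
  rw [emb, emb, h2, G.tak_eq_of_proj_eq (h X), G.tak_eq_of_proj_eq (h (Complex.I • X))]

/-- The embedding `X ↦ X^{(x)}_p` as a linear map. -/
noncomputable def embLin (x : OnePoint ℂ) (p : ℕ) : Aff 𝔤 →ₗ[ℂ] G.TakC where
  toFun := G.emb x p
  map_add' := G.emb_add x p
  map_smul' := G.emb_smul x p

end GaudinData

/-- The linear embedding of `𝔤 ⊗ tⁿ`. -/
noncomputable def Aff.monoLin {𝔤 : Type*} [AddCommGroup 𝔤] [Module ℂ 𝔤] (n : ℤ) : 𝔤 →ₗ[ℂ] Aff 𝔤 :=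
  LinearMap.inl ℂ (ℤ →₀ 𝔤) (ℂ × ℂ) ∘ₗ Finsupp.lsingle n

namespace GaudinData

variable {𝔤 : Type*} [LieRing 𝔤] [LieAlgebra ℂ 𝔤] (G : GaudinData 𝔤)

theorem sig_mono (n : ℤ) (x : 𝔤) : G.sig (Aff.mono n x) = Aff.mono n (G.σ x) := by
  refine Aff.ext' (fun j => ?_) rfl rfl
  rw [loop_sig, Aff.loop_mono, Aff.loop_mono, Finsupp.single_apply, Finsupp.single_apply]
  split_ifs <;> simp

theorem sig_K : G.sig (Aff.K : Aff 𝔤) = Aff.K :=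
  Aff.ext' (fun _ => map_zero G.σ) rfl rfl

theorem sig_D : G.sig (Aff.D : Aff 𝔤) = Aff.D :=
  Aff.ext' (fun _ => map_zero G.σ) rfl rfl

/-! ### Eigenvector property and vanishing of the formal fields -/

section Canonical

variable {ι : Type*} [Fintype ι] [DecidableEq ι] (b : Module.Basis ι ℂ 𝔤)

/-- Invariance of the canonical element of `𝔤 ⊗ 𝔤` under `σ`. -/
theorem sum_dualBasis_σ {M : Type*} [AddCommGroup M] [Module ℂ M] (φ : 𝔤 →ₗ[ℂ] 𝔤 →ₗ[ℂ] M) :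
    ∑ a, φ (G.σ (G.κ.dualBasis G.κ_nondeg b a)) (G.σ (b a)) =
      ∑ a, φ (G.κ.dualBasis G.κ_nondeg b a) (b a) := by
  set b' := G.κ.dualBasis G.κ_nondeg b with hb'
  have left : ∀ w, ∑ a, G.κ w (b a) • b' a = w := fun w => by
    conv_rhs => rw [← b'.sum_repr w]
    exact Finset.sum_congr rfl fun a _ => by rw [LinearMap.BilinForm.dualBasis_repr_apply]
  have coord : ∀ w c, G.κ (b' c) w = b.repr w c := fun w c => by
    conv_lhs => rw [← b.sum_repr w]
    simp only [map_sum, map_smul, hb', LinearMap.BilinForm.apply_dualBasis_left]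
    simp
  have right : ∀ w, ∑ c, G.κ (b' c) w • b c = w := fun w => by
    conv_rhs => rw [← b.sum_repr w]
    exact Finset.sum_congr rfl fun c _ => by rw [coord]
  -- Surjectivity of `σ`, with `σ ^ (T - 1)` as right inverse.
  have hσ : ∀ c, ∃ w, G.σ w = b' c := fun c =>
    ⟨(⇑G.σ)^[G.T - 1] (b' c), by
      rw [← Function.iterate_succ_apply' (⇑G.σ), Nat.succ_eq_add_one,
        Nat.sub_add_cancel G.T_pos, G.σ_pow]⟩
  -- Expand `σ (b a)` in the basis `b`. If `b' c = σ w`, its coefficients are `κ w (b a)` by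
  -- isometry, and summing over `a` reassembles `σ w = b' c` in the other factor.
  calc ∑ a, φ (G.σ (b' a)) (G.σ (b a))
      = ∑ a, ∑ c, G.κ (b' c) (G.σ (b a)) • φ (G.σ (b' a)) (b c) := by
        refine Finset.sum_congr rfl fun a _ => ?_
        conv_lhs => rw [← right (G.σ (b a))]
        rw [map_sum]
        simp only [map_smul]
    _ = ∑ c, φ (∑ a, G.κ (b' c) (G.σ (b a)) • G.σ (b' a)) (b c) := by
        rw [Finset.sum_comm]
        simp only [map_sum, map_smul, LinearMap.sum_apply, LinearMap.smul_apply]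
    _ = _ := by
        refine Finset.sum_congr rfl fun c _ => ?_
        obtain ⟨w, hw⟩ := hσ c
        simp only [← hw, G.κ_σ, ← map_smul, ← map_sum, left]

theorem canon_eq_zero {u : Aff 𝔤 → Aff 𝔤} {v : Aff 𝔤 → G.TakC} (hv : ∀ X, v X = 0)
    (h : ∀ (k : ℕ) (n : ℤ) (x y : 𝔤), k ≤ n.natAbs →
      u (Aff.mono (-n) y) ⊗ₜ[ℂ] v (Aff.mono n x) ∈ G.filField.F k) : G.canon b u v h = 0 := by
  refine Subtype.ext (funext fun k => ?_)
  change (G.filField.F k).mkQ _ = 0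
  simp [hv]

/-- On fields `σ` acts on the first factor only, but by `emb_sig` it may also be applied inside the
embedding at the cost of the twist. What remains is the canonical element transformed by `σ ⊗ σ`,
which is invariant degree by degree and on the terms in `K` and `D`. -/
theorem sigF_field {x : OnePoint ℂ} (hx : x = OnePoint.infty ∨ x = ((0 : ℂ) : OnePoint ℂ))
    (p : ℕ) : G.sigF (G.field b x p) = G.twist x ^ p • G.field b x p := by
  refine Subtype.ext (funext fun k => ?_)
  change (G.filField.F k).mkQ (TensorProduct.map G.sig LinearMap.id _) =
    G.twist x ^ p • (G.filField.F k).mkQ _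
  rw [← map_smul]
  congr 1
  have hs : ∀ X Y : Aff 𝔤, TensorProduct.map G.sig LinearMap.id (X ⊗ₜ[ℂ] G.emb x p Y) =
      G.twist x ^ p • (G.sig X ⊗ₜ[ℂ] G.emb x p (G.sig Y)) := fun X Y => by
    rw [TensorProduct.map_tmul, ← TensorProduct.tmul_smul, G.emb_sig hx]
    rfl
  simp only [map_add, map_sum, smul_add, Finset.smul_sum, id_eq, hs]
  congr 1
  · rw [sig_K, sig_D]
  refine Finset.sum_congr rfl fun n _ => ?_
  simp only [sig_mono]
  rw [← Finset.smul_sum, ← Finset.smul_sum]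
  congr 1
  exact G.sum_dualBasis_σ b (M := Aff 𝔤 ⊗[ℂ] G.TakC) ((TensorProduct.mk ℂ (Aff 𝔤) G.TakC ∘ₗ Aff.monoLin (-n)).compl₂
    (G.embLin x p ∘ₗ Aff.monoLin n))

theorem isExp_coe (x : ℂ) (p : ℕ) : G.IsExp (x : OnePoint ℂ) p ↔ p < G.n x := Iff.rfl

theorem isExp_infty (p : ℕ) : G.IsExp OnePoint.infty p ↔ 1 ≤ p ∧ p < G.nInf := Iff.rfl

theorem not_free_zero : ¬ G.Free ((0 : ℂ) : OnePoint ℂ) :=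
  fun h => h ⟨0, G.refl_fixed (Or.inr rfl) 0⟩

theorem zero_notMem_zc : (0 : ℂ) ∉ G.zc := fun h =>
  G.not_free_zero (by classical exact (Finset.mem_filter.1 h).2)

theorem A_zero (p : ℕ) : G.A b 0 p = G.field b ((0 : ℂ) : OnePoint ℂ) p := by
  rw [A, dif_neg (by rw [map_zero]; exact G.zero_notMem_zc)]

theorem sigF_A_zero (p : ℕ) : G.sigF (G.A b 0 p) = (G.ω⁻¹) ^ p • G.A b 0 p := by
  rw [A_zero]
  exact G.sigF_field b (Or.inr rfl) p

theorem sigF_AInf (p : ℕ) : G.sigF (G.AInf b p) = G.ω ^ p • G.AInf b p :=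
  G.sigF_field b (Or.inl rfl) p

theorem mult_zero : G.mult 0 = G.n 0 := by
  rw [mult, if_neg (by rw [map_zero]; exact G.zero_notMem_zc)]

theorem A_eq_zero (x : ℂ) (p : ℕ) (h : G.mult x ≤ p) : G.A b x p = 0 := by
  unfold mult at h
  unfold A
  split_ifs at h ⊢ with hx
  · exact G.canon_eq_zero b (fun X => by
      rw [G.emb_eq_zero (by rw [isExp_coe]; omega), map_zero]) _
  · exact G.canon_eq_zero b (G.emb_eq_zero (by rw [isExp_coe]; omega)) _

theorem AInf_eq_zero (p : ℕ) (h : G.nInf ≤ p) : G.AInf b p = 0 := by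
  unfold AInf field
  exact G.canon_eq_zero b (G.emb_eq_zero (by rw [isExp_infty]; omega)) _

end Canonical

/-! ### The positions of the poles -/

theorem ω_ne_zero : G.ω ≠ 0 := G.ω_prim.ne_zero (by have := G.T_pos; omega)

theorem mem_Zp {x : ℂ} : x ∈ G.Zp ↔ (x ∈ G.z ∧ x ≠ 0) ∨ starRingEnd ℂ x ∈ G.zc := by
  classical
  rw [Zp, Finset.mem_union, Finset.mem_erase, Finset.mem_image, and_comm]
  refine or_congr_right ⟨?_, fun h => ⟨_, h, Complex.conj_conj x⟩⟩
  rintro ⟨y, hy, rfl⟩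
  rwa [Complex.conj_conj]

theorem mem_zc {x : ℂ} : x ∈ G.zc ↔ x ∈ G.z ∧ G.Free x := by
  classical
  rw [zc, Finset.mem_filter]

theorem ne_zero_of_mem_Zp {x : ℂ} (hx : x ∈ G.Zp) : x ≠ 0 := by
  rcases G.mem_Zp.1 hx with h | h
  · exact h.2
  · rintro rfl
    rw [map_zero] at h
    exact G.zero_notMem_zc h

theorem zero_notMem_Zp : (0 : ℂ) ∉ G.Zp := fun h => G.ne_zero_of_mem_Zp h rfl

theorem ne_of_mem_zc {x : ℂ} (hx : x ∈ G.zc) (k : ℕ) : G.ω ^ k * starRingEnd ℂ x ≠ x := fun h =>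
  (G.mem_zc.1 hx).2 ⟨k, by rw [refl, OnePoint.map_some, h]⟩

theorem conj_ω_pow (k : ℕ) : starRingEnd ℂ (G.ω ^ k) = (G.ω ^ k)⁻¹ := by
  refine eq_inv_of_mul_eq_one_left ?_
  rw [mul_comm, Complex.mul_conj, Complex.normSq_eq_norm_sq, norm_pow, G.ω_norm]
  simp

/-- If both points lie in the divisor, or both are conjugates of free points, disjointness of orbits
applies directly or after conjugation. In the mixed cases it identifies the divisor point with the
free point, which would then be fixed by a reflection. -/
theorem eq_of_ω_pow_mul_eq {x y : ℂ} (hx : x ∈ G.Zp) (hy : y ∈ G.Zp) {k : ℕ}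
    (h : G.ω ^ k * x = y) : x = y := by
  have hk : G.ω ^ k ≠ 0 := pow_ne_zero _ G.ω_ne_zero
  rcases G.mem_Zp.1 hx with h1 | h1 <;> rcases G.mem_Zp.1 hy with h2 | h2
  · exact G.disj x h1.1 y h2.1 k (Or.inl h)
  · exfalso
    -- Disjointness is stated with natural exponents, so the inverse rotation is written as a
    -- positive power.
    have hj : G.ω ^ (k * (G.T - 1)) = (G.ω ^ k)⁻¹ := by
      refine eq_inv_of_mul_eq_one_left ?_
      rw [← pow_add, ← Nat.mul_succ, Nat.succ_eq_add_one, Nat.sub_add_cancel G.T_pos, mul_comm,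
        pow_mul, G.ω_prim.pow_eq_one, one_pow]
    have e := G.disj x h1.1 _ (G.mem_zc.1 h2).1 (k * (G.T - 1)) (Or.inr (by
      rw [hj, ← h, map_mul, G.conj_ω_pow]))
    refine G.ne_of_mem_zc h2 (k * (G.T - 1)) ?_
    rw [Complex.conj_conj, hj, ← e, ← h, inv_mul_cancel_left₀ hk]
  · exfalso
    have e := G.disj _ (G.mem_zc.1 h1).1 y h2.1 k (Or.inr (by rw [Complex.conj_conj, h]))
    refine G.ne_of_mem_zc h1 k ?_
    rw [Complex.conj_conj, h, e]
  · have e := G.disj _ (G.mem_zc.1 h2).1 _ (G.mem_zc.1 h1).1 k (Or.inl (by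
      rw [← h, map_mul, G.conj_ω_pow, mul_inv_cancel_left₀ hk]))
    exact (star_injective e).symm

end GaudinData

/-! ### Homogeneity of the coefficients under rotations -/

section Rotation

variable {V W : Type*} [AddCommGroup V] [Module ℂ V] [AddCommGroup W] [Module ℂ W]

/-- The polar part at `ζ * a` obtained from the polar part `f` at `a` by a rotation. -/
def rotSeq (ζ : ℂ) (ρ : Module.End ℂ V) (f : ℕ → V) (q : ℕ) : V := ζ ^ q • ρ (f q)

variable {B : V →ₗ[ℂ] V →ₗ[ℂ] W} {ρ : Module.End ℂ V} {ζ : ℂ}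

theorem crossPolar_smul_smul (B : V →ₗ[ℂ] V →ₗ[ℂ] W) (a b α β : ℂ) (f g : ℕ → V) (N M p : ℕ) :
    crossPolar B a b (fun q => α • f q) (fun q => β • g q) N M p =
      (α * β) • crossPolar B a b f g N M p := by
  simp only [crossPolar, Finset.smul_sum, map_smul, LinearMap.smul_apply, smul_smul]
  refine Finset.sum_congr rfl fun q _ => Finset.sum_congr rfl fun s _ => ?_
  congr 1
  ring

theorem mixedPolar_smul (B : V →ₗ[ℂ] V →ₗ[ℂ] W) (a α : ℂ) (f d : ℕ → V) (N Q p : ℕ) :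
    mixedPolar B a (fun q => α • f q) d N Q p = α • mixedPolar B a f d N Q p := by
  simp only [mixedPolar, Finset.smul_sum, map_smul, LinearMap.smul_apply, smul_smul, mul_comm α]

theorem mixedRegular_smul (B : V →ₗ[ℂ] V →ₗ[ℂ] W) (a α : ℂ) (f d : ℕ → V) (N Q p : ℕ) :
    mixedRegular B a (fun q => α • f q) d N Q p = α • mixedRegular B a f d N Q p := by
  simp only [mixedRegular, Finset.smul_sum, map_smul, LinearMap.smul_apply, smul_smul, mul_comm α]

theorem selfPolar_smul (B : V →ₗ[ℂ] V →ₗ[ℂ] W) (α : ℂ) (f : ℕ → V) (p : ℕ) :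
    selfPolar B (fun q => α • f q) p = (α * α) • selfPolar B f p := by
  simp only [selfPolar, Finset.smul_sum, map_smul, LinearMap.smul_apply, smul_smul]

/-- Invariance of `B` removes `ρ`; the sequences contribute `ζ ^ (p + s + q)` and the denominator `ζ
^ (q + s + 1)`. The weight `ζ^{p-1}` is written `ζ ^ p * ζ⁻¹` so as to be correct at `p = 0`. -/
theorem crossPolar_rotSeq (hρ : ∀ x y, B (ρ x) (ρ y) = B x y) (hζ : ζ ≠ 0) (a b : ℂ)
    (f g : ℕ → V) (N M p : ℕ) :
    crossPolar B (ζ * a) (ζ * b) (rotSeq ζ ρ f) (rotSeq ζ ρ g) N M p =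
      (ζ ^ p * ζ⁻¹) • crossPolar B a b f g N M p := by
  simp only [crossPolar, rotSeq, Finset.smul_sum, map_smul, LinearMap.smul_apply, smul_smul, hρ]
  refine Finset.sum_congr rfl fun q _ => Finset.sum_congr rfl fun s _ => ?_
  congr 1
  have e : ζ ^ q * ζ ^ (p + s) * (ζ ^ (q + s + 1))⁻¹ = ζ ^ p * ζ⁻¹ := by
    field_simp
    ring
  rw [← mul_sub, mul_pow, div_eq_mul_inv, div_eq_mul_inv, mul_inv]
  linear_combination (((q + s).choose s : ℂ) * (-1) ^ s * ((a - b) ^ (q + s + 1))⁻¹) * e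

theorem selfPolar_rotSeq (hρ : ∀ x y, B (ρ x) (ρ y) = B x y) (hζ : ζ ≠ 0) (f : ℕ → V) (p : ℕ) :
    selfPolar B (rotSeq ζ ρ f) p = (ζ ^ p * ζ⁻¹) • selfPolar B f p := by
  simp only [selfPolar, rotSeq, Finset.smul_sum, map_smul, LinearMap.smul_apply, smul_smul, hρ]
  refine Finset.sum_congr rfl fun q hq => ?_
  have := Finset.mem_range.1 hq
  obtain ⟨r, rfl⟩ : ∃ r, p = q + r + 1 := ⟨p - q - 1, by omega⟩
  rw [show q + r + 1 - q - 1 = r by omega]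
  congr 1
  field_simp
  ring

/-- Moving `ρ` across `B` onto the eigenvector `d q` costs `ζ^{-(q+1)}`. Together with `ζ^{q-s}`
from the position and `ζ^{p+s}` from the sequence this gives the same weight as in
`crossPolar_rotSeq`. -/
theorem mixedPolar_rotSeq (hρ : ∀ x y, B (ρ x) (ρ y) = B x y) (hζ : ζ ≠ 0) (a : ℂ)
    (f : ℕ → V) {d : ℕ → V} (hd : ∀ q, ρ (d q) = ζ ^ (q + 1) • d q) (N Q p : ℕ) :
    mixedPolar B (ζ * a) (rotSeq ζ ρ f) d N Q p = (ζ ^ p * ζ⁻¹) • mixedPolar B a f d N Q p := by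
  have h : ∀ x q, B (ρ x) (d q) = (ζ ^ (q + 1))⁻¹ • B x (d q) := fun x q => by
    rw [← hρ x, hd, map_smul, inv_smul_smul₀ (pow_ne_zero _ hζ)]
  simp only [mixedPolar, rotSeq, Finset.smul_sum, map_smul, LinearMap.smul_apply, smul_smul, h]
  refine Finset.sum_congr rfl fun q _ => Finset.sum_congr rfl fun s _ => ?_
  congr 1
  rcases Nat.lt_or_ge q s with hqs | hqs
  · rw [Nat.choose_eq_zero_of_lt hqs]; simp
  · obtain ⟨t, rfl⟩ := Nat.exists_eq_add_of_le hqs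
    rw [Nat.add_sub_cancel_left]
    field_simp
    ring

/-- The exponents are `s - p` from the position, `p` from the sequence and `-(r + s + 2)` from the
eigenvector; they add up to `-(r + 2)`. -/
theorem mixedRegular_rotSeq (hρ : ∀ x y, B (ρ x) (ρ y) = B x y) (hζ : ζ ≠ 0) (a : ℂ)
    (f : ℕ → V) {d : ℕ → V} (hd : ∀ q, ρ (d q) = ζ ^ (q + 1) • d q) (N Q r : ℕ) :
    mixedRegular B (ζ * a) (rotSeq ζ ρ f) d N Q r =
      (ζ ^ (r + 2))⁻¹ • mixedRegular B a f d N Q r := by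
  have h : ∀ x q, B (ρ x) (d q) = (ζ ^ (q + 1))⁻¹ • B x (d q) := fun x q => by
    rw [← hρ x, hd, map_smul, inv_smul_smul₀ (pow_ne_zero _ hζ)]
  simp only [mixedRegular, rotSeq, Finset.smul_sum, map_smul, LinearMap.smul_apply, smul_smul, h]
  refine Finset.sum_congr rfl fun q _ => Finset.sum_congr rfl fun s _ => ?_
  congr 1
  rcases Nat.lt_or_ge s q with hqs | hqs
  · rw [Nat.choose_eq_zero_of_lt hqs]; simp
  · obtain ⟨t, rfl⟩ := Nat.exists_eq_add_of_le hqs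
    rw [Nat.add_sub_cancel_left]
    field_simp
    ring

theorem selfRegular_eq_smul (hρ : ∀ x y, B (ρ x) (ρ y) = B x y) (hζ : ζ ≠ 0) {d : ℕ → V}
    (hd : ∀ q, ρ (d q) = ζ ^ (q + 1) • d q) (r : ℕ) :
    selfRegular B d r = (ζ ^ (r + 2))⁻¹ • selfRegular B d r := by
  rw [eq_inv_smul_iff₀ (pow_ne_zero _ hζ)]
  simp only [selfRegular, Finset.smul_sum]
  refine Finset.sum_congr rfl fun p hp => ?_
  have := Finset.mem_range.1 hp
  conv_rhs => rw [← hρ, hd, hd, map_smul, map_smul, LinearMap.smul_apply, smul_smul, ← pow_add]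
  rw [show r - p + 1 + (p + 1) = r + 2 by omega]

end Rotation

theorem sum_range_add_of_periodic {M : Type*} [AddCommGroup M] {T : ℕ} {g : ℕ → M}
    (hg : ∀ k, g (k + T) = g k) (k : ℕ) :
    ∑ l ∈ Finset.range T, g (k + l) = ∑ l ∈ Finset.range T, g l := by
  induction k with
  | zero => simp
  | succ k ih =>
    rw [← ih]
    have h := Finset.sum_range_succ (fun l => g (k + l)) T
    rw [Finset.sum_range_succ', hg, add_zero] at h
    rw [← add_right_cancel h]
    exact Finset.sum_congr rfl fun l _ => by rw [Nat.add_right_comm, Nat.add_assoc]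

theorem IsPrimitiveRoot.pow_mul_inv_eq_one_iff {ω : ℂ} {T : ℕ} (hω : IsPrimitiveRoot ω T)
    (hT : 1 ≤ T) (p : ℕ) : ω ^ p * ω⁻¹ = 1 ↔ p ≡ 1 [MOD T] := by
  have h0 : ω ≠ 0 := hω.ne_zero (by omega)
  rw [mul_inv_eq_one₀ h0]
  refine ⟨fun h => ?_, fun h => ?_⟩
  · refine hω.pow_inj (Nat.mod_lt _ hT) (Nat.mod_lt _ hT) ?_
    rw [← pow_eq_pow_mod p hω.pow_eq_one, ← pow_eq_pow_mod 1 hω.pow_eq_one, h, pow_one]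
  · rw [pow_eq_pow_mod p hω.pow_eq_one, show p % T = 1 % T from h,
      ← pow_eq_pow_mod 1 hω.pow_eq_one, pow_one]

theorem sum_pow_eq_ite {ζ : ℂ} {T : ℕ} (hT : 1 ≤ T) (hζ : ζ ^ T = 1) [Decidable (ζ = 1)] :
    1 / (T : ℂ) * ∑ k ∈ Finset.range T, ζ ^ k = if ζ = 1 then 1 else 0 := by
  have hT' : (T : ℂ) ≠ 0 := Nat.cast_ne_zero.2 (by omega)
  split_ifs with h
  · subst h
    simp [hT']
  · rw [geom_sum_eq h, hζ, sub_self, zero_div, mul_zero]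

theorem eq_zero_of_eq_smul {W : Type*} [AddCommGroup W] [Module ℂ W] {ζ : ℂ} {w : W}
    (h : w = ζ • w) (hζ : ζ ≠ 1) : w = 0 := by
  have : (1 - ζ) • w = 0 := by rw [sub_smul, one_smul, ← h, sub_self]
  exact (smul_eq_zero.1 this).resolve_left (sub_ne_zero.2 hζ.symm)

/-! ### Coefficients of an equivariant Lax matrix -/

section Poles

variable {V W X : Type*} [AddCommGroup V] [Module ℂ V] [AddCommGroup W] [Module ℂ W]

/-- The positions of the poles: `0` and the images of the points `pt x` under the rotations. -/
def polePos (T : ℕ) (ω : ℂ) (pt : X → ℂ) : Option (Fin T × X) → ℂ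
  | none => 0
  | some (k, x) => ω ^ (k : ℕ) * pt x

/-- The polar parts: `A₀` at `0` and the images of the `A x` under the rotations. -/
noncomputable def poleSeq (T : ℕ) (ω : ℂ) (σ : Module.End ℂ V) (A : X → ℕ → V) (A₀ : ℕ → V) :
    Option (Fin T × X) → ℕ → V
  | none => A₀
  | some (k, x) => fun q => (1 / (T : ℂ)) • rotSeq (ω ^ (k : ℕ)) (σ ^ (k : ℕ)) (A x) q

/-- The bounds for the orders of the poles. -/
def poleMult (T : ℕ) (N : X → ℕ) (N₀ : ℕ) : Option (Fin T × X) → ℕ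
  | none => N₀
  | some (_, x) => N x

theorem crossPolar_smul_left (B : V →ₗ[ℂ] V →ₗ[ℂ] W) (a b α : ℂ) (f g : ℕ → V) (N M p : ℕ) :
    crossPolar B a b (fun q => α • f q) g N M p = α • crossPolar B a b f g N M p := by
  simpa using crossPolar_smul_smul B a b α 1 f g N M p

theorem crossPolar_smul_right (B : V →ₗ[ℂ] V →ₗ[ℂ] W) (a b β : ℂ) (f g : ℕ → V) (N M p : ℕ) :
    crossPolar B a b f (fun q => β • g q) N M p = β • crossPolar B a b f g N M p := by
  simpa using crossPolar_smul_smul B a b 1 β f g N M p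

theorem rotSeq_add (ω : ℂ) (σ : Module.End ℂ V) (k l : ℕ) (f : ℕ → V) :
    rotSeq (ω ^ (k + l)) (σ ^ (k + l)) f =
      rotSeq (ω ^ k) (σ ^ k) (rotSeq (ω ^ l) (σ ^ l) f) := by
  funext q
  rw [rotSeq, rotSeq, rotSeq, map_smul, smul_smul, pow_add, mul_pow, pow_add, Module.End.mul_apply]

theorem pow_apply_eq_smul {σ : Module.End ℂ V} {c : ℂ} {v : V} (h : σ v = c • v) (k : ℕ) :
    (σ ^ k) v = c ^ k • v := by
  induction k with
  | zero => simp
  | succ k ih => rw [pow_succ, Module.End.mul_apply, h, map_smul, ih, smul_smul, ← pow_succ']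

variable [Fintype X] {B : V →ₗ[ℂ] V →ₗ[ℂ] W} {σ : Module.End ℂ V} {T : ℕ} {ω : ℂ} {pt : X → ℂ}
  {A : X → ℕ → V} {A₀ d : ℕ → V} {N : X → ℕ} {N₀ Q : ℕ}

/-- The coefficient of the pole of order `p + 1` at `pt x`, up to the factor `1 / T ^ 2`. -/
noncomputable def dihedralPolar (B : V →ₗ[ℂ] V →ₗ[ℂ] W) (σ : Module.End ℂ V) (T : ℕ) (ω : ℂ)
    (pt : X → ℂ) (A : X → ℕ → V) (A₀ d : ℕ → V) (N : X → ℕ) (N₀ Q : ℕ) (x : X) (p : ℕ) : W :=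
  ∑ l ∈ Finset.range T, ∑ y, crossPolar B (pt x) (ω ^ l * pt y) (A x)
      (rotSeq (ω ^ l) (σ ^ l) (A y)) (N x) (N y) p
    + (T : ℂ) • crossPolar B (pt x) 0 (A x) A₀ (N x) N₀ p
    - (T : ℂ) • mixedPolar B (pt x) (A x) d (N x) Q p + (1 / 2 : ℂ) • selfPolar B (A x) p

theorem pow_isometry (hσ : ∀ x y, B (σ x) (σ y) = B x y) (k : ℕ) (x y : V) :
    B ((σ ^ k) x) ((σ ^ k) y) = B x y := by
  induction k with
  | zero => rfl
  | succ k ih => rw [pow_succ', Module.End.mul_apply, Module.End.mul_apply, hσ, ih]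

/-- The weight `ω ^ (k * q)` of the rotation cancels the eigenvalue of `σ ^ k`: the polar part at
the fixed point `0` is invariant. -/
theorem rotSeq_eq_self (hω : ω ≠ 0) (hA₀ : ∀ p, σ (A₀ p) = ω⁻¹ ^ p • A₀ p) (k : ℕ) :
    rotSeq (ω ^ k) (σ ^ k) A₀ = A₀ := by
  funext q
  rw [rotSeq, pow_apply_eq_smul (hA₀ q), smul_smul, ← pow_mul, ← pow_mul, mul_comm q k, ← mul_pow,
    mul_inv_cancel₀ hω, one_pow, one_smul]

theorem pow_apply_regular (hd : ∀ q, σ (d q) = ω ^ (q + 1) • d q) (k q : ℕ) :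
    (σ ^ k) (d q) = (ω ^ k) ^ (q + 1) • d q := by
  rw [pow_apply_eq_smul (hd q), ← pow_mul, ← pow_mul, mul_comm]

/-- All contributions scale by the same weight when the configuration is rotated by `ω ^ k`. A pair
of rotated polar parts carries `1 / T ^ 2`, but a pairing with the part at `0` or with the
polynomial only `1 / T`, whence the factors `T` in `dihedralPolar`. -/
theorem polarCoeff_some (hT : 1 ≤ T) (hω : ω ^ T = 1) (hB : ∀ x y, B (σ x) (σ y) = B x y)
    (hσ : σ ^ T = 1) (hA₀ : ∀ p, σ (A₀ p) = ω⁻¹ ^ p • A₀ p)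
    (hd : ∀ q, σ (d q) = ω ^ (q + 1) • d q) (k : Fin T) (x : X) (p : ℕ) :
    polarCoeff B (polePos T ω pt) (poleSeq T ω σ A A₀) d (poleMult T N N₀) Q (some (k, x)) p =
      (1 / (T : ℂ) ^ 2) • ((ω ^ (k : ℕ)) ^ p * (ω ^ (k : ℕ))⁻¹) •
        dihedralPolar B σ T ω pt A A₀ d N N₀ Q x p := by
  obtain ⟨k, hk⟩ := k
  have hT' : (T : ℂ) ≠ 0 := Nat.cast_ne_zero.2 (by omega)
  have hω0 : ω ≠ 0 := fun h => by rw [h, zero_pow (by omega)] at hω; exact zero_ne_one hω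
  have hζ : ω ^ k ≠ 0 := pow_ne_zero _ hω0
  have hρ := pow_isometry hB k
  have h0 : crossPolar B (ω ^ k * pt x) 0 (rotSeq (ω ^ k) (σ ^ k) (A x)) A₀ (N x) N₀ p =
      ((ω ^ k) ^ p * (ω ^ k)⁻¹) • crossPolar B (pt x) 0 (A x) A₀ (N x) N₀ p := by
    rw [← crossPolar_rotSeq hρ hζ, rotSeq_eq_self hω0 hA₀, mul_zero]
  have h1 : ∑ l ∈ Finset.range T, ∑ y, crossPolar B (ω ^ k * pt x) (ω ^ l * pt y)
      (rotSeq (ω ^ k) (σ ^ k) (A x)) (rotSeq (ω ^ l) (σ ^ l) (A y)) (N x) (N y) p =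
      ((ω ^ k) ^ p * (ω ^ k)⁻¹) • ∑ l ∈ Finset.range T, ∑ y, crossPolar B (pt x)
        (ω ^ l * pt y) (A x) (rotSeq (ω ^ l) (σ ^ l) (A y)) (N x) (N y) p := by
    -- Only the relative rotation matters: since `ω ^ T = 1` and `σ ^ T = 1`, the summation index
    -- can be shifted from `l` to `k + l`.
    rw [← sum_range_add_of_periodic (fun l => by simp only [pow_add, hω, hσ, mul_one]) k]
    simp only [Finset.smul_sum, ← crossPolar_rotSeq hρ hζ, rotSeq_add]
    simp only [pow_add ω k, mul_assoc]
  simp only [polarCoeff, Fintype.sum_option, Fintype.sum_prod_type, polePos, poleSeq, poleMult,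
    crossPolar_smul_left, crossPolar_smul_right, mixedPolar_smul, selfPolar_smul, selfPolar_rotSeq hρ hζ,
    mixedPolar_rotSeq hρ hζ _ _ (pow_apply_regular hd k), h0, ← Finset.smul_sum]
  rw [Fin.sum_univ_eq_sum_range (fun l => ∑ y, crossPolar B (ω ^ k * pt x) (ω ^ l * pt y)
    (rotSeq (ω ^ k) (σ ^ k) (A x)) (rotSeq (ω ^ l) (σ ^ l) (A y)) (N x) (N y) p) T, h1,
    dihedralPolar]
  match_scalars <;> field_simp

/-- The cross terms with the rotated points form a geometric sum in `ω ^ p * ω⁻¹`, whose average is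
`1` or `0`. The other two terms equal their own multiples by this root of unity, so they vanish when
it is not `1`. -/
theorem polarCoeff_none (hT : 1 ≤ T) (hω : IsPrimitiveRoot ω T)
    (hB : ∀ x y, B (σ x) (σ y) = B x y) (hA₀ : ∀ p, σ (A₀ p) = ω⁻¹ ^ p • A₀ p)
    (hd : ∀ q, σ (d q) = ω ^ (q + 1) • d q) (p : ℕ) [Decidable (p ≡ 1 [MOD T])] :
    polarCoeff B (polePos T ω pt) (poleSeq T ω σ A A₀) d (poleMult T N N₀) Q none p =
      if p ≡ 1 [MOD T] then ∑ x, crossPolar B 0 (pt x) A₀ (A x) N₀ (N x) p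
        - mixedPolar B 0 A₀ d N₀ Q p + (1 / 2 : ℂ) • selfPolar B A₀ p else 0 := by
  have hω0 : ω ≠ 0 := hω.ne_zero (by omega)
  have hA1 := rotSeq_eq_self hω0 hA₀ 1
  rw [pow_one, pow_one] at hA1
  have h0 : ∀ (k : ℕ) x, crossPolar B 0 (ω ^ k * pt x) A₀ (rotSeq (ω ^ k) (σ ^ k) (A x)) N₀ (N x) p
      = (ω ^ p * ω⁻¹) ^ k • crossPolar B 0 (pt x) A₀ (A x) N₀ (N x) p := by
    intro k x
    rw [mul_pow, inv_pow, ← pow_mul, mul_comm p, pow_mul,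
      ← crossPolar_rotSeq (pow_isometry hB k) (pow_ne_zero k hω0), rotSeq_eq_self hω0 hA₀, mul_zero]
  have hm : mixedPolar B 0 A₀ d N₀ Q p = (ω ^ p * ω⁻¹) • mixedPolar B 0 A₀ d N₀ Q p := by
    rw [← mixedPolar_rotSeq hB hω0 _ _ hd, hA1, mul_zero]
  have hs : selfPolar B A₀ p = (ω ^ p * ω⁻¹) • selfPolar B A₀ p := by
    rw [← selfPolar_rotSeq hB hω0, hA1]
  have hζ : (ω ^ p * ω⁻¹) ^ T = 1 := by
    rw [mul_pow, inv_pow, hω.pow_eq_one, ← pow_mul, mul_comm, mul_comm p, pow_mul, hω.pow_eq_one]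
    simp
  classical
  simp only [polarCoeff, Fintype.sum_option, Fintype.sum_prod_type, polePos, poleSeq, poleMult,
    crossPolar_self, crossPolar_smul_right, h0, zero_add, ← Finset.smul_sum, ← Finset.sum_smul]
  rw [Fin.sum_univ_eq_sum_range (fun k => (ω ^ p * ω⁻¹) ^ k) T, smul_smul, sum_pow_eq_ite hT hζ]
  simp only [hω.pow_mul_inv_eq_one_iff hT]
  split_ifs with h
  · rw [one_smul]
  · rw [← hω.pow_mul_inv_eq_one_iff hT] at h
    rw [eq_zero_of_eq_smul hm h, eq_zero_of_eq_smul hs h]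
    simp

/-- Same projector argument as at `0`, now with the root of unity `(ω ^ (r + 2))⁻¹`. -/
theorem regularCoeff_poles (hT : 1 ≤ T) (hω : IsPrimitiveRoot ω T)
    (hB : ∀ x y, B (σ x) (σ y) = B x y) (hA₀ : ∀ p, σ (A₀ p) = ω⁻¹ ^ p • A₀ p)
    (hd : ∀ q, σ (d q) = ω ^ (q + 1) • d q) (r : ℕ) [Decidable (r + 2 ≡ 0 [MOD T])] :
    regularCoeff B (polePos T ω pt) (poleSeq T ω σ A A₀) d (poleMult T N N₀) Q r =
      if r + 2 ≡ 0 [MOD T] then -(∑ x, mixedRegular B (pt x) (A x) d (N x) Q r)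
        - mixedRegular B 0 A₀ d N₀ Q r + (1 / 2 : ℂ) • selfRegular B d r else 0 := by
  have hω0 : ω ≠ 0 := hω.ne_zero (by omega)
  have hA1 := rotSeq_eq_self hω0 hA₀ 1
  rw [pow_one, pow_one] at hA1
  have h0 : ∀ (k : ℕ) x, mixedRegular B (ω ^ k * pt x) (rotSeq (ω ^ k) (σ ^ k) (A x)) d (N x) Q r
      = ((ω ^ (r + 2))⁻¹) ^ k • mixedRegular B (pt x) (A x) d (N x) Q r := by
    intro k x
    rw [inv_pow, ← pow_mul, mul_comm (r + 2), pow_mul, ← mixedRegular_rotSeq (pow_isometry hB k)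
      (pow_ne_zero k hω0) _ _ (pow_apply_regular hd k)]
  have hm : mixedRegular B 0 A₀ d N₀ Q r =
      (ω ^ (r + 2))⁻¹ • mixedRegular B 0 A₀ d N₀ Q r := by
    rw [← mixedRegular_rotSeq hB hω0 _ _ hd, hA1, mul_zero]
  have hs := selfRegular_eq_smul hB hω0 hd r
  have hζ : ((ω ^ (r + 2))⁻¹) ^ T = 1 := by
    rw [inv_pow, ← pow_mul, mul_comm, pow_mul, hω.pow_eq_one, one_pow, inv_one]
  have hiff : (ω ^ (r + 2))⁻¹ = 1 ↔ r + 2 ≡ 0 [MOD T] := by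
    rw [inv_eq_one, hω.pow_eq_one_iff_dvd, Nat.modEq_zero_iff_dvd]
  classical
  simp only [regularCoeff, Fintype.sum_option, Fintype.sum_prod_type, polePos, poleSeq, poleMult,
    mixedRegular_smul, h0, ← Finset.smul_sum, ← Finset.sum_smul]
  rw [Fin.sum_univ_eq_sum_range (fun k => ((ω ^ (r + 2))⁻¹) ^ k) T, smul_smul,
    sum_pow_eq_ite hT hζ]
  simp only [hiff]
  split_ifs with h
  · rw [one_smul]
    abel
  · rw [← hiff] at h
    rw [eq_zero_of_eq_smul hm h, eq_zero_of_eq_smul hs h]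
    simp

end Poles

/-- Coincidence of `ω ^ k * pt x` and `ω ^ l * pt y` forces `x = y` by the orbit hypothesis, and
then `k = l` because `ω` is primitive and `pt x ≠ 0`. -/
theorem polePos_injective {T : ℕ} {ω : ℂ} {X : Type*} {pt : X → ℂ} (hω : IsPrimitiveRoot ω T)
    (hpt : Function.Injective pt) (h0 : ∀ x, pt x ≠ 0)
    (h : ∀ (k : ℕ) x y, ω ^ k * pt x = pt y → pt x = pt y) :
    Function.Injective (polePos T ω pt) := by
  rcases Nat.eq_zero_or_pos T with rfl | hT
  · rintro (_ | ⟨k, _⟩) (_ | ⟨l, _⟩) _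
    · rfl
    · exact l.elim0
    · exact k.elim0
    · exact k.elim0
  have hω0 : ω ≠ 0 := hω.ne_zero (by omega)
  rintro (_ | ⟨k, x⟩) (_ | ⟨l, y⟩) e
  · rfl
  · exact absurd e.symm (mul_ne_zero (pow_ne_zero _ hω0) (h0 y))
  · exact absurd e (mul_ne_zero (pow_ne_zero _ hω0) (h0 x))
  · change ω ^ (k : ℕ) * pt x = ω ^ (l : ℕ) * pt y at e
    have hl : ω ^ (T - l) * ω ^ (l : ℕ) = 1 := by
      rw [← pow_add, Nat.sub_add_cancel l.2.le, hω.pow_eq_one]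
    have e' : ω ^ (T - l + k) * pt x = pt y := by
      rw [pow_add, mul_assoc, e, ← mul_assoc, hl, one_mul]
    obtain rfl := hpt (h _ _ _ e')
    have hkl : (k : ℕ) = l := hω.pow_inj k.2 l.2 (mul_right_cancel₀ (h0 x) e)
    rw [Fin.ext hkl]

/-! ### Comparison with the explicit formulas -/

section Explicit

variable {V W : Type*} [AddCommGroup V] [Module ℂ V] [AddCommGroup W] [Module ℂ W]

/-- With `ζ = ω ^ k`, passing from `1 / (ω^{-k} z - x) ^ (p + 1)` to `1 / (z - ω^k x) ^ (p + 1)`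
produces `ζ ^ (p + 1)`. The prefactor `ω^{-k}` of the Lax matrix reduces this to the `ζ ^ p` of
`rotSeq`. -/
theorem smul_tmul_smul_pow_succ {R : Type*} [CommRing R] [Algebra ℂ R] {ζ : ℂ} (hζ : ζ ≠ 0) (c : ℂ)
    (p : ℕ) (v : V) (r : R) :
    c • ((ζ⁻¹ • v) ⊗ₜ[ℂ] (ζ ^ (p + 1) • r)) = (c • ζ ^ p • v) ⊗ₜ[ℂ] r := by
  rw [← TensorProduct.smul_tmul', ← TensorProduct.smul_tmul', ← TensorProduct.smul_tmul',
    TensorProduct.tmul_smul, smul_smul ζ⁻¹, pow_succ', inv_mul_cancel_left₀ hζ]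

theorem crossPolar_rotSeq_right (B : V →ₗ[ℂ] V →ₗ[ℂ] W) (a c ω : ℂ) (σ : Module.End ℂ V) (l : ℕ)
    (f g : ℕ → V) (N M p : ℕ) :
    crossPolar B a c f (rotSeq (ω ^ l) (σ ^ l) g) N M p =
      ∑ q ∈ Finset.range M, ∑ s ∈ Finset.range N,
        (((q + s).choose s : ℂ) * (-1) ^ s * ω ^ (l * q) / (a - c) ^ (q + s + 1)) •
          B (f (p + s)) ((σ ^ l) (g q)) := by
  simp only [crossPolar, rotSeq, map_smul, smul_smul, ← pow_mul, div_mul_eq_mul_div]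

-- The excluded pair `(0, x)` may be put back, as its term is `0` by `crossPolar_self`. For `y = 0`
-- the summand does not depend on `l`, by `rotSeq_eq_self`, which yields the factor `T`.
open Classical in
theorem sum_insert_eq_dihedralPolar {B : V →ₗ[ℂ] V →ₗ[ℂ] W} {σ : Module.End ℂ V} {T : ℕ} {ω : ℂ}
    (hω : ω ≠ 0) {S : Finset ℂ} (hS : (0 : ℂ) ∉ S) {A : ℂ → ℕ → V}
    (hA₀ : ∀ p, σ (A 0 p) = ω⁻¹ ^ p • A 0 p) {N : ℂ → ℕ} (d : ℕ → V) (Q : ℕ) (x : S) (p : ℕ) :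
    (∑ l ∈ Finset.range T, ∑ y ∈ insert 0 S, if (l, y) = (0, (x : ℂ)) then 0 else
      ∑ q ∈ Finset.range (N y), ∑ s ∈ Finset.range (N x),
        (((q + s).choose s : ℂ) * (-1) ^ s * ω ^ (l * q) / (x - ω ^ l * y) ^ (q + s + 1)) •
          B (A x (p + s)) ((σ ^ l) (A y q)))
    - (T : ℂ) • mixedPolar B x (A x) d (N x) Q p + (1 / 2 : ℂ) • selfPolar B (A x) p =
    dihedralPolar B σ T ω (fun x : S => (x : ℂ)) (fun x : S => A x) (A 0) d (fun x : S => N x)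
      (N 0) Q x p := by
  rw [dihedralPolar]
  congr 2
  have h : ∀ (l : ℕ) (y : ℂ), (if (l, y) = (0, (x : ℂ)) then 0 else
      ∑ q ∈ Finset.range (N y), ∑ s ∈ Finset.range (N x),
        (((q + s).choose s : ℂ) * (-1) ^ s * ω ^ (l * q) / (x - ω ^ l * y) ^ (q + s + 1)) •
          B (A x (p + s)) ((σ ^ l) (A y q))) =
      crossPolar B x (ω ^ l * y) (A x) (rotSeq (ω ^ l) (σ ^ l) (A y)) (N x) (N y) p := by
    intro l y
    split_ifs with hl
    · obtain ⟨rfl, rfl⟩ := Prod.mk.inj hl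
      rw [pow_zero, one_mul, crossPolar_self]
    · rw [crossPolar_rotSeq_right]
  simp only [h]
  rw [Finset.sum_congr rfl fun l _ => Finset.sum_insert hS, Finset.sum_add_distrib, add_comm]
  congr 1
  · exact Finset.sum_congr rfl fun l _ => (Finset.sum_coe_sort S _).symm
  · simp only [rotSeq_eq_self hω hA₀, mul_zero, Finset.sum_const, Finset.card_range,
      Nat.cast_smul_eq_nsmul]

/-- Only a sign is involved: `(-1) ^ s` divided by `(-1) ^ (q + s + 1)` is `(-1) ^ (q + 1)`. -/
theorem crossPolar_zero_left (B : V →ₗ[ℂ] V →ₗ[ℂ] W) {a : ℂ} (ha : a ≠ 0) (f g : ℕ → V)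
    (N M p : ℕ) : crossPolar B 0 a f g N M p =
      ∑ q ∈ Finset.range M, ∑ s ∈ Finset.range N,
        ((-1) ^ (q + 1) * ((q + s).choose s : ℂ) / a ^ (q + s + 1)) • B (f (p + s)) (g q) := by
  refine Finset.sum_congr rfl fun q _ => Finset.sum_congr rfl fun s _ => ?_
  congr 1
  have h2 : (-1 : ℂ) ^ (q + 1) * (-1) ^ (q + 1) = 1 := by rw [← mul_pow]; simp
  have h3 : (-1 : ℂ) ^ (q + s + 1) = (-1) ^ (q + 1) * (-1) ^ s := by ring
  rw [zero_sub, neg_pow a, h3, div_eq_div_iff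
    (mul_ne_zero (mul_ne_zero (by simp) (by simp)) (pow_ne_zero _ ha)) (pow_ne_zero _ ha)]
  linear_combination (-((q + s).choose s : ℂ) * (-1) ^ s * a ^ (q + s + 1)) * h2

/-- At `a = 0` only `s = q` survives: the binomial kills `s > q` and the power of `0` kills `s < q`.
-/
theorem mixedPolar_zero {B : V →ₗ[ℂ] V →ₗ[ℂ] W} {f d : ℕ → V} {N Q p : ℕ}
    (hf : ∀ p, N ≤ p → f p = 0) :
    mixedPolar B 0 f d N Q p = ∑ q ∈ Finset.range Q, B (f (p + q)) (d q) := by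
  refine Finset.sum_congr rfl fun q _ => ?_
  rw [Finset.sum_eq_single q]
  · simp
  · intro s _ hs
    rcases Nat.lt_or_ge q s with h | h
    · rw [Nat.choose_eq_zero_of_lt h]; simp
    · rw [zero_pow (by omega)]; simp
  -- If `s = q` is outside the summation range, then `q ≥ N` and the field `f (p + q)` itself
  -- vanishes.
  · intro hq
    rw [hf _ (by rw [Finset.mem_range] at hq; omega)]
    simp

theorem mixedRegular_zero {B : V →ₗ[ℂ] V →ₗ[ℂ] W} {f d : ℕ → V} {N Q r : ℕ}
    (hd : ∀ q, Q ≤ q → d q = 0) :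
    mixedRegular B 0 f d N Q r = ∑ p ∈ Finset.range N, B (f p) (d (r + p + 1)) := by
  refine Finset.sum_congr rfl fun p _ => ?_
  rw [Finset.sum_eq_single p]
  · simp
  · intro s _ hs
    rcases Nat.lt_or_ge s p with h | h
    · rw [Nat.choose_eq_zero_of_lt h]; simp
    · rw [zero_pow (by omega)]; simp
  · intro hp
    rw [hd _ (by rw [Finset.mem_range] at hp; omega)]
    simp

theorem sum_eq_zeroPolar {B : V →ₗ[ℂ] V →ₗ[ℂ] W} (hB : ∀ x y, B x y = B y x) {S : Finset ℂ}
    (hS : (0 : ℂ) ∉ S) (A : ℂ → ℕ → V) {A₀ : ℕ → V} (d : ℕ → V) (N : ℂ → ℕ) {N₀ : ℕ}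
    (hA₀ : ∀ p, N₀ ≤ p → A₀ p = 0) (Q p : ℕ) :
    (∑ x ∈ S, ∑ q ∈ Finset.range (N x), ∑ s ∈ Finset.range N₀,
      ((-1) ^ (q + 1) * ((q + s).choose s : ℂ) / x ^ (q + s + 1)) • B (A₀ (p + s)) (A x q))
    - ∑ q ∈ Finset.range Q, B (A₀ (p + q)) (d q)
    + (1 / 2 : ℂ) • ∑ q ∈ Finset.range p, B (A₀ (p - q - 1)) (A₀ q) =
    ∑ x : S, crossPolar B 0 x A₀ (A x) N₀ (N x) p - mixedPolar B 0 A₀ d N₀ Q p +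
      (1 / 2 : ℂ) • selfPolar B A₀ p := by
  rw [← Finset.sum_coe_sort, mixedPolar_zero hA₀]
  congr 1
  · congr 1
    exact Finset.sum_congr rfl fun x _ =>
      (crossPolar_zero_left B (fun h => hS (h ▸ x.2)) _ _ _ _ _).symm
  · congr 1
    exact Finset.sum_congr rfl fun q _ => hB _ _

theorem sum_eq_inftyRegular {B : V →ₗ[ℂ] V →ₗ[ℂ] W} {S : Finset ℂ} (A : ℂ → ℕ → V) (A₀ : ℕ → V)
    {AI : ℕ → V} (N : ℂ → ℕ) (N₀ : ℕ) {Q : ℕ} (hAI : ∀ q, Q ≤ q → AI (q + 1) = 0) (r : ℕ) :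
    -(∑ x ∈ S, ∑ p ∈ Finset.range (N x), ∑ s ∈ Finset.range Q,
      ((s.choose p : ℂ) * x ^ (s - p)) • B (A x p) (AI (r + s + 2)))
    - ∑ p ∈ Finset.range N₀, B (A₀ p) (AI (r + p + 2))
    + (1 / 2 : ℂ) • ∑ p ∈ Finset.range (r + 1), B (AI (p + 1)) (AI (r - p + 1)) =
    -(∑ x : S, mixedRegular B x (A x) (fun q => AI (q + 1)) (N x) Q r) -
      mixedRegular B 0 A₀ (fun q => AI (q + 1)) N₀ Q r +
      (1 / 2 : ℂ) • selfRegular B (fun q => AI (q + 1)) r := by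
  rw [← Finset.sum_coe_sort, mixedRegular_zero hAI]
  rfl

/-- Half the square of a Lax matrix which is equivariant under the rotations of order `T`. -/
theorem half_pairExt_self_of_equivariant {R : Type*} [CommRing R] [Algebra ℂ R]
    {B : V →ₗ[ℂ] V →ₗ[ℂ] W} (hB : ∀ x y, B x y = B y x) {σ : Module.End ℂ V}
    (hBσ : ∀ x y, B (σ x) (σ y) = B x y) {T : ℕ} (hT : 1 ≤ T) (hσ : σ ^ T = 1) {ω : ℂ}
    (hω : IsPrimitiveRoot ω T) {S : Finset ℂ} (hS : (0 : ℂ) ∉ S)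
    (hSω : ∀ (k : ℕ) (x y : S), ω ^ k * (x : ℂ) = y → (x : ℂ) = y) {A : ℂ → ℕ → V} {A₀ d : ℕ → V}
    {N : ℂ → ℕ} {N₀ Q : ℕ} (hA : ∀ x p, N x ≤ p → A x p = 0) (hA₀ : ∀ p, N₀ ≤ p → A₀ p = 0)
    (hd : ∀ q, Q ≤ q → d q = 0) (hσA₀ : ∀ p, σ (A₀ p) = ω⁻¹ ^ p • A₀ p)
    (hσd : ∀ q, σ (d q) = ω ^ (q + 1) • d q) {rot pole : ℕ → S → ℕ → R}
    {zero : ℕ → 0 < N₀ → R} {mon : ℕ → R} (hmon : ∀ q, mon q = mon 1 ^ q)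
    (hpole : ∀ k x m, pole k x m = pole k x 1 ^ m)
    (hpole' : ∀ k x, pole k x 1 * (mon 1 - algebraMap ℂ R (ω ^ k * x)) = 1)
    (hrot : ∀ k x m, rot k x m = (ω ^ k) ^ m • pole k x 1 ^ m)
    (hzero : ∀ m h, zero m h = zero 1 h ^ m)
    (hzero' : ∀ h, zero 1 h * (mon 1 - algebraMap ℂ R 0) = 1) {L : V ⊗[ℂ] R}
    (hL : L = (1 / (T : ℂ)) • ∑ k ∈ Finset.range T, ∑ x : S, ∑ p ∈ Finset.range (N x),
        ((ω ^ k)⁻¹ • (σ ^ k) (A x p)) ⊗ₜ[ℂ] rot k x (p + 1)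
      + ∑ p : Fin N₀, A₀ p ⊗ₜ[ℂ] zero (p + 1) (by have := p.2; omega)
      - ∑ q ∈ Finset.range Q, d q ⊗ₜ[ℂ] mon q)
    {HP : ℂ → ℕ → W} {H₀ HI : ℕ → W} {M : ℕ} (hM : M = 2 * Q - 1)
    (hHP : ∀ (x : S) p, HP x p = dihedralPolar B σ T ω (fun x : S => (x : ℂ)) (fun x : S => A x) A₀
      d (fun x : S => N x) N₀ Q x p)
    (hH₀ : ∀ p, H₀ p = ∑ x : S, crossPolar B 0 x A₀ (A x) N₀ (N x) p - mixedPolar B 0 A₀ d N₀ Q p +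
      (1 / 2 : ℂ) • selfPolar B A₀ p)
    (hHI : ∀ r, HI r = -(∑ x : S, mixedRegular B x (A x) d (N x) Q r) -
      mixedRegular B 0 A₀ d N₀ Q r + (1 / 2 : ℂ) • selfRegular B d r) :
    (1 / 2 : ℂ) • pairExt R B L L =
      (1 / (T : ℂ) ^ 2) • ∑ k ∈ Finset.range T, ∑ x : S, ∑ p ∈ Finset.range (2 * N x),
          (ω ^ ((k : ℤ) * ((p : ℤ) - 1)) • HP x p) ⊗ₜ[ℂ] pole k x (p + 1)
        + ∑ p : Fin (2 * N₀), (if (p : ℕ) ≡ 1 [MOD T] then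
            H₀ p ⊗ₜ[ℂ] zero (p + 1) (by have := p.2; omega) else 0)
        + ∑ q ∈ Finset.range M, (if q + 2 ≡ 0 [MOD T] then
            HI q ⊗ₜ[ℂ] mon q else 0) := by
  subst hM
  have hω0 : ω ≠ 0 := hω.ne_zero (by omega)
  set u : Option (Fin T × S) → R := fun j => j.elim (if h : 0 < N₀ then zero 1 h else 0)
    (fun kx => pole kx.1 kx.2 1) with hu
  have hnone : ∀ m h, u none ^ m = zero m h := fun m h => by
    rw [hzero]
    change (if h : 0 < N₀ then zero 1 h else 0) ^ m = _
    rw [dif_pos h]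
  have hinj : Function.Injective (polePos T ω (fun x : S => (x : ℂ))) :=
    polePos_injective hω Subtype.val_injective (fun x h => hS (h ▸ x.2)) hSω
  have hL' : L = ∑ j, ∑ p ∈ Finset.range (poleMult T (fun x : S => N x) N₀ j),
      poleSeq T ω σ (fun x : S => A x) A₀ j p ⊗ₜ[ℂ] (u j ^ (p + 1)) -
      ∑ q ∈ Finset.range Q, d q ⊗ₜ[ℂ] (mon 1 ^ q) := by
    rw [hL]
    simp only [← hmon]
    congr 1
    rw [Fintype.sum_option, add_comm, Fintype.sum_prod_type]
    congr 1
    · change _ = ∑ p ∈ Finset.range N₀, A₀ p ⊗ₜ[ℂ] (u none ^ (p + 1))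
      rw [Finset.sum_range]
      exact Finset.sum_congr rfl fun p _ => by rw [hnone]
    · rw [Finset.sum_range, Finset.smul_sum]
      refine Finset.sum_congr rfl fun k _ => ?_
      rw [Finset.smul_sum]
      refine Finset.sum_congr rfl fun x _ => ?_
      rw [Finset.smul_sum]
      refine Finset.sum_congr rfl fun p _ => ?_
      rw [hrot]
      exact smul_tmul_smul_pow_succ (pow_ne_zero _ hω0) _ p _ _
  refine (half_pairExt_self hB hinj (fun j hj => ?_) ?_ hd hL').trans ?_
  · rcases j with _ | ⟨k, x⟩
    · have h : 0 < N₀ := Nat.pos_of_ne_zero hj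
      rw [← pow_one (u none), hnone 1 h]
      exact hzero' h
    · exact hpole' k x
  · rintro (_ | ⟨k, x⟩) p h
    · exact hA₀ p h
    · change _ • _ • (σ ^ (k : ℕ)) (A x p) = _
      rw [hA x p h, map_zero, smul_zero, smul_zero]
  congr 1
  · rw [Fintype.sum_option, add_comm, Fintype.sum_prod_type]
    congr 1
    · rw [Finset.sum_range, Finset.smul_sum]
      refine Finset.sum_congr rfl fun k _ => ?_
      rw [Finset.smul_sum]
      refine Finset.sum_congr rfl fun x _ => ?_
      rw [Finset.smul_sum]
      refine Finset.sum_congr rfl fun p _ => ?_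
      -- The weight `(ω ^ k) ^ p * (ω ^ k)⁻¹` is recognised as the integer power `ω ^ (k * (p -
      -- 1))`, where `p - 1` may be `-1`.
      rw [polarCoeff_some hT hω.pow_eq_one hBσ hσ hσA₀ hσd, ← hHP, hpole,
        ← TensorProduct.smul_tmul', zpow_mul, zpow_sub₀ (zpow_ne_zero _ hω0), zpow_natCast,
        zpow_natCast, zpow_one, div_eq_mul_inv]
      rfl
    · change ∑ p ∈ Finset.range (2 * N₀), _ = _
      rw [Finset.sum_range]
      refine Finset.sum_congr rfl fun p _ => ?_
      rw [polarCoeff_none hT hω hBσ hσA₀ hσd, ← hH₀, hnone _ (by have := p.2; omega)]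
      split_ifs
      · rfl
      · rw [TensorProduct.zero_tmul]
  · refine Finset.sum_congr rfl fun q _ => ?_
    rw [regularCoeff_poles hT hω hBσ hσA₀ hσd, ← hHI, ← hmon]
    split_ifs
    · rfl
    · rw [TensorProduct.zero_tmul]

end Explicit

namespace GaudinData

variable {𝔤 : Type*} [LieRing 𝔤] [LieAlgebra ℂ 𝔤] (G : GaudinData 𝔤)

/-! ### Rational functions -/

theorem frac_pow (a c : ℂ) (m : ℕ) (h : ∀ w, a * w = c → w ∈ G.orbit) :
    G.frac a c m h = G.frac a c 1 h ^ m := by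
  refine Subtype.ext ?_
  change _ / _ = (_ / _) ^ m
  rw [div_pow, pow_one, map_pow, map_one, one_pow]

/-- The relation `u * (Z - a) = 1` is the only property of rational functions that the partial
fraction expansions require. -/
theorem frac_one_mul_sub (c : ℂ) (h : ∀ w, 1 * w = c → w ∈ G.orbit) :
    G.frac 1 c 1 h * (G.zpow 1 - algebraMap ℂ G.R c) = 1 := by
  refine Subtype.ext ?_
  change algebraMap (Polynomial ℂ) (RatFunc ℂ) 1 / algebraMap (Polynomial ℂ) (RatFunc ℂ)
    ((Polynomial.C 1 * Polynomial.X - Polynomial.C c) ^ 1) *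
      (RatFunc.X ^ 1 - algebraMap ℂ (RatFunc ℂ) c) = 1
  have e : RatFunc.X ^ 1 - algebraMap ℂ (RatFunc ℂ) c = algebraMap (Polynomial ℂ) (RatFunc ℂ)
      ((Polynomial.C 1 * Polynomial.X - Polynomial.C c) ^ 1) := by
    rw [pow_one, pow_one, map_sub, map_mul, map_one, map_one, one_mul, RatFunc.algebraMap_X,
      RatFunc.algebraMap_C, RatFunc.algebraMap_eq_C]
  rw [e, map_one]
  refine div_mul_cancel₀ 1 ?_
  rw [← e, pow_one, ← RatFunc.algebraMap_X, RatFunc.algebraMap_eq_C, ← RatFunc.algebraMap_C,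
    ← map_sub]
  exact RatFunc.algebraMap_ne_zero (Polynomial.X_sub_C_ne_zero c)

theorem fracPt_pow (k : ℕ) (x : G.Zp) (m : ℕ) : G.fracPt k x m = G.fracPt k x 1 ^ m :=
  G.frac_pow _ _ _ _

theorem fracZero_pow (m : ℕ) (h : 0 < G.n 0) : G.fracZero m h = G.fracZero 1 h ^ m :=
  G.frac_pow _ _ _ _

theorem zpow_pow (q : ℕ) : G.zpow q = G.zpow 1 ^ q := by
  refine Subtype.ext ?_
  change RatFunc.X ^ q = (RatFunc.X ^ 1) ^ q
  rw [pow_one]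

/-- Comes from the factorisation `z - ω^k x = ω^k (ω^{-k} z - x)`. -/
theorem fracRot_eq (k : ℕ) (x : G.Zp) (m : ℕ) :
    G.fracRot k x m = (G.ω ^ k) ^ m • G.fracPt k x 1 ^ m := by
  have hk : G.ω ^ k ≠ 0 := pow_ne_zero _ G.ω_ne_zero
  have h : G.fracRot k x 1 = G.ω ^ k • G.fracPt k x 1 := by
    refine Subtype.ext ?_
    change algebraMap (Polynomial ℂ) (RatFunc ℂ) 1 / algebraMap (Polynomial ℂ) (RatFunc ℂ)
      ((Polynomial.C (G.ω ^ k)⁻¹ * Polynomial.X - Polynomial.C (x : ℂ)) ^ 1) =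
      G.ω ^ k • (algebraMap (Polynomial ℂ) (RatFunc ℂ) 1 / algebraMap (Polynomial ℂ) (RatFunc ℂ)
      ((Polynomial.C 1 * Polynomial.X - Polynomial.C (G.ω ^ k * (x : ℂ))) ^ 1))
    have e : Polynomial.C 1 * Polynomial.X - Polynomial.C (G.ω ^ k * (x : ℂ)) =
        Polynomial.C (G.ω ^ k) *
          (Polynomial.C (G.ω ^ k)⁻¹ * Polynomial.X - Polynomial.C (x : ℂ)) := by
      rw [mul_sub, ← mul_assoc, ← Polynomial.C_mul, ← Polynomial.C_mul, mul_inv_cancel₀ hk]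
    have hC : RatFunc.C (G.ω ^ k) ≠ 0 := (map_ne_zero _).2 hk
    rw [pow_one, pow_one, e, map_mul, RatFunc.algebraMap_C, Algebra.smul_def,
      RatFunc.algebraMap_eq_C, map_one]
    rw [mul_one_div, div_mul_eq_div_div, div_self hC]
  rw [← smul_pow, ← h]
  exact G.frac_pow _ _ _ _

/-! ### The Hamiltonians as partial fraction coefficients -/

section Hamiltonians

variable {ι : Type*} [Fintype ι] [DecidableEq ι] (b : Module.Basis ι ℂ 𝔤)

theorem A_zero_eq_zero (p : ℕ) (h : G.n 0 ≤ p) : G.A b 0 p = 0 :=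
  G.A_eq_zero b 0 p (by rwa [mult_zero])

theorem hamPt_eq (x : G.Zp) (p : ℕ) : G.hamPt b x p =
    dihedralPolar G.pair G.sigF G.T G.ω (fun x : G.Zp => (x : ℂ)) (fun x : G.Zp => G.A b x)
      (G.A b 0) (fun q => G.AInf b (q + 1)) (fun x : G.Zp => G.mult x) (G.n 0) (G.nInf - 1) x p := by
  -- In `hamPt` the point `0` is one of the `y`, with range `mult 0` rather than `n 0`.
  rw [← mult_zero]
  exact sum_insert_eq_dihedralPolar G.ω_ne_zero G.zero_notMem_Zp (G.sigF_A_zero b) _ _ x p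

theorem hamZero_eq (p : ℕ) : G.hamZero b p =
    ∑ x : G.Zp, crossPolar G.pair 0 x (G.A b 0) (G.A b x) (G.n 0) (G.mult x) p -
      mixedPolar G.pair 0 (G.A b 0) (fun q => G.AInf b (q + 1)) (G.n 0) (G.nInf - 1) p +
      (1 / 2 : ℂ) • selfPolar G.pair (G.A b 0) p := by
  exact sum_eq_zeroPolar G.pair_symm G.zero_notMem_Zp (G.A b) _ G.mult (G.A_zero_eq_zero b) _ p

theorem hamInf_eq (r : ℕ) : G.hamInf b r =
    -(∑ x : G.Zp, mixedRegular G.pair x (G.A b x) (fun q => G.AInf b (q + 1)) (G.mult x)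
        (G.nInf - 1) r) -
      mixedRegular G.pair 0 (G.A b 0) (fun q => G.AInf b (q + 1)) (G.n 0) (G.nInf - 1) r +
      (1 / 2 : ℂ) • selfRegular G.pair (fun q => G.AInf b (q + 1)) r := by
  exact sum_eq_inftyRegular (G.A b) (G.A b 0) G.mult (G.n 0)
    (fun q hq => G.AInf_eq_zero b (q + 1) (by omega)) r

end Hamiltonians

end GaudinData

/-! ### The generating function of the Hamiltonians -/

theorem mainTheorem9 {𝔤 : Type*} [LieRing 𝔤] [LieAlgebra ℂ 𝔤] (G : GaudinData 𝔤)
    {ι : Type*} [Fintype ι] [DecidableEq ι] (b : Module.Basis ι ℂ 𝔤) :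
    (1 / 2 : ℂ) • G.pairR (G.lax b) (G.lax b) =
      (1 / (G.T : ℂ) ^ 2) • ∑ k ∈ Finset.range G.T, ∑ x : G.Zp, ∑ p ∈ Finset.range (2 * G.mult x),
          (G.ω ^ ((k : ℤ) * ((p : ℤ) - 1)) • G.hamPt b x p) ⊗ₜ[ℂ] G.fracPt k x (p + 1)
        + ∑ p : Fin (2 * G.n 0), (if (p : ℕ) ≡ 1 [MOD G.T] then
            G.hamZero b p ⊗ₜ[ℂ] G.fracZero (p + 1) (by have := p.2; omega) else 0)
        + ∑ q ∈ Finset.range (2 * G.nInf - 3), (if q + 2 ≡ 0 [MOD G.T] then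
            G.hamInf b q ⊗ₜ[ℂ] G.zpow q else 0) := by
  -- The polynomial part of the Lax matrix has `Q = nInf - 1` terms, `d q = 𝒜^∞_{q+1}`, so its
  -- square runs over `2 * Q - 1 = 2 * nInf - 3` exponents. Both sides are `0` when `nInf = 1`.
  exact half_pairExt_self_of_equivariant G.pair_symm G.pair_sigF G.T_pos G.sigF_pow_T G.ω_prim
    G.zero_notMem_Zp (fun _ x y h => G.eq_of_ω_pow_mul_eq x.2 y.2 h) (G.A_eq_zero b)
    (G.A_zero_eq_zero b) (fun q hq => G.AInf_eq_zero b (q + 1) (by omega)) (G.sigF_A_zero b)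
    (fun q => G.sigF_AInf b (q + 1)) G.zpow_pow G.fracPt_pow
    (fun k x => G.frac_one_mul_sub (G.ω ^ k * x) _) G.fracRot_eq G.fracZero_pow
    (fun h => G.frac_one_mul_sub 0 _) (L := G.lax b) (zero := G.fracZero) rfl (by omega)
    (G.hamPt_eq b) (G.hamZero_eq b) (G.hamInf_eq b)
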